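/- **Setting.** Let $s\in\mathbb C^*$ be such that $q=s^2$ is not a root of unity (half-integral powers of $q$ are powers of $s$). Write $[n]=(q^n-q^{-n})/(q-q^{-1})$. For $n\in\mathbb N$ let $V_n$ be the irreducible representation of $\mathcal U_q(sl_2)$ with basis $e_0,\dots,e_n$ and $Ke_i=q^{n-2i}e_i$, $Ee_i=[n-i+1]e_{i-1}$, $Fe_i=[i+1]e_{i+1}$; the coproduct is $\Delta K=K\otimes K$, $\Delta E=E\otimes K+1\otimes E$, $\Delta F=F\otimes1+K^{-1}\otimes F$. Let $$R=q^{H\otimes H/2}\sum_{k\ge0}\frac{q^{k(k-1)/2}(q-q^{-1})^k}{[k]!}\,E^k\otimes F^k ,\qquad K=q^H,$$ let $v_n=q^{-n(n+2)/2}$ be the value of the ribbon element on $V_n$ and let $\mu=K$. Call $(a,b,c)$ admissible if $V_c$ occurs in $V_a\otimes V_b$, i.e. if $a+b+c$ is even and $|a-b|\le c\le a+b$. Fix intertwiners $\phi^{ab}_c:V_c\to V_a\otimes V_b$ and $\psi_{ab}^c:V_a\otimes V_b\to V_c$, zero unless $(a,b,c)$ is admissible, with $\psi^c_{ab}\phi^{ab}_{d}=\delta_{c,d}\,\mathrm{id}$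 for $(a,b,c)$ admissible, $\sum_c\phi^{ab}_c\psi_{ab}^c=\mathrm{id}$, and $P_{12}R=\sum_c (v_av_b/v_c)^{1/2}\,\phi^{ba}_c\psi_{ab}^c$ on $V_a\otimes V_b$, where $P_{12}$ is the flip and $(v_av_b/v_c)^{1/2}=(-1)^{(a+b-c)/2}q^{(c(c+2)-a(a+2)-b(b+2))/4}$. Let $\Gamma$ be the algebra generated by the entries of the matrices $\overset{n}{g}$ and $S(\overset{n}{g})$, $n\in\mathbb N$, subject to $\overset{a}{g}_1\overset{b}{g}_2=\sum_c\phi^{ab}_c\,\overset{c}{g}\,\psi^c_{ab}$, $\overset{0}{g}=1$, and $S(\overset{n}{g})$ is the inverse matrix of $\overset{n}{g}$. Let a finite simple graph be given, with vertex set $\mathcal V$ and with a ciliation: at each vertex $z$ a strict linear order $<_c$ on the edges at $z$. Every edge carries two opposite links; $(xy)$ denotes the link with departure point $y$ and end point $x$. The algebra $\Lambda$ of gauge fields is generated by the entries of the matrices $\overset{n}{u}(l)$, for all links $l$ and all $n\in\mathbb N$, subject to: whenever $xy<_cyz$ at a vertex $y$, $$R_{12}\,\overset{a}{u}(yx)_1\overset{b}{u}(yz)_2=\overset{b}{u}(yz)_2\overset{a}{u}(yx)_1,\quad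 \overset{a}{u}(xy)_1R_{12}^{-1}\,\overset{b}{u}(yz)_2=\overset{b}{u}(yz)_2\overset{a}{u}(xy)_1,\quad \overset{a}{u}(xy)_1\overset{b}{u}(zy)_2R_{12}=\overset{b}{u}(zy)_2\overset{a}{u}(xy)_1;$$ $\overset{a}{u}(xy)_1\overset{b}{u}(zt)_2=\overset{b}{u}(zt)_2\overset{a}{u}(xy)_1$ when $x,y,z,t$ are pairwise distinct; $\overset{n}{u}(xy)\overset{n}{u}(yx)=1$; $\overset{a}{u}(l)_1\overset{b}{u}(l)_2=\sum_c\phi^{ab}_c\overset{c}{u}(l)\psi_{ba}^cP_{12}$; $\overset{0}{u}(l)=1$. Let $\hat\Gamma=\bigotimes_{z\in\mathcal V}\Gamma$, let $\overset{n}{g}_z$ be the matrix $\overset{n}{g}$ over the $z$-th factor, and let the gauge coaction be the algebra morphism $\Omega:\Lambda\to\Lambda\otimes\hat\Gamma$ with $\Omega(\overset{n}{u}(xy))=\overset{n}{g}_x\,\overset{n}{u}(xy)\,S(\overset{n}{g}_y)$. The integral $\int dh$ is the nonzero linear form $h$ on $\Lambda$ with $(h\otimes\mathrm{id})\Omega(A)=h(A)\otimes1$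 for all $A$, and with $h(AB)=h(A)h(B)$ whenever $A\in\Lambda_X$, $B\in\Lambda_Y$ and $(X\cup -X)\cap(Y\cup -Y)=\emptyset$, where $\Lambda_X$ is the subalgebra generated by the $\overset{n}{u}(l)$, $l\in X$. **In and Out states.** Let $\mathcal C=[x_{n+1}=x_1,x_n,\dots,x_1]$ be a simple loop in the graph (the $x_i$ are distinct, consecutive ones adjacent, indices modulo $n$) such that $x_{i-1}x_i<_cx_ix_{i+1}$ at every $x_i$. Let $\alpha_i$ be the label of the strand emerging at $x_i$, and let $\beta_1,\dots,\beta_n\in\mathbb N$. With $u_{[x,y]}=u(xy)$, put $$\mathcal O(\alpha,\beta)=v_{\beta_n}^{-1}\,\mathrm{tr}_{V_{\beta_n}}\!\big(\psi^{\beta_n}_{\beta_1\alpha_1}\overset{\beta_1}{u}_{[x_1,x_2]}\psi^{\beta_1}_{\beta_2\alpha_2}\cdots\psi^{\beta_{n-1}}_{\beta_n\alpha_n}\overset{\beta_n}{u}_{[x_n,x_1]}\,R_{\beta_n\alpha_1}^{-1}\,\mu_{\beta_n}\big),$$ $$\mathcal I(\alpha,\beta)=v_{\beta_n}\,\mathrm{tr}_{V_{\beta_n}}\!\big(\mu_{\beta_n}R_{\beta_n\alpha_1}\overset{\beta_n}{u}_{[x_1,x_n]}\phi^{\beta_n\alpha_n}_{\beta_{n-1}}\cdots\phi^{\beta_2\alpha_2}_{\beta_1}\overset{\beta_1}{u}_{[x_2,x_1]}\phi_{\beta_n}^{\beta_1\alpha_1}\big),$$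 so that $\mathcal O(\alpha,\beta)$ has components $\mathcal O_a\in\Lambda$ and $\mathcal I(\alpha,\beta)$ has components $\mathcal I^a\in\Lambda$, indexed by the basis vectors $a=(a_i)$ of $\bigotimes_iV_{\alpha_i}$. **Lemma.** (1) (Cyclicity) The states $\mathcal O$ and $\mathcal I$ do not change if the numbering of $(x_i,\alpha_i,\beta_i)$ is shifted cyclically, i.e. if $(x_n,\alpha_n,\beta_n)$ becomes the first triple. (2) (Gauge transformation) $$\Omega(\mathcal O)=\mathcal O\,\prod_{i=1}^nS(\overset{\alpha_i}{g}_{x_i}),\qquad \Omega(\mathcal I)=\prod_{i=1}^n\overset{\alpha_i}{g}_{x_i}\;\mathcal I,$$ i.e. $\Omega(\mathcal O_a)=\sum_b\mathcal O_b\otimes\prod_iS(\overset{\alpha_i}{g}_{x_i})^{b_i}_{a_i}$ and $\Omega(\mathcal I^a)=\sum_b\mathcal I^b\otimes\prod_i(\overset{\alpha_i}{g}_{x_i})^{a_i}_{b_i}$. (3) (Scalar product) If $(\beta_i,\alpha_i,\beta_{i-1})$ is admissible for all $i$, then for all $\beta'$ $$\int dh\;\mathrm{tr}\big(\sigma_{\mathcal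 C}\,\mathcal O(\alpha,\beta)\,\mathcal I(\alpha,\beta')\big)=\int dh\,\sum_a\mathcal O(\alpha,\beta)_a\,\mathcal I(\alpha,\beta')^a=\prod_{i=1}^n\delta_{\beta_i,\beta'_i}.$$ -/

import Mathlib

open scoped TensorProduct

noncomputable section

namespace LatticeGauge

/-! ### Spin representations of `U_q(sl₂)`, with `q = s ^ 2`

The irreducible representation of spin `n / 2` has the basis `e_0, …, e_n`, with
`K e_i = q ^ (n - 2 i) e_i`, `E e_i = [n - i + 1] e_{i-1}`, `F e_i = [i + 1] e_{i+1}`.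
The coproduct is `Δ K = K ⊗ K`, `Δ E = E ⊗ K + 1 ⊗ E`, `Δ F = F ⊗ 1 + K⁻¹ ⊗ F`. -/

/-- Index set of the basis of the representation with label `n` (dimension `n + 1`). -/
abbrev Idx (n : ℕ) : Type := Fin (n + 1)

theorem idx_zero_eq (i j : Idx 0) : i = j := Fin.ext (by omega)

/-- The quantum integer `[n] = (q ^ n - q ^ (-n)) / (q - q ^ (-1))`. -/
def qInt (s : ℂ) (n : ℕ) : ℂ :=
  ((s ^ 2) ^ n - ((s ^ 2) ^ n)⁻¹) / (s ^ 2 - (s ^ 2)⁻¹)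

/-- The quantum factorial. -/
def qFact (s : ℂ) (n : ℕ) : ℂ := ∏ k ∈ Finset.range n, qInt s (k + 1)

/-- The weight of the basis vector `e_i`. -/
def wt (n : ℕ) (i : Idx n) : ℤ := (n : ℤ) - 2 * (i : ℤ)

def repK (s : ℂ) (n : ℕ) : Matrix (Idx n) (Idx n) ℂ :=
  Matrix.diagonal fun i => (s ^ 2) ^ wt n i

def repKinv (s : ℂ) (n : ℕ) : Matrix (Idx n) (Idx n) ℂ :=
  Matrix.diagonal fun i => (s ^ 2) ^ (-wt n i)

def repE (s : ℂ) (n : ℕ) : Matrix (Idx n) (Idx n) ℂ :=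
  Matrix.of fun i j => if (i : ℕ) + 1 = j then qInt s (n - i) else 0

def repF (s : ℂ) (n : ℕ) : Matrix (Idx n) (Idx n) ℂ :=
  Matrix.of fun i j => if (i : ℕ) = j + 1 then qInt s i else 0

/-- `M ⊗ 1`, the matrix `M` acting on the first leg of `V_a ⊗ V_b`. -/
def leg₁ {A : Type*} [Zero A] {a : ℕ} (b : ℕ) (M : Matrix (Idx a) (Idx a) A) :
    Matrix (Idx a × Idx b) (Idx a × Idx b) A :=
  Matrix.of fun p r => if p.2 = r.2 then M p.1 r.1 else 0

/-- `1 ⊗ M`, the matrix `M` acting on the second leg of `V_a ⊗ V_b`. -/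
def leg₂ {A : Type*} [Zero A] (a : ℕ) {b : ℕ} (M : Matrix (Idx b) (Idx b) A) :
    Matrix (Idx a × Idx b) (Idx a × Idx b) A :=
  Matrix.of fun p r => if p.1 = r.1 then M p.2 r.2 else 0

/-- A complex matrix, seen as a matrix over the `ℂ`-algebra `A`. -/
def const (A : Type*) [Semiring A] [Algebra ℂ A] {m n : Type*} (M : Matrix m n ℂ) :
    Matrix m n A :=
  M.map (algebraMap ℂ A)

/-- The action of `K`, `E`, `F` on `V_a ⊗ V_b`. -/
def tensK (s : ℂ) (a b : ℕ) : Matrix (Idx a × Idx b) (Idx a × Idx b) ℂ :=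
  leg₁ b (repK s a) * leg₂ a (repK s b)

def tensE (s : ℂ) (a b : ℕ) : Matrix (Idx a × Idx b) (Idx a × Idx b) ℂ :=
  leg₁ b (repE s a) * leg₂ a (repK s b) + leg₂ a (repE s b)

def tensF (s : ℂ) (a b : ℕ) : Matrix (Idx a × Idx b) (Idx a × Idx b) ℂ :=
  leg₁ b (repF s a) + leg₁ b (repKinv s a) * leg₂ a (repF s b)

/-- The universal `R`-matrix
`q ^ (H ⊗ H / 2) ∑ₖ q ^ (k (k - 1) / 2) (q - q⁻¹) ^ k / [k]! E ^ k ⊗ F ^ k` on `V_a ⊗ V_b`. -/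
def Rmat (s : ℂ) (a b : ℕ) : Matrix (Idx a × Idx b) (Idx a × Idx b) ℂ :=
  Matrix.diagonal (fun p => s ^ (wt a p.1 * wt b p.2)) *
    ∑ k ∈ Finset.range (a + 1),
      (s ^ (k * (k - 1)) * (s ^ 2 - (s ^ 2)⁻¹) ^ k / qFact s k) •
        (leg₁ b (repE s a ^ k) * leg₂ a (repF s b ^ k))

/-- The value `q ^ (-n (n + 2) / 2)` of the ribbon element `v` on `V_n`. -/
def ribbon (s : ℂ) (n : ℕ) : ℂ := (s ^ (n * (n + 2)))⁻¹

/-- The element `μ = u v⁻¹`, which is `K`, on `V_n`. -/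
def muMat (s : ℂ) (n : ℕ) : Matrix (Idx n) (Idx n) ℂ := repK s n

/-- `V_c` occurs in `V_a ⊗ V_b` (it then occurs exactly once). -/
def Adm (a b c : ℕ) : Prop :=
  Even (a + b + c) ∧ c ≤ a + b ∧ a ≤ b + c ∧ b ≤ a + c

instance (a b c : ℕ) : Decidable (Adm a b c) := by unfold Adm; infer_instance

/-- The labels of the components of `V_a ⊗ V_b`. -/
def channels (a b : ℕ) : Finset ℕ := (Finset.range (a + b + 1)).filter (Adm a b)

/-- The square root `(-1) ^ ((a + b - c) / 2) q ^ ((c (c + 2) - a (a + 2) - b (b + 2)) / 4)` of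
`v_a v_b / v_c`; both divisions of exponents are exact when `Adm a b c`. -/
def sqrtLam (s : ℂ) (a b c : ℕ) : ℂ :=
  (-1) ^ ((a + b - c) / 2) *
    s ^ ((((c * (c + 2) : ℕ) : ℤ) - ((a * (a + 2) : ℕ) : ℤ) - ((b * (b + 2) : ℕ) : ℤ)) / 2)

/-- A normalised system of Clebsch-Gordan maps: inclusions `φ a b c : V_c → V_a ⊗ V_b` and
projections `ψ a b c : V_a ⊗ V_b → V_c` that intertwine the action of `U_q(sl₂)`, split
`V_a ⊗ V_b` into its irreducible components, and are normalised by
`P R = ∑_c (v_a v_b / v_c) ^ (1 / 2) φ b a c ∘ ψ a b c`. -/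
structure ClebschGordan (s : ℂ) where
  φ : ∀ a b c : ℕ, Matrix (Idx a × Idx b) (Idx c) ℂ
  ψ : ∀ a b c : ℕ, Matrix (Idx c) (Idx a × Idx b) ℂ
  φ_K : ∀ a b c, tensK s a b * φ a b c = φ a b c * repK s c
  φ_E : ∀ a b c, tensE s a b * φ a b c = φ a b c * repE s c
  φ_F : ∀ a b c, tensF s a b * φ a b c = φ a b c * repF s c
  ψ_K : ∀ a b c, ψ a b c * tensK s a b = repK s c * ψ a b c
  ψ_E : ∀ a b c, ψ a b c * tensE s a b = repE s c * ψ a b c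
  ψ_F : ∀ a b c, ψ a b c * tensF s a b = repF s c * ψ a b c
  φ_zero : ∀ a b c, ¬ Adm a b c → φ a b c = 0
  ψ_zero : ∀ a b c, ¬ Adm a b c → ψ a b c = 0
  ψ_φ_self : ∀ a b c, Adm a b c → ψ a b c * φ a b c = 1
  ψ_φ_ne : ∀ a b c d, c ≠ d → ψ a b c * φ a b d = 0
  complete : ∀ a b, ∑ c ∈ channels a b, φ a b c * ψ a b c = 1
  braid : ∀ a b, (Rmat s a b).submatrix Prod.swap id =
    ∑ c ∈ channels a b, sqrtLam s a b c • (φ b a c * ψ a b c)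

/-! ### The quantum group `Γ` and the gauge symmetry algebra -/

/-- Generators of `Γ`: the matrix elements of `g` (`anti = false`) and of `S(g)`
(`anti = true`) in the representation with label `spin`. -/
structure GroupVar where
  anti : Bool
  spin : ℕ
  row : Idx spin
  col : Idx spin

def freeG (anti : Bool) (n : ℕ) : Matrix (Idx n) (Idx n) (FreeAlgebra ℂ GroupVar) :=
  Matrix.of fun i j => FreeAlgebra.ι ℂ ⟨anti, n, i, j⟩

/-- Relations of `Γ`: `g₁ g₂ = ∑_c φ_c g ψ_c`, the trivial representation gives `1`, and `S(g)` is
the inverse matrix of `g`. -/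
inductive GroupRel {s : ℂ} (C : ClebschGordan s) :
    FreeAlgebra ℂ GroupVar → FreeAlgebra ℂ GroupVar → Prop
  | fusion (a b : ℕ) (p r : Idx a × Idx b) : GroupRel C
      ((leg₁ b (freeG false a) * leg₂ a (freeG false b)) p r)
      ((∑ c ∈ channels a b,
        const (FreeAlgebra ℂ GroupVar) (C.φ a b c) * freeG false c * const (FreeAlgebra ℂ GroupVar) (C.ψ a b c)) p r)
  | triv (i j : Idx 0) : GroupRel C (freeG false 0 i j) 1
  | anti_mul (n : ℕ) (i j : Idx n) : GroupRel C
      ((freeG true n * freeG false n) i j) ((1 : Matrix (Idx n) (Idx n) _) i j)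
  | mul_anti (n : ℕ) (i j : Idx n) : GroupRel C
      ((freeG false n * freeG true n) i j) ((1 : Matrix (Idx n) (Idx n) _) i j)

/-- The algebra `Γ` of functions on the quantum group. -/
abbrev Gam {s : ℂ} (C : ClebschGordan s) : Type := RingQuot (GroupRel C)

/-- The matrix `g` (for `anti = false`), or `S(g)` (for `anti = true`), over `Γ`. -/
def gMat {s : ℂ} (C : ClebschGordan s) (anti : Bool) (n : ℕ) : Matrix (Idx n) (Idx n) (Gam C) :=
  (freeG anti n).map (RingQuot.mkAlgHom ℂ (GroupRel C))

/-- The gauge symmetry algebra, the tensor product of one copy of `Γ` for each vertex. -/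
abbrev GaugeAlg {s : ℂ} (C : ClebschGordan s) (V : Type*) : Type _ := ⨂[ℂ] _ : V, Gam C

/-- The matrix `g_z` (or `S(g_z)`) over the gauge symmetry algebra. -/
def gAt {s : ℂ} (C : ClebschGordan s) {V : Type*} [DecidableEq V] (anti : Bool) (z : V) (n : ℕ) :
    Matrix (Idx n) (Idx n) (GaugeAlg C V) :=
  (gMat C anti n).map (PiTensorProduct.singleAlgHom (R := ℂ) (A := fun _ : V => Gam C) z)

/-! ### Ciliated graphs and the algebra of gauge fields -/

variable {V : Type*}

/-- A ciliation: a strict linear order on the edges at each vertex; `lt z x y` says that the edge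
`z x` comes before the edge `z y` in the cilium order at `z`. -/
structure Ciliation (G : SimpleGraph V) where
  lt : V → V → V → Prop
  irrefl : ∀ z x, ¬ lt z x x
  trans : ∀ z w x y, lt z w x → lt z x y → lt z w y
  total : ∀ z x y, G.Adj z x → G.Adj z y → x ≠ y → lt z x y ∨ lt z y x

/-- Generators of the algebra of gauge fields: `u(l)^row_col` in the representation `spin`. -/
structure FieldVar (G : SimpleGraph V) where
  link : G.Dart
  spin : ℕ
  row : Idx spin
  col : Idx spin

def freeU {G : SimpleGraph V} (l : G.Dart) (n : ℕ) :
    Matrix (Idx n) (Idx n) (FreeAlgebra ℂ (FieldVar G)) :=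
  Matrix.of fun i j => FreeAlgebra.ι ℂ ⟨l, n, i, j⟩

/-- Relations of the algebra of gauge fields. An oriented link `l` has departure point `l.fst` and
end point `l.snd`; `l.symm` is the opposite link. In `startEnd` and `startStart` the matrices
`R⁻¹ = (S ⊗ id)(R)` and `R = (S ⊗ S)(R)` appear. -/
inductive FieldRel {s : ℂ} (C : ClebschGordan s) {G : SimpleGraph V} (cil : Ciliation G) :
    FreeAlgebra ℂ (FieldVar G) → FreeAlgebra ℂ (FieldVar G) → Prop
  | endEnd (l l' : G.Dart) (h : l.snd = l'.snd) (hlt : cil.lt l.snd l.fst l'.fst)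
      (a b : ℕ) (p r : Idx a × Idx b) : FieldRel C cil
      ((const (FreeAlgebra ℂ (FieldVar G)) (Rmat s a b) * leg₁ b (freeU l a) * leg₂ a (freeU l' b)) p r)
      ((leg₂ a (freeU l' b) * leg₁ b (freeU l a)) p r)
  | startEnd (l l' : G.Dart) (h : l.fst = l'.snd) (hlt : cil.lt l.fst l.snd l'.fst)
      (a b : ℕ) (p r : Idx a × Idx b) : FieldRel C cil
      ((leg₁ b (freeU l a) * const (FreeAlgebra ℂ (FieldVar G)) (Rmat s a b)⁻¹ * leg₂ a (freeU l' b)) p r)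
      ((leg₂ a (freeU l' b) * leg₁ b (freeU l a)) p r)
  | startStart (l l' : G.Dart) (h : l.fst = l'.fst) (hlt : cil.lt l.fst l.snd l'.snd)
      (a b : ℕ) (p r : Idx a × Idx b) : FieldRel C cil
      ((leg₁ b (freeU l a) * leg₂ a (freeU l' b) * const (FreeAlgebra ℂ (FieldVar G)) (Rmat s a b)) p r)
      ((leg₂ a (freeU l' b) * leg₁ b (freeU l a)) p r)
  | disjoint (l l' : G.Dart) (h₁ : l.fst ≠ l'.fst) (h₂ : l.fst ≠ l'.snd)
      (h₃ : l.snd ≠ l'.fst) (h₄ : l.snd ≠ l'.snd)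
      (a b : ℕ) (p r : Idx a × Idx b) : FieldRel C cil
      ((leg₁ b (freeU l a) * leg₂ a (freeU l' b)) p r)
      ((leg₂ a (freeU l' b) * leg₁ b (freeU l a)) p r)
  | inverse (l : G.Dart) (n : ℕ) (i j : Idx n) : FieldRel C cil
      ((freeU l n * freeU l.symm n) i j) ((1 : Matrix (Idx n) (Idx n) _) i j)
  | fusion (l : G.Dart) (a b : ℕ) (p r : Idx a × Idx b) : FieldRel C cil
      ((leg₁ b (freeU l a) * leg₂ a (freeU l b)) p r)
      ((∑ c ∈ channels a b, const (FreeAlgebra ℂ (FieldVar G)) (C.φ a b c) * freeU l c *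
        const (FreeAlgebra ℂ (FieldVar G)) ((C.ψ b a c).submatrix id Prod.swap)) p r)
  | triv (l : G.Dart) (i j : Idx 0) : FieldRel C cil (freeU l 0 i j) 1

/-- The algebra `Λ` of gauge fields. -/
abbrev Lam {s : ℂ} (C : ClebschGordan s) {G : SimpleGraph V} (cil : Ciliation G) : Type _ :=
  RingQuot (FieldRel C cil)

/-- The matrix `u(l)` over `Λ` in the representation with label `n`. -/
def uMat {s : ℂ} (C : ClebschGordan s) {G : SimpleGraph V} (cil : Ciliation G)
    (l : G.Dart) (n : ℕ) : Matrix (Idx n) (Idx n) (Lam C cil) :=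
  (freeU l n).map (RingQuot.mkAlgHom ℂ (FieldRel C cil))

/-! ### Elementary facts on matrices, for the gauge coaction -/

section Facts

variable {A B : Type*} [Semiring A] [Semiring B]

theorem leg₁_mul {a : ℕ} (b : ℕ) (M N : Matrix (Idx a) (Idx a) A) :
    leg₁ b (M * N) = leg₁ b M * leg₁ b N := by
  ext p r
  simp only [leg₁, Matrix.of_apply, Matrix.mul_apply, Fintype.sum_prod_type]
  by_cases h : p.2 = r.2 <;> simp [h]

theorem leg₂_mul (a : ℕ) {b : ℕ} (M N : Matrix (Idx b) (Idx b) A) :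
    leg₂ a (M * N) = leg₂ a M * leg₂ a N := by
  ext p r
  simp only [leg₂, Matrix.of_apply, Matrix.mul_apply, Fintype.sum_prod_type_right]
  by_cases h : p.1 = r.1 <;> simp [h]

theorem leg₁_one (a b : ℕ) : leg₁ b (1 : Matrix (Idx a) (Idx a) A) = 1 := by
  ext p r
  simp only [leg₁, Matrix.of_apply, Matrix.one_apply, Prod.ext_iff]
  grind

theorem leg₂_one (a b : ℕ) : leg₂ a (1 : Matrix (Idx b) (Idx b) A) = 1 := by
  ext p r
  simp only [leg₂, Matrix.of_apply, Matrix.one_apply, Prod.ext_iff]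
  grind

theorem leg₁_mul_leg₂_apply {a b : ℕ} (M : Matrix (Idx a) (Idx a) A) (N : Matrix (Idx b) (Idx b) A)
    (p r : Idx a × Idx b) : (leg₁ b M * leg₂ a N) p r = M p.1 r.1 * N p.2 r.2 := by
  simp [leg₁, leg₂, Matrix.mul_apply, Fintype.sum_prod_type]

theorem leg₂_mul_leg₁_apply {a b : ℕ} (M : Matrix (Idx a) (Idx a) A) (N : Matrix (Idx b) (Idx b) A)
    (p r : Idx a × Idx b) : (leg₂ a N * leg₁ b M) p r = N p.2 r.2 * M p.1 r.1 := by
  simp [leg₁, leg₂, Matrix.mul_apply, Fintype.sum_prod_type]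

theorem leg_comm {a b : ℕ} {M : Matrix (Idx a) (Idx a) A} {N : Matrix (Idx b) (Idx b) A}
    (h : ∀ i j k l, Commute (M i j) (N k l)) : leg₁ b M * leg₂ a N = leg₂ a N * leg₁ b M := by
  ext p r
  rw [leg₁_mul_leg₂_apply, leg₂_mul_leg₁_apply, (h _ _ _ _).eq]

theorem leg₁_map {a : ℕ} (b : ℕ) (M : Matrix (Idx a) (Idx a) A) (f : A → B) (hf : f 0 = 0) :
    (leg₁ b M).map f = leg₁ b (M.map f) := by
  ext p r
  simp only [leg₁, Matrix.of_apply, Matrix.map_apply]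
  split_ifs <;> simp [hf]

theorem leg₂_map (a : ℕ) {b : ℕ} (M : Matrix (Idx b) (Idx b) A) (f : A → B) (hf : f 0 = 0) :
    (leg₂ a M).map f = leg₂ a (M.map f) := by
  ext p r
  simp only [leg₂, Matrix.of_apply, Matrix.map_apply]
  split_ifs <;> simp [hf]

end Facts

theorem const_mul {A : Type*} [Semiring A] [Algebra ℂ A] {l m n : Type*} [Fintype m]
    (M : Matrix l m ℂ) (N : Matrix m n ℂ) : const A (M * N) = const A M * const A N := by
  simp [const, Matrix.map_mul]

theorem const_one {A : Type*} [Semiring A] [Algebra ℂ A] {m : Type*} [DecidableEq m] :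
    const A (1 : Matrix m m ℂ) = 1 := by
  simp [const, Matrix.map_one]

theorem const_zero {A : Type*} [Semiring A] [Algebra ℂ A] {m n : Type*} :
    const A (0 : Matrix m n ℂ) = 0 := by
  ext; simp [const]

theorem const_sum {A : Type*} [Semiring A] [Algebra ℂ A] {m n ι : Type*} (t : Finset ι)
    (M : ι → Matrix m n ℂ) : const A (∑ c ∈ t, M c) = ∑ c ∈ t, const A (M c) := by
  ext i j
  simp [const, Matrix.sum_apply]

theorem const_map {A B : Type*} [Semiring A] [Algebra ℂ A] [Semiring B] [Algebra ℂ B]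
    {m n : Type*} (M : Matrix m n ℂ) (f : A →ₐ[ℂ] B) : (const A M).map f = const B M := by
  ext i j
  simp [const]

/-- Applying an algebra morphism entrywise. -/
theorem map_matMul {A B : Type*} [Semiring A] [Algebra ℂ A] [Semiring B] [Algebra ℂ B]
    {l m n : Type*} [Fintype m] (f : A →ₐ[ℂ] B) (M : Matrix l m A) (N : Matrix m n A) :
    (M * N).map f = M.map f * N.map f := by
  ext i j
  simp [Matrix.mul_apply]

theorem map_matSum {A B : Type*} [Semiring A] [Algebra ℂ A] [Semiring B] [Algebra ℂ B]
    {m n ι : Type*} (f : A →ₐ[ℂ] B) (t : Finset ι) (M : ι → Matrix m n A) :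
    (∑ c ∈ t, M c).map f = ∑ c ∈ t, (M c).map f := by
  ext i j
  simp [Matrix.sum_apply]

/-- A matrix family over `A` that multiplies like `g`. -/
def FusesG {s : ℂ} (C : ClebschGordan s) {A : Type*} [Semiring A] [Algebra ℂ A]
    (g : ∀ n, Matrix (Idx n) (Idx n) A) : Prop :=
  ∀ a b, leg₁ b (g a) * leg₂ a (g b) =
    ∑ c ∈ channels a b, const A (C.φ a b c) * g c * const A (C.ψ a b c)

section Gauge

variable {s : ℂ} (C : ClebschGordan s)

theorem channels_comm (a b : ℕ) : channels a b = channels b a := by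
  ext c
  simp only [channels, Finset.mem_filter, Finset.mem_range, Adm, add_comm a b]
  tauto

theorem ψ_φ_swap_self {a b c : ℕ} (h : Adm b a c) :
    (C.ψ b a c).submatrix id Prod.swap * (C.φ b a c).submatrix Prod.swap id = 1 := by
  have := C.ψ_φ_self b a c h
  rw [← Matrix.submatrix_mul _ _ id Prod.swap id Prod.swap_bijective, this]
  simp

theorem ψ_φ_swap_ne {a b c d : ℕ} (h : c ≠ d) :
    (C.ψ b a c).submatrix id Prod.swap * (C.φ b a d).submatrix Prod.swap id = 0 := by
  have := C.ψ_φ_ne b a c d h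
  rw [← Matrix.submatrix_mul _ _ id Prod.swap id Prod.swap_bijective, this]
  simp

theorem Rmat_eq (a b : ℕ) : Rmat s a b =
    ∑ c ∈ channels a b, sqrtLam s a b c • ((C.φ b a c).submatrix Prod.swap id * C.ψ a b c) := by
  have h := congrArg (fun M => M.submatrix Prod.swap id) (C.braid a b)
  simp only [Matrix.submatrix_submatrix] at h
  have h1 : (Prod.swap ∘ Prod.swap : Idx a × Idx b → _) = id := by ext <;> simp
  rw [show (Rmat s a b).submatrix (Prod.swap ∘ Prod.swap) (id ∘ id) = Rmat s a b by
    ext; simp] at h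
  rw [h]
  ext p r
  simp [Matrix.sum_apply, Matrix.mul_apply]

/-- Collapse of a product of two sums over channels. -/
theorem collapse {A : Type*} [Semiring A] [Algebra ℂ A] {m n k : Type*}
    {t : Finset ℕ} [Fintype n]
    (X : ∀ c, Matrix m (Idx c) A) (Y : ∀ c, Matrix (Idx c) k A)
    (P : ∀ c, Matrix (Idx c) n ℂ) (Q : ∀ c, Matrix n (Idx c) ℂ)
    (h1 : ∀ c ∈ t, P c * Q c = 1) (h0 : ∀ c d, c ≠ d → P c * Q d = 0) :
    (∑ c ∈ t, X c * const A (P c)) * (∑ c ∈ t, const A (Q c) * Y c) = ∑ c ∈ t, X c * Y c := by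
  rw [Matrix.sum_mul]
  refine Finset.sum_congr rfl fun c hc => ?_
  rw [Matrix.mul_sum, Finset.sum_eq_single c]
  · rw [Matrix.mul_assoc, ← Matrix.mul_assoc (const A (P c)), ← const_mul, h1 c hc, const_one,
      Matrix.one_mul]
  · intro d _ hd
    rw [Matrix.mul_assoc, ← Matrix.mul_assoc (const A (P c)), ← const_mul, h0 c d hd.symm,
      const_zero]
    simp
  · exact fun h => absurd hc h

theorem adm_of_mem {a b c : ℕ} (h : c ∈ channels a b) : Adm a b c := (Finset.mem_filter.mp h).2

theorem adm_symm {a b c : ℕ} (h : Adm a b c) : Adm b a c := by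
  unfold Adm at *
  rw [add_comm b a]
  tauto

variable {A : Type*} [Semiring A] [Algebra ℂ A] {g : ∀ n, Matrix (Idx n) (Idx n) A}

theorem FusesG.swap {C : ClebschGordan s} (h : FusesG C g) (a b : ℕ) :
    leg₂ a (g b) * leg₁ b (g a) = ∑ c ∈ channels a b,
      const A ((C.φ b a c).submatrix Prod.swap id) * g c *
        const A ((C.ψ b a c).submatrix id Prod.swap) := by
  ext p r
  have := congrFun (congrFun (h b a) p.swap) r.swap
  rw [leg₁_mul_leg₂_apply] at this
  rw [leg₂_mul_leg₁_apply, channels_comm]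
  simp only [Prod.fst_swap, Prod.snd_swap] at this
  rw [this]
  simp [Matrix.sum_apply, Matrix.mul_apply, const]

/-- The exchange relation `R₁₂ g₁ g₂ = g₂ g₁ R₁₂`. -/
theorem FusesG.exchange {C : ClebschGordan s} (h : FusesG C g) (a b : ℕ) :
    const A (Rmat s a b) * (leg₁ b (g a) * leg₂ a (g b)) =
      leg₂ a (g b) * leg₁ b (g a) * const A (Rmat s a b) := by
  have hR : const A (Rmat s a b) = ∑ c ∈ channels a b,
      (const A (sqrtLam s a b c • (C.φ b a c).submatrix Prod.swap id)) * const A (C.ψ a b c) := by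
    rw [Rmat_eq C, const_sum]
    exact Finset.sum_congr rfl fun c _ => by rw [← const_mul, Matrix.smul_mul]
  have hR' : const A (Rmat s a b) = ∑ c ∈ channels a b,
      (const A ((C.φ b a c).submatrix Prod.swap id)) *
        const A (sqrtLam s a b c • C.ψ a b c) := by
    rw [Rmat_eq C, const_sum]
    exact Finset.sum_congr rfl fun c _ => by rw [← const_mul, Matrix.mul_smul]
  have e1 := collapse (A := A) (t := channels a b)
    (fun c => const A (sqrtLam s a b c • (C.φ b a c).submatrix Prod.swap id))
    (fun c => g c * const A (C.ψ a b c)) (fun c => C.ψ a b c) (fun c => C.φ a b c)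
    (fun c hc => C.ψ_φ_self a b c (adm_of_mem hc)) (fun c d hcd => C.ψ_φ_ne a b c d hcd)
  have e2 := collapse (A := A) (t := channels a b)
    (fun c => const A ((C.φ b a c).submatrix Prod.swap id) * g c)
    (fun c => const A (sqrtLam s a b c • C.ψ a b c))
    (fun c => (C.ψ b a c).submatrix id Prod.swap) (fun c => (C.φ b a c).submatrix Prod.swap id)
    (fun c hc => ψ_φ_swap_self C (adm_symm (adm_of_mem hc)))
    (fun c d hcd => ψ_φ_swap_ne C hcd)
  rw [h.swap, hR']
  rw [e2, ← hR', hR, h a b]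
  simp only [← Matrix.mul_assoc] at e1 ⊢
  rw [e1]
  refine Finset.sum_congr rfl fun c _ => ?_
  ext p r
  simp only [Matrix.mul_apply, const, Matrix.map_apply, Matrix.smul_apply, smul_eq_mul, map_mul,
    Finset.sum_mul]
  refine Finset.sum_congr rfl fun x _ => Finset.sum_congr rfl fun y _ => ?_
  rw [Algebra.commutes (sqrtLam s a b c), mul_assoc, mul_assoc, mul_assoc]
  congr 1
  rw [← mul_assoc, Algebra.commutes, mul_assoc]

theorem sqrtLam_ne (hs : s ≠ 0) (a b c : ℕ) : sqrtLam s a b c ≠ 0 :=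
  mul_ne_zero (pow_ne_zero _ (by norm_num)) (zpow_ne_zero _ hs)

theorem Rmat_mul_inv {C : ClebschGordan s} (hs : s ≠ 0) (a b : ℕ) :
    Rmat s a b * (Rmat s a b)⁻¹ = 1 := by
  have h : Rmat s a b * ∑ c ∈ channels a b,
      (sqrtLam s a b c)⁻¹ • (C.φ a b c * (C.ψ b a c).submatrix id Prod.swap) = 1 := by
    rw [Rmat_eq C]
    have e := collapse (A := ℂ) (t := channels a b)
      (fun c => sqrtLam s a b c • (C.φ b a c).submatrix Prod.swap id)
      (fun c => (sqrtLam s a b c)⁻¹ • (C.ψ b a c).submatrix id Prod.swap)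
      (fun c => C.ψ a b c) (fun c => C.φ a b c)
      (fun c hc => C.ψ_φ_self a b c (adm_of_mem hc)) (fun c d hcd => C.ψ_φ_ne a b c d hcd)
    have hc : ∀ {m n : Type} (M : Matrix m n ℂ), const ℂ M = M := fun M => by ext; simp [const]
    simp only [hc, Matrix.smul_mul, Matrix.mul_smul, smul_smul] at e
    rw [e]
    have h1 := congrArg (fun M => M.submatrix Prod.swap Prod.swap) (C.complete b a)
    rw [channels_comm]
    have h2 : ((1 : Matrix (Idx b × Idx a) (Idx b × Idx a) ℂ).submatrix Prod.swap Prod.swap :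
        Matrix (Idx a × Idx b) (Idx a × Idx b) ℂ) = 1 :=
      Matrix.submatrix_one _ Prod.swap_injective
    rw [h2] at h1
    rw [← h1]
    ext p r
    simp [Matrix.sum_apply, Matrix.mul_apply, sqrtLam_ne hs]
  rw [Matrix.inv_eq_right_inv h, h]

theorem Rmat_inv_mul {C : ClebschGordan s} (hs : s ≠ 0) (a b : ℕ) :
    (Rmat s a b)⁻¹ * Rmat s a b = 1 :=
  mul_eq_one_comm.mp (Rmat_mul_inv (C := C) hs a b)

variable {S : ∀ n, Matrix (Idx n) (Idx n) A}

theorem FusesG.anti_fuses {C : ClebschGordan s} (h : FusesG C g) (hl : ∀ n, S n * g n = 1)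
    (hr : ∀ n, g n * S n = 1) (a b : ℕ) :
    leg₁ b (S a) * leg₂ a (S b) = ∑ c ∈ channels a b,
      const A ((C.φ b a c).submatrix Prod.swap id) * S c *
        const A ((C.ψ b a c).submatrix id Prod.swap) := by
  refine left_inv_eq_right_inv (a := leg₂ a (g b) * leg₁ b (g a)) ?_ ?_
  · rw [Matrix.mul_assoc, ← Matrix.mul_assoc (leg₂ a (S b)), ← leg₂_mul, hl, leg₂_one,
      Matrix.one_mul, ← leg₁_mul, hl, leg₁_one]
  · have e := collapse (A := A) (t := channels a b)
      (fun c => const A ((C.φ b a c).submatrix Prod.swap id) * g c)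
      (fun c => S c * const A ((C.ψ b a c).submatrix id Prod.swap))
      (fun c => (C.ψ b a c).submatrix id Prod.swap) (fun c => (C.φ b a c).submatrix Prod.swap id)
      (fun c hc => ψ_φ_swap_self C (adm_symm (adm_of_mem hc)))
      (fun c d hcd => ψ_φ_swap_ne C hcd)
    rw [h.swap]
    simp only [← Matrix.mul_assoc] at e
    rw [e]
    have h1 := congrArg (fun M => const A (M.submatrix Prod.swap Prod.swap)) (C.complete b a)
    have h2 : ((1 : Matrix (Idx b × Idx a) (Idx b × Idx a) ℂ).submatrix Prod.swap Prod.swap :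
        Matrix (Idx a × Idx b) (Idx a × Idx b) ℂ) = 1 :=
      Matrix.submatrix_one _ Prod.swap_injective
    simp only [h2, const_one] at h1
    rw [channels_comm, ← h1]
    have h3 : (∑ c ∈ channels b a, C.φ b a c * C.ψ b a c).submatrix Prod.swap Prod.swap =
        ∑ c ∈ channels b a, (C.φ b a c).submatrix Prod.swap (id : Idx c → _) *
          ((C.ψ b a c).submatrix id Prod.swap : Matrix _ (Idx a × Idx b) ℂ) := by
      ext p r
      simp [Matrix.sum_apply, Matrix.mul_apply]
    rw [h3, const_sum]
    refine Finset.sum_congr rfl fun c _ => ?_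
    rw [Matrix.mul_assoc (const A _) (g c), hr, Matrix.mul_one, const_mul]

theorem mon_startEnd {M : Type*} [Monoid M] {R R' g₁ g₂ S₁ : M} (h : R * (g₁ * g₂) = g₂ * g₁ * R)
    (h1 : R * R' = 1) (h2 : R' * R = 1) (hl : S₁ * g₁ = 1) (hr : g₁ * S₁ = 1) :
    S₁ * R' * g₂ = g₂ * R' * S₁ := by
  have e : g₁ * g₂ * R' = R' * (g₂ * g₁) := by
    calc g₁ * g₂ * R' = R' * (R * (g₁ * g₂)) * R' := by rw [← mul_assoc R' R, h2, one_mul]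
      _ = R' * (g₂ * g₁) * (R * R') := by rw [h]; simp only [mul_assoc]
      _ = R' * (g₂ * g₁) := by rw [h1, mul_one]
  calc S₁ * R' * g₂ = S₁ * (R' * (g₂ * g₁)) * S₁ := by
        simp only [mul_assoc]; rw [hr, mul_one]
    _ = (S₁ * g₁) * g₂ * R' * S₁ := by rw [← e]; simp only [mul_assoc]
    _ = g₂ * R' * S₁ := by rw [hl, one_mul]

theorem mon_startStart {M : Type*} [Monoid M] {R g₁ g₂ S₁ S₂ : M}
    (h : R * (g₁ * g₂) = g₂ * g₁ * R)
    (hl : S₁ * g₁ = 1) (hr : g₁ * S₁ = 1) (hl' : S₂ * g₂ = 1) (hr' : g₂ * S₂ = 1) :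
    S₁ * S₂ * R = R * (S₂ * S₁) := by
  calc S₁ * S₂ * R = S₁ * S₂ * (R * (g₁ * g₂)) * (S₂ * S₁) := by
        simp only [mul_assoc]; rw [← mul_assoc g₂, hr', one_mul, hr, mul_one]
    _ = S₁ * (S₂ * g₂) * g₁ * R * (S₂ * S₁) := by rw [h]; simp only [mul_assoc]
    _ = R * (S₂ * S₁) := by rw [hl', mul_one, hl, one_mul]

end Gauge

/-! ### The gauge coaction -/

theorem rel_mat {X m n : Type*} {rel : FreeAlgebra ℂ X → FreeAlgebra ℂ X → Prop}
    {A : Type*} [Semiring A] [Algebra ℂ A] {f : FreeAlgebra ℂ X →ₐ[ℂ] A}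
    (hf : ∀ ⦃x y⦄, rel x y → f x = f y)
    {M N : Matrix m n (FreeAlgebra ℂ X)} (h : ∀ p r, rel (M p r) (N p r)) :
    M.map f = N.map f := by
  ext p r
  exact hf (h p r)

theorem mon_nf {M : Type*} [Monoid M] {G₁ G₂ U₁ U₂ S₁ S₂ : M}
    (h1 : Commute U₁ G₂) (h2 : Commute S₁ G₂) (h3 : Commute S₁ U₂) :
    G₁ * U₁ * S₁ * (G₂ * U₂ * S₂) = G₁ * G₂ * (U₁ * U₂) * (S₁ * S₂) := by
  simp only [mul_assoc, h1.left_comm, h2.left_comm, h3.left_comm]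

section Coact

variable {s : ℂ} {C : ClebschGordan s} {G : SimpleGraph V} {cil : Ciliation G}
  {B : Type*} [Semiring B] [Algebra ℂ B]

/-- The morphism `u(xy) ↦ g_x u(xy) S(g_y)` on the free algebra, for the link `xy` with departure
point `y` and end point `x`; here `u` and `g` are matrices over the same algebra. -/
def freeCoact (f : FreeAlgebra ℂ (FieldVar G) →ₐ[ℂ] B)
    (g : Bool → V → ∀ n, Matrix (Idx n) (Idx n) B) : FreeAlgebra ℂ (FieldVar G) →ₐ[ℂ] B :=
  FreeAlgebra.lift ℂ fun w => (g false w.link.snd w.spin * (freeU w.link w.spin).map f *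
    g true w.link.fst w.spin) w.row w.col

theorem freeU_map_coact (f : FreeAlgebra ℂ (FieldVar G) →ₐ[ℂ] B)
    (g : Bool → V → ∀ n, Matrix (Idx n) (Idx n) B) (l : G.Dart) (n : ℕ) :
    (freeU l n).map (freeCoact f g) =
      g false l.snd n * (freeU l n).map f * g true l.fst n := by
  ext i j
  rw [Matrix.map_apply, freeU, Matrix.of_apply, freeCoact, FreeAlgebra.lift_ι_apply]
  rfl

theorem freeCoact_rel (hs : s ≠ 0) (f : FreeAlgebra ℂ (FieldVar G) →ₐ[ℂ] B)
    (hf : ∀ ⦃x y⦄, FieldRel C cil x y → f x = f y)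
    (g : Bool → V → ∀ n, Matrix (Idx n) (Idx n) B)
    (fus : ∀ z, FusesG C (g false z)) (g0 : ∀ z, g false z 0 = 1)
    (gl : ∀ z n, g true z n * g false z n = 1) (gr : ∀ z n, g false z n * g true z n = 1)
    (hgg : ∀ z w, z ≠ w → ∀ t t' a b i j k l, Commute (g t z a i j) (g t' w b k l))
    (hug : ∀ x t w b k l, Commute (f x) (g t w b k l)) ⦃x y : FreeAlgebra ℂ (FieldVar G)⦄
    (h : FieldRel C cil x y) : freeCoact f g x = freeCoact f g y := by
  set U : ∀ (_ : G.Dart) (n : ℕ), Matrix (Idx n) (Idx n) B := fun l n => (freeU l n).map f with hUdef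
  have hUmap : ∀ l n, (freeU l n).map f = U l n := fun _ _ => rfl
  have key : ∀ {m n : Type} {M N : Matrix m n (FreeAlgebra ℂ (FieldVar G))},
      M.map (freeCoact f g) = N.map (freeCoact f g) →
      ∀ p r, freeCoact f g (M p r) = freeCoact f g (N p r) :=
    fun e p r => congrFun (congrFun e p) r
  have ug : ∀ (d : G.Dart) (t : Bool) (w : V) (a b : ℕ),
      Commute (leg₁ b (U d a)) (leg₂ a (g t w b)) :=
    fun d t w a b => leg_comm (fun _ _ _ _ => hug _ _ _ _ _ _)
  have gu : ∀ (d : G.Dart) (t : Bool) (w : V) (a b : ℕ),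
      Commute (leg₁ b (g t w a)) (leg₂ a (U d b)) :=
    fun d t w a b => leg_comm (fun _ _ _ _ => (hug _ _ _ _ _ _).symm)
  have gg : ∀ {z w : V} (_ : z ≠ w) (t t' : Bool) (a b : ℕ),
      Commute (leg₁ b (g t z a)) (leg₂ a (g t' w b)) :=
    fun h t t' a b => leg_comm (fun _ _ _ _ => hgg _ _ h _ _ _ _ _ _ _ _)
  have hl₁ : ∀ z a b, leg₁ b (g true z a) * leg₁ b (g false z a) = 1 := by
    intro z a b; rw [← leg₁_mul, gl, leg₁_one]
  have hr₁ : ∀ z a b, leg₁ b (g false z a) * leg₁ b (g true z a) = 1 := by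
    intro z a b; rw [← leg₁_mul, gr, leg₁_one]
  have hl₂ : ∀ z a b, leg₂ a (g true z b) * leg₂ a (g false z b) = 1 := by
    intro z a b; rw [← leg₂_mul, gl, leg₂_one]
  have hr₂ : ∀ z a b, leg₂ a (g false z b) * leg₂ a (g true z b) = 1 := by
    intro z a b; rw [← leg₂_mul, gr, leg₂_one]
  have hR₁ : ∀ a b, const (B) (Rmat s a b) * const B (Rmat s a b)⁻¹ = 1 := by
    intro a b; rw [← const_mul, Rmat_mul_inv (C := C) hs, const_one]
  have hR₂ : ∀ a b, const (B) (Rmat s a b)⁻¹ * const B (Rmat s a b) = 1 := by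
    intro a b; rw [← const_mul, Rmat_inv_mul (C := C) hs, const_one]
  cases h with
  | endEnd l l' h hlt a b p r =>
    refine key ?_ p r
    have hU := rel_mat hf (FieldRel.endEnd (C := C) (cil := cil) l l' h hlt a b)
    have hne : l.fst ≠ l'.fst := fun e => cil.irrefl _ _ (e ▸ hlt)
    simp only [map_matMul, const_map, leg₁_map _ _ _ (map_zero _), leg₂_map _ _ _ (map_zero _),
      hUmap, freeU_map_coact] at hU ⊢
    simp only [leg₁_mul, leg₂_mul]
    rw [mul_assoc (const B _), mon_nf (ug _ _ _ _ _) (gg (h ▸ l.fst_ne_snd) _ _ _ _)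
        (gu _ _ _ _ _),
      mon_nf (gu _ _ _ _ _).symm (gg (h ▸ l'.fst_ne_snd.symm) _ _ _ _).symm (ug _ _ _ _ _).symm,
      ← hU, (gg hne true true a b).eq, ← h]
    have hG := (fus l.snd).exchange a b
    simp only [← mul_assoc] at hG ⊢
    rw [hG]
  | startEnd l l' h hlt a b p r =>
    refine key ?_ p r
    have hU := rel_mat hf (FieldRel.startEnd (C := C) (cil := cil) l l' h hlt a b)
    have hne : l.snd ≠ l'.fst := fun e => cil.irrefl _ _ (e ▸ hlt)
    have hS := mon_startEnd ((fus l.fst).exchange a b) (hR₁ a b) (hR₂ a b)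
      (hl₁ l.fst a b) (hr₁ l.fst a b)
    simp only [map_matMul, const_map, leg₁_map _ _ _ (map_zero _), leg₂_map _ _ _ (map_zero _),
      hUmap, freeU_map_coact] at hU ⊢
    simp only [leg₁_mul, leg₂_mul]
    have hxy : l.snd ≠ l.fst := l.fst_ne_snd.symm
    have hyz : l.fst ≠ l'.fst := h ▸ l'.fst_ne_snd.symm
    rw [mon_nf (gu _ _ _ _ _).symm (gg hne _ _ _ _).symm (ug _ _ _ _ _).symm, ← hU,
      ← (gg (h ▸ hxy) false false a b).eq, ← (gg hyz true true a b).eq, ← h]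
    simp only [mul_assoc] at hS ⊢
    rw [← mul_assoc (leg₁ b (g true l.fst a)) (const B _), mul_assoc (leg₁ b _) (const B _),
      ← mul_assoc (const B _) (leg₂ a _), ← mul_assoc (leg₁ b (g true l.fst a)), hS]
    simp only [mul_assoc, (ug _ _ _ _ _).left_comm, (gu _ _ _ _ _).left_comm]
  | startStart l l' h hlt a b p r =>
    refine key ?_ p r
    have hU := rel_mat hf (FieldRel.startStart (C := C) (cil := cil) l l' h hlt a b)
    have hne : l.snd ≠ l'.snd := fun e => cil.irrefl _ _ (e ▸ hlt)
    have hS := mon_startStart ((fus l.fst).exchange a b)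
      (hl₁ l.fst a b) (hr₁ l.fst a b) (hl₂ l.fst a b) (hr₂ l.fst a b)
    simp only [map_matMul, const_map, leg₁_map _ _ _ (map_zero _), leg₂_map _ _ _ (map_zero _),
      hUmap, freeU_map_coact] at hU ⊢
    simp only [leg₁_mul, leg₂_mul]
    rw [mon_nf (ug _ _ _ _ _) (gg (h ▸ l'.fst_ne_snd) _ _ _ _) (gu _ _ _ _ _),
      mon_nf (gu _ _ _ _ _).symm (gg (h ▸ l.fst_ne_snd.symm) _ _ _ _).symm (ug _ _ _ _ _).symm,
      ← hU, ← h, mul_assoc _ _ (const B _), hS, (gg hne false false a b).eq]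
    simp only [mul_assoc]
  | disjoint l l' h₁ h₂ h₃ h₄ a b p r =>
    refine key ?_ p r
    have hU := rel_mat hf (FieldRel.disjoint (C := C) (cil := cil) l l' h₁ h₂ h₃ h₄ a b)
    simp only [map_matMul, leg₁_map _ _ _ (map_zero _), leg₂_map _ _ _ (map_zero _),
      hUmap, freeU_map_coact] at hU ⊢
    simp only [leg₁_mul, leg₂_mul]
    rw [mon_nf (ug _ _ _ _ _) (gg h₂ _ _ _ _) (gu _ _ _ _ _),
      mon_nf (gu _ _ _ _ _).symm (gg h₃ _ _ _ _).symm (ug _ _ _ _ _).symm,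
      hU, (gg h₄ false false a b).eq, (gg h₁ true true a b).eq]
  | inverse l n i j =>
    refine key ?_ i j
    have hU := rel_mat hf (FieldRel.inverse (C := C) (cil := cil) l n)
    rw [Matrix.map_one _ (map_zero _) (map_one _), map_matMul, hUmap, hUmap] at hU
    rw [Matrix.map_one _ (map_zero _) (map_one _), map_matMul, freeU_map_coact, freeU_map_coact,
      hUmap, hUmap]
    change _ * (g false l.fst n * _ * g true l.snd n) = 1
    calc _ = g false l.snd n * U l n *
          (g true l.fst n * g false l.fst n) * U l.symm n *
            g true l.snd n := by simp only [mul_assoc]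
      _ = g false l.snd n * (U l n * U l.symm n) *
            g true l.snd n := by rw [gl, mul_one]; simp only [mul_assoc]
      _ = 1 := by rw [hU, mul_one, gr]
  | fusion l a b p r =>
    refine key ?_ p r
    have hU := rel_mat hf (FieldRel.fusion (C := C) (cil := cil) l a b)
    simp only [map_matMul, map_matSum, const_map, leg₁_map _ _ _ (map_zero _),
      leg₂_map _ _ _ (map_zero _), hUmap, freeU_map_coact] at hU ⊢
    simp only [leg₁_mul, leg₂_mul]
    rw [mon_nf (ug _ _ _ _ _) (gg l.fst_ne_snd _ _ _ _) (gu _ _ _ _ _), hU,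
      fus l.snd a b,
      (fus l.fst).anti_fuses (gl l.fst) (gr l.fst) a b]
    have e1 := collapse (A := B) (t := channels a b)
      (fun c => const B (C.φ a b c) * g false l.snd c)
      (fun c => U l c * const B ((C.ψ b a c).submatrix id Prod.swap :
        Matrix _ (Idx a × Idx b) ℂ))
      (fun c => C.ψ a b c) (fun c => C.φ a b c)
      (fun c hc => C.ψ_φ_self a b c (adm_of_mem hc)) (fun c d hcd => C.ψ_φ_ne a b c d hcd)
    have e2 := collapse (A := B) (t := channels a b)
      (fun c => const B (C.φ a b c) * g false l.snd c * U l c)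
      (fun c => g true l.fst c * const B ((C.ψ b a c).submatrix id Prod.swap :
        Matrix _ (Idx a × Idx b) ℂ))
      (fun c => (C.ψ b a c).submatrix id Prod.swap) (fun c => (C.φ b a c).submatrix Prod.swap id)
      (fun c hc => ψ_φ_swap_self C (adm_symm (adm_of_mem hc)))
      (fun c d hcd => ψ_φ_swap_ne C hcd)
    simp only [← Matrix.mul_assoc] at e1 e2 ⊢
    rw [e1, e2]
  | triv l i j =>
    have hU := rel_mat (M := freeU l 0) (N := 1) hf (fun i j => by
      rw [idx_zero_eq i j, Matrix.one_apply_eq]; exact FieldRel.triv l j j)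
    have hS : g true l.fst 0 = 1 := by
      have h1 := gl l.fst 0
      rwa [g0, mul_one] at h1
    refine (congrFun (congrFun (freeU_map_coact f g l 0) i) j).trans ?_
    rw [map_one, g0, hS, hU, Matrix.map_one _ (map_zero _) (map_one _), mul_one, mul_one,
      idx_zero_eq i j, Matrix.one_apply_eq]

end Coact

section Coaction

variable {s : ℂ} (C : ClebschGordan s) {G : SimpleGraph V} (cil : Ciliation G)

theorem FusesG.map {C : ClebschGordan s} {A B : Type*} [Semiring A] [Algebra ℂ A] [Semiring B]
    [Algebra ℂ B] {g : ∀ n, Matrix (Idx n) (Idx n) A} (h : FusesG C g) (f : A →ₐ[ℂ] B) :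
    FusesG C fun n => (g n).map f := by
  intro a b
  have := congrArg (fun M => M.map f) (h a b)
  simpa only [map_matMul, map_matSum, const_map, leg₁_map _ _ _ (map_zero f),
    leg₂_map _ _ _ (map_zero f)] using this

theorem gMat_rel ⦃x y : FreeAlgebra ℂ GroupVar⦄ (h : GroupRel C x y) :
    RingQuot.mkAlgHom ℂ (GroupRel C) x = RingQuot.mkAlgHom ℂ (GroupRel C) y :=
  RingQuot.mkAlgHom_rel ℂ h

theorem gMat_fuses : FusesG C (gMat C false) := by
  intro a b
  have := rel_mat (gMat_rel C) (GroupRel.fusion (C := C) a b)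
  simp only [map_matMul, map_matSum, const_map, leg₁_map _ _ _ (map_zero _),
    leg₂_map _ _ _ (map_zero _)] at this
  exact this

theorem gMat_anti_mul (n : ℕ) : gMat C true n * gMat C false n = 1 := by
  have := rel_mat (gMat_rel C) (GroupRel.anti_mul (C := C) n)
  rwa [map_matMul, Matrix.map_one _ (map_zero _) (map_one _)] at this

theorem gMat_mul_anti (n : ℕ) : gMat C false n * gMat C true n = 1 := by
  have := rel_mat (gMat_rel C) (GroupRel.mul_anti (C := C) n)
  rwa [map_matMul, Matrix.map_one _ (map_zero _) (map_one _)] at this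

theorem gMat_zero : gMat C false 0 = 1 := by
  have := rel_mat (M := freeG false 0) (N := 1) (gMat_rel C) (fun i j => by
    rw [idx_zero_eq i j, Matrix.one_apply_eq]; exact GroupRel.triv j j)
  rwa [Matrix.map_one _ (map_zero _) (map_one _)] at this

variable [DecidableEq V]

/-- The algebra `Λ ⊗ Γ̂`. -/
abbrev LamGauge : Type _ := Lam C cil ⊗[ℂ] GaugeAlg C V

/-- The morphism `g ↦ 1 ⊗ g_z` from `Γ` to `Λ ⊗ Γ̂`. -/
def inclG (z : V) : Gam C →ₐ[ℂ] LamGauge C cil :=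
  (Algebra.TensorProduct.includeRight : GaugeAlg C V →ₐ[ℂ] LamGauge C cil).comp
    (PiTensorProduct.singleAlgHom (R := ℂ) (A := fun _ : V => Gam C) z)

/-- The morphism from the free algebra onto `Λ ⊗ 1`. -/
def inclU : FreeAlgebra ℂ (FieldVar G) →ₐ[ℂ] LamGauge C cil :=
  (Algebra.TensorProduct.includeLeft (R := ℂ) (S := ℂ) : Lam C cil →ₐ[ℂ] LamGauge C cil).comp
    (RingQuot.mkAlgHom ℂ (FieldRel C cil))

theorem inclG_comm {z w : V} (h : z ≠ w) (x y : Gam C) :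
    Commute (inclG C cil z x) (inclG C cil w y) :=
  Commute.map (Commute.tprod (R := ℂ) (A := fun _ : V => Gam C)
    (a₁ := Pi.mulSingle z x) (a₂ := Pi.mulSingle w y) (Pi.mulSingle_commute (f := fun _ : V => Gam C) h x y))
    (Algebra.TensorProduct.includeRight : GaugeAlg C V →ₐ[ℂ] LamGauge C cil)

theorem inclU_inclG_comm (x : FreeAlgebra ℂ (FieldVar G)) (w : V) (y : Gam C) :
    Commute (inclU C cil x) (inclG C cil w y) := by
  simp [inclU, inclG, Commute, SemiconjBy]

/-- The gauge coaction `Ω : Λ → Λ ⊗ Γ̂`, the algebra morphism with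
`Ω(u(xy)) = g_x u(xy) S(g_y)`. -/
def coaction (hs : s ≠ 0) : Lam C cil →ₐ[ℂ] LamGauge C cil :=
  RingQuot.liftAlgHom ℂ
    ⟨freeCoact (inclU C cil) (fun t z n => (gMat C t n).map (inclG C cil z)),
      freeCoact_rel hs (inclU C cil)
        (fun _ _ h => congrArg (Algebra.TensorProduct.includeLeft (R := ℂ) (S := ℂ) :
          Lam C cil →ₐ[ℂ] LamGauge C cil) (RingQuot.mkAlgHom_rel ℂ h)) _
        (fun z => (gMat_fuses C).map (inclG C cil z))
        (fun z => by rw [gMat_zero, Matrix.map_one _ (map_zero _) (map_one _)])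
        (fun z n => by rw [← map_matMul, gMat_anti_mul, Matrix.map_one _ (map_zero _) (map_one _)])
        (fun z n => by rw [← map_matMul, gMat_mul_anti, Matrix.map_one _ (map_zero _) (map_one _)])
        (fun _ _ h _ _ _ _ _ _ _ _ => inclG_comm C cil h _ _)
        (fun _ _ _ _ _ _ => inclU_inclG_comm C cil _ _ _)⟩

end Coaction

/-! ### Haar forms -/

section Haar

variable {s : ℂ} (C : ClebschGordan s) {G : SimpleGraph V} (cil : Ciliation G)

/-- The subalgebra `Λ_X` generated by the matrix elements of `u(l)` for `l ∈ X`. -/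
def fieldSubalg (X : Set G.Dart) : Subalgebra ℂ (Lam C cil) :=
  Algebra.adjoin ℂ {A | ∃ l ∈ X, ∃ (n : ℕ) (i j : Idx n), A = uMat C cil l n i j}

/-- `h` is an invariant measure `∫ dh` on `Λ`: a nonzero linear form that is invariant under the
gauge coaction and factorises on subalgebras generated by disjoint sets of links. -/
structure IsHaar [DecidableEq V] (hs : s ≠ 0) (h : Lam C cil →ₗ[ℂ] ℂ) : Prop where
  ne_zero : h ≠ 0
  invariant : ∀ A : Lam C cil,
    TensorProduct.map h (LinearMap.id : GaugeAlg C V →ₗ[ℂ] GaugeAlg C V) (coaction C cil hs A) =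
      h A ⊗ₜ[ℂ] (1 : GaugeAlg C V)
  factor : ∀ X Y : Set G.Dart, (∀ l ∈ X, l ∉ Y ∧ l.symm ∉ Y) →
    ∀ A ∈ fieldSubalg C cil X, ∀ B ∈ fieldSubalg C cil Y, h (A * B) = h A * h B

end Haar

/-! ### In and Out states

The vertices `x_1, …, x_n` of a loop, and the labels attached to them, are indexed by `Fin n`, so
that `x_1` is `x 0` and `x_n` is `x (0 - 1)`, with cyclic addition on `Fin n`. -/

/-- A simple loop `[x_{n+1} = x_1, x_n, …, x_1]`; at each of its vertices the incoming edge
`x_{i-1} x_i` comes before the outgoing edge `x_i x_{i+1}` in the cilium order. -/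
structure Loop {G : SimpleGraph V} (cil : Ciliation G) (n : ℕ) [NeZero n] where
  x : Fin n → V
  inj : Function.Injective x
  adj : ∀ i, G.Adj (x i) (x (i + 1))
  cil_lt : ∀ i, cil.lt (x i) (x (i - 1)) (x (i + 1))

namespace Loop

variable {G : SimpleGraph V} {cil : Ciliation G} {n : ℕ} [NeZero n]

/-- The same loop with the numbering of the vertices shifted: `x_n` is the new `x_1`. -/
def rotate (L : Loop cil n) : Loop cil n where
  x := fun i => L.x (i - 1)
  inj := fun i j h => sub_left_injective (L.inj h)
  adj := fun i => by
    have h := L.adj (i - 1)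
    rwa [sub_add_eq_add_sub] at h
  cil_lt := fun i => by
    have h := L.cil_lt (i - 1)
    rwa [sub_add_eq_add_sub] at h

/-- The link `[x_i, x_{i+1}]`, with departure point `x_{i+1}` and end point `x_i`. -/
def back (L : Loop cil n) (i : Fin n) : G.Dart := ⟨(L.x (i + 1), L.x i), (L.adj i).symm⟩

/-- The link `[x_{i+1}, x_i]`, with departure point `x_i` and end point `x_{i+1}`. -/
def fwd (L : Loop cil n) (i : Fin n) : G.Dart := ⟨(L.x i, L.x (i + 1)), L.adj i⟩

end Loop

section States

variable {s : ℂ} (C : ClebschGordan s) {G : SimpleGraph V} {cil : Ciliation G} {n : ℕ} [NeZero n]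

/-- The matrix element of the maps between the link variables in the Out state: the product of
`ψ^{β_{i-1}}_{β_i α_i}` for `i ≠ 1`, and of `R⁻¹_{β_n α_1} μ_{β_n} ψ^{β_n}_{β_1 α_1}`, times
`v_{β_n}⁻¹`. Here `p i`, `r i` are the row and the column index of `u^{β_i}`. -/
def outCoeff (α β : Fin n → ℕ) (a : ∀ i, Idx (α i)) (p r : ∀ i, Idx (β i)) : ℂ :=
  (ribbon s (β (0 - 1)))⁻¹ *
    (∏ i ∈ Finset.univ.erase 0, C.ψ (β i) (α i) (β (i - 1)) (r (i - 1)) (p i, a i)) *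
    ∑ t : Idx (β (0 - 1)), ∑ w : Idx (β (0 - 1)), ∑ b : Idx (α 0),
      (Rmat s (β (0 - 1)) (α 0))⁻¹ (r (0 - 1), b) (t, a 0) * muMat s (β (0 - 1)) t w *
        C.ψ (β 0) (α 0) (β (0 - 1)) w (p 0, b)

/-- The component on `⨂ᵢ e_{a i}` of the Out state
`v_{β_n}⁻¹ tr (ψ^{β_n}_{β_1 α_1} u^{β_1}_{[x_1,x_2]} ψ^{β_1}_{β_2 α_2} ⋯
ψ^{β_{n-1}}_{β_n α_n} u^{β_n}_{[x_n,x_1]} R⁻¹_{β_n α_1} μ_{β_n})`. -/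
def outState (L : Loop cil n) (α β : Fin n → ℕ) (a : ∀ i, Idx (α i)) : Lam C cil :=
  ∑ p : ∀ i, Idx (β i), ∑ r : ∀ i, Idx (β i), outCoeff C α β a p r •
    (List.ofFn fun i => uMat C cil (L.back i) (β i) (p i) (r i)).prod

/-- The matrix element of the maps between the link variables in the In state: the product of
`φ_{β_{i-1}}^{β_i α_i}` for `i ≠ 1`, and of `φ_{β_n}^{β_1 α_1} μ_{β_n} R_{β_n α_1}`, times
`v_{β_n}`. Here `p i`, `r i` are the row and the column index of `u^{β_i}`. -/
def inCoeff (α β : Fin n → ℕ) (a : ∀ i, Idx (α i)) (p r : ∀ i, Idx (β i)) : ℂ :=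
  ribbon s (β (0 - 1)) *
    (∏ i ∈ Finset.univ.erase 0, C.φ (β i) (α i) (β (i - 1)) (r i, a i) (p (i - 1))) *
    ∑ w : Idx (β (0 - 1)), ∑ t : Idx (β (0 - 1)), ∑ b : Idx (α 0),
      muMat s (β (0 - 1)) w t * Rmat s (β (0 - 1)) (α 0) (t, a 0) (p (0 - 1), b) *
        C.φ (β 0) (α 0) (β (0 - 1)) (r 0, b) w

/-- The component on `⨂ᵢ e_{a i}` of the In state
`v_{β_n} tr (μ_{β_n} R_{β_n α_1} u^{β_n}_{[x_1,x_n]} φ_{β_{n-1}}^{β_n α_n} ⋯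
φ_{β_1}^{β_2 α_2} u^{β_1}_{[x_2,x_1]} φ_{β_n}^{β_1 α_1})`. -/
def inState (L : Loop cil n) (α β : Fin n → ℕ) (a : ∀ i, Idx (α i)) : Lam C cil :=
  ∑ p : ∀ i, Idx (β i), ∑ r : ∀ i, Idx (β i), inCoeff C α β a p r •
    (List.ofFn fun i => uMat C cil (L.fwd i) (β i) (p i) (r i)).reverse.prod

end States

end LatticeGauge

end

open scoped TensorProduct

noncomputable section

namespace LatticeGauge

/-! ### The coefficients of the R-matrix as a q-exponential series -/

section QExponential

variable {s : ℂ}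

/-! Matrices that multiply like `g` can be carried through the vertices `ψ` and `φ`. Besides `g`
itself there is a second family of this kind. The identity (id ⊗ Δ)R = R₁₃R₁₂, which is the
multiplicativity of the q-exponential on the q²-commuting summands of ΔF, says that the matrices R⁻¹
on V_d ⊗ V_n, read as matrices on V_n over End V_d, satisfy the relations of `Γ`, with R in the
place of S(g) (`blk_Rmat_inv_fuses`). For every such family S(g) is a transpose of g twisted by the
invariant vector φ^{aa}_0. Hence g also has an inverse for the opposite order of multiplication,
weighted by μ⁻¹ (`FusesG.sum_anti_mul`). Applied to R⁻¹, this inverts R with respect to one row and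
one column index.

Cyclicity. The vertex at which the trace is closed carries the extra factor R⁻¹μ/v (respectively
vμR). Contracted with the R⁻¹ that appears when two neighbouring links are exchanged, it contains
R⁻¹_{cb}R⁻¹_{ca}. The map ψ fuses this product to R⁻¹_{cc}, and the trace against μ of the latter is
the scalar v_c by Schur's lemma. So the special vertex becomes a regular one (`sum_Rmat_inv_outTw`,
`sum_inTw_Rmat`). Exchanging neighbouring links therefore trades special vertices for regular ones,
and the words of both numberings reduce to one word with two special vertices (`traceWord_cyclic`).

Gauge transformation. The gauge factors are regrouped by vertices. At a regular vertex S(g_c) ψ g_b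
= ψ S(g_a) is the intertwining property. At the special vertex the two factors meet in the opposite
order; contraction with R⁻¹ and the exchange relation of g reduce this case to the regular one, and
R⁻¹ is cancelled again (`FusesG.sum_outTw_mul`, `FusesG.sum_inTw_mul`).

Scalar product. Invariance of h, tested on the representation R⁻¹ of `Γ`, gives h(u^k) = 0 for k ≠
0. In 𝒪ℐ the links occur as u(l₁)⋯u(l_n)u(-l_n)⋯u(-l₁). The innermost pair expands into the
u^c(l_n), and since exchange relations do not change c, only c = 0 survives
(`IsHaar.apply_mul_mul`). Peeling off the pairs gives a product of Schur orthogonality relations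
with weight μ⁻¹ divided by the quantum dimension. They force β = β', and the remaining sum
factorises over the vertices, each of which contributes 1 (`sum_outAt_mul_inAt`). -/

theorem sq_zpow_inj (hs : s ≠ 0) (hq : ∀ k : ℕ, 0 < k → (s ^ 2) ^ k ≠ 1) {m n : ℤ}
    (h : (s ^ 2) ^ m = (s ^ 2) ^ n) : m = n := by
  have h0 : s ^ 2 ≠ 0 := pow_ne_zero _ hs
  have key : ∀ k : ℤ, 0 < k → (s ^ 2) ^ k ≠ 1 := by
    intro k hk
    lift k to ℕ using hk.le
    rw [zpow_natCast]
    exact hq k (by exact_mod_cast hk)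
  rcases lt_trichotomy m n with hmn | hmn | hmn
  · exact absurd (by rw [zpow_sub₀ h0, h, div_self (zpow_ne_zero _ h0)]) (key (n - m) (by omega))
  · exact hmn
  · exact absurd (by rw [zpow_sub₀ h0, h, div_self (zpow_ne_zero _ h0)]) (key (m - n) (by omega))

theorem sq_pow_sub_inv_ne (hs : s ≠ 0) (hq : ∀ k : ℕ, 0 < k → (s ^ 2) ^ k ≠ 1) {n : ℕ}
    (hn : 0 < n) : (s ^ 2) ^ n - ((s ^ 2) ^ n)⁻¹ ≠ 0 := by
  have h0 : (s ^ 2) ^ n ≠ 0 := pow_ne_zero _ (pow_ne_zero _ hs)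
  intro h
  refine hq (2 * n) (by omega) ?_
  rw [two_mul, pow_add]
  nth_rewrite 2 [sub_eq_zero.mp h]
  exact mul_inv_cancel₀ h0

theorem sq_sub_inv_ne (hs : s ≠ 0) (hq : ∀ k : ℕ, 0 < k → (s ^ 2) ^ k ≠ 1) :
    s ^ 2 - (s ^ 2)⁻¹ ≠ 0 := by
  simpa using sq_pow_sub_inv_ne hs hq one_pos

theorem qInt_ne (hs : s ≠ 0) (hq : ∀ k : ℕ, 0 < k → (s ^ 2) ^ k ≠ 1) {n : ℕ} (hn : 0 < n) :
    qInt s n ≠ 0 :=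
  div_ne_zero (sq_pow_sub_inv_ne hs hq hn) (sq_sub_inv_ne hs hq)

/-- The coefficients of the universal `R`-matrix. -/
def rCoeff (s : ℂ) (k : ℕ) : ℂ := s ^ (k * (k - 1)) * (s ^ 2 - (s ^ 2)⁻¹) ^ k / qFact s k

theorem rCoeff_zero : rCoeff s 0 = 1 := by simp [rCoeff, qFact]

/-- Up to powers of q and the factor q - q⁻¹, [k+1] is 1 - q^{-2(k+1)}. In this form the recursion
drives the induction for the q-exponential in base q⁻². -/
theorem rCoeff_succ (hs : s ≠ 0) (hq : ∀ k : ℕ, 0 < k → (s ^ 2) ^ k ≠ 1) (k : ℕ) :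
    rCoeff s (k + 1) * (1 - ((s ^ 4)⁻¹) ^ (k + 1)) =
      ((s ^ 2)⁻¹ * (s ^ 2 - (s ^ 2)⁻¹) ^ 2) * rCoeff s k := by
  have h1 := sq_pow_sub_inv_ne hs hq (Nat.succ_pos k)
  have h2 := sq_sub_inv_ne hs hq
  have h3 : qFact s k ≠ 0 := Finset.prod_ne_zero_iff.mpr fun i _ => qInt_ne hs hq (by omega)
  have e1 : s ^ ((k + 1) * (k + 1 - 1)) = s ^ (k * (k - 1)) * (s ^ 2) ^ k := by
    rw [← pow_mul, ← pow_add]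
    congr 1
    cases k <;> simp; ring
  have e2 : (1 - ((s ^ 4)⁻¹) ^ (k + 1)) =
      ((s ^ 2) ^ (k + 1) - ((s ^ 2) ^ (k + 1))⁻¹) * ((s ^ 2) ^ (k + 1))⁻¹ := by
    have : (s ^ 2) ^ (k + 1) ≠ 0 := pow_ne_zero _ (pow_ne_zero _ hs)
    rw [sub_mul, mul_inv_cancel₀ this, ← mul_inv, ← mul_pow, inv_pow]
    ring_nf
  have e3 : (s ^ 2) ^ k = (s ^ 2) ^ (k + 1) * (s ^ 2)⁻¹ := by
    rw [pow_succ (s ^ 2), mul_inv_cancel_right₀ (pow_ne_zero _ hs)]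
  rw [rCoeff, rCoeff, qFact, Finset.prod_range_succ, ← qFact, e1, e2, qInt,
    pow_succ (s ^ 2 - (s ^ 2)⁻¹), e3]
  generalize hx : (s ^ 2) ^ (k + 1) = x at *
  have hx0 : x ≠ 0 := hx ▸ pow_ne_zero _ (pow_ne_zero _ hs)
  generalize (s ^ 2 - (s ^ 2)⁻¹) = w at *
  generalize hy : x - x⁻¹ = y at *
  field_simp

/-- The multiplicativity of the `q`-exponential series on `q²`-commuting elements. -/
theorem rCoeff_smul_add_pow (hs : s ≠ 0) (hq : ∀ k : ℕ, 0 < k → (s ^ 2) ^ k ≠ 1)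
    {A : Type*} [Ring A] [Algebra ℂ A] {X Y : A} (h : Y * X = (s ^ 4) • (X * Y)) (k : ℕ) :
    rCoeff s k • (X + Y) ^ k = ∑ lm ∈ Finset.HasAntidiagonal.antidiagonal k,
      (rCoeff s lm.1 * rCoeff s lm.2) • (Y ^ lm.1 * X ^ lm.2) := by
  set p := (s ^ 4)⁻¹ with hp
  set θ := (s ^ 2)⁻¹ * (s ^ 2 - (s ^ 2)⁻¹) ^ 2 with hθ
  have hs4 : s ^ 4 ≠ 0 := pow_ne_zero _ hs
  have hYX : ∀ m : ℕ, X ^ m * Y = p ^ m • (Y * X ^ m) := by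
    intro m
    induction m with
    | zero => simp
    | succ m ih =>
      have hXY : X * Y = p • (Y * X) := by rw [h, smul_smul, hp, inv_mul_cancel₀ hs4, one_smul]
      rw [pow_succ, mul_assoc, hXY, mul_smul_comm, ← mul_assoc, ih, smul_mul_assoc, smul_smul,
        mul_assoc, pow_succ, mul_comm p]
  induction k with
  | zero => simp [rCoeff_zero]
  | succ k ih =>
    have hne : (1 - p ^ (k + 1)) ≠ 0 := by
      have h1 := sq_pow_sub_inv_ne hs hq (Nat.succ_pos k)
      intro h0
      have h2 := rCoeff_succ hs hq k
      rw [← hp, h0, mul_zero] at h2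
      refine mul_ne_zero (mul_ne_zero (inv_ne_zero (pow_ne_zero _ hs))
        (pow_ne_zero _ (sq_sub_inv_ne hs hq))) ?_ h2.symm
      exact div_ne_zero (mul_ne_zero (pow_ne_zero _ hs) (pow_ne_zero _ (sq_sub_inv_ne hs hq)))
        (Finset.prod_ne_zero_iff.mpr fun i _ => qInt_ne hs hq (by omega))
    -- Split 1 - p^{l+m} = (1 - p^m) + (1 - p^l)p^m. The first part is the effect of right
    -- multiplication by X, the second that of right multiplication by Y, which picks up p^m on its
    -- way through X^m.
    have e1 : ∑ lm ∈ Finset.HasAntidiagonal.antidiagonal (k + 1), (rCoeff s lm.1 *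
        (rCoeff s lm.2 * (1 - p ^ lm.2))) • (Y ^ lm.1 * X ^ lm.2) =
        θ • ((∑ lm ∈ Finset.HasAntidiagonal.antidiagonal k,
      (rCoeff s lm.1 * rCoeff s lm.2) • (Y ^ lm.1 * X ^ lm.2)) * X) := by
      rw [Finset.Nat.sum_antidiagonal_succ']
      simp only [pow_zero, sub_self, mul_zero, zero_smul, zero_add]
      rw [Finset.sum_mul, Finset.smul_sum]
      refine Finset.sum_congr rfl fun lm _ => ?_
      rw [rCoeff_succ hs hq, smul_mul_assoc, smul_smul, mul_assoc (Y ^ _), ← pow_succ]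
      congr 1
      ring
    have e2 : ∑ lm ∈ Finset.HasAntidiagonal.antidiagonal (k + 1), (rCoeff s lm.1 * (1 - p ^ lm.1) *
        (rCoeff s lm.2 * p ^ lm.2)) • (Y ^ lm.1 * X ^ lm.2) =
        θ • ((∑ lm ∈ Finset.HasAntidiagonal.antidiagonal k,
      (rCoeff s lm.1 * rCoeff s lm.2) • (Y ^ lm.1 * X ^ lm.2)) * Y) := by
      rw [Finset.Nat.sum_antidiagonal_succ]
      simp only [pow_zero, sub_self, mul_zero, zero_mul, zero_smul, zero_add]
      rw [Finset.sum_mul, Finset.smul_sum]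
      refine Finset.sum_congr rfl fun lm _ => ?_
      rw [rCoeff_succ hs hq, smul_mul_assoc, smul_smul, mul_assoc (Y ^ _), hYX, mul_smul_comm,
        smul_smul, ← mul_assoc (Y ^ _) Y, ← pow_succ]
      congr 1
      ring
    refine smul_right_injective A hne ?_
    simp only []
    rw [smul_smul, mul_comm, rCoeff_succ hs hq, ← hθ, pow_succ, ← smul_smul, ← smul_mul_assoc, ih,
      mul_add, smul_add, ← e1, ← e2, ← Finset.sum_add_distrib, Finset.smul_sum]
    refine Finset.sum_congr rfl fun lm hlm => ?_
    rw [← add_smul, smul_smul, ← Finset.HasAntidiagonal.mem_antidiagonal.mp hlm, pow_add]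
    congr 1
    ring

end QExponential

/-! ### The hexagon identity for R and the intertwiners -/

section Hexagon

variable {s : ℂ}

/-- Multiplies two series in E truncated at the same degree; the hypothesis will hold because
E^{d+1} = 0 on V_d. -/
theorem sum_range_sum_range_of_add {M : Type*} [AddCommMonoid M] (N : ℕ) (g : ℕ → ℕ → M)
    (hg : ∀ l m, N ≤ l + m → g l m = 0) :
    ∑ l ∈ Finset.range N, ∑ m ∈ Finset.range N, g l m =
      ∑ k ∈ Finset.range N, ∑ x ∈ Finset.HasAntidiagonal.antidiagonal k, g x.1 x.2 := by
  rw [← Finset.sum_product', ← Finset.sum_filter_add_sum_filter_not _ (fun x => x.1 + x.2 < N),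
    Finset.sum_eq_zero (s := Finset.filter (fun x : ℕ × ℕ => ¬ x.1 + x.2 < N) _)
      (fun x hx => hg _ _ (not_lt.mp (Finset.mem_filter.mp hx).2)), add_zero,
    ← Finset.sum_fiberwise_of_maps_to (t := Finset.range N) (g := fun x : ℕ × ℕ => x.1 + x.2)
      (fun x hx => Finset.mem_range.mpr (Finset.mem_filter.mp hx).2)]
  refine Finset.sum_congr rfl fun k hk => Finset.sum_congr ?_ fun _ _ => rfl
  ext x
  simp only [Finset.mem_filter, Finset.mem_product, Finset.mem_range,
    Finset.HasAntidiagonal.mem_antidiagonal] at hk ⊢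
  omega

theorem leg₁_pow {A : Type*} [Semiring A] {a : ℕ} (b : ℕ) (M : Matrix (Idx a) (Idx a) A) (k : ℕ) :
    leg₁ b (M ^ k) = leg₁ b M ^ k := by
  induction k with
  | zero => simp [leg₁_one]
  | succ k ih => rw [pow_succ, leg₁_mul, ih, pow_succ]

theorem leg₂_pow {A : Type*} [Semiring A] (a : ℕ) {b : ℕ} (M : Matrix (Idx b) (Idx b) A) (k : ℕ) :
    leg₂ a (M ^ k) = leg₂ a M ^ k := by
  induction k with
  | zero => simp [leg₂_one]
  | succ k ih => rw [pow_succ, leg₂_mul, ih, pow_succ]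

theorem leg_commute {A : Type*} [CommSemiring A] {a b : ℕ} (M : Matrix (Idx a) (Idx a) A)
    (N : Matrix (Idx b) (Idx b) A) : Commute (leg₁ b M) (leg₂ a N) :=
  leg_comm fun _ _ _ _ => Commute.all _ _

theorem repKinv_mul_repF (hs : s ≠ 0) (n : ℕ) :
    repKinv s n * repF s n = s ^ 4 • (repF s n * repKinv s n) := by
  ext i j
  simp only [repKinv, repF, Matrix.diagonal_mul, Matrix.mul_diagonal, Matrix.smul_apply,
    Matrix.of_apply, smul_eq_mul]
  split_ifs with h
  · have : -wt n i = -wt n j + 2 := by simp only [wt]; omega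
    rw [this, zpow_add₀ (pow_ne_zero _ hs)]
    norm_cast
    ring
  · simp

/-- The summands F ⊗ 1 and K⁻¹ ⊗ F of ΔF commute up to q² = s⁴, so the q-exponential of ΔF splits
into the product of theirs. -/
theorem tensF_pow_apply (hs : s ≠ 0) (hq : ∀ k : ℕ, 0 < k → (s ^ 2) ^ k ≠ 1) (a b k : ℕ)
    (p r : Idx a × Idx b) :
    (rCoeff s k • tensF s a b ^ k) p r = ∑ lm ∈ Finset.HasAntidiagonal.antidiagonal k,
      rCoeff s lm.1 * rCoeff s lm.2 * (s ^ (-(2 * lm.1 * wt a p.1)) *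
        (repF s a ^ lm.2) p.1 r.1 * (repF s b ^ lm.1) p.2 r.2) := by
  have h : leg₁ b (repKinv s a) * leg₂ a (repF s b) * leg₁ b (repF s a) =
      s ^ 4 • (leg₁ b (repF s a) * (leg₁ b (repKinv s a) * leg₂ a (repF s b))) := by
    rw [mul_assoc, ← (leg_commute _ _).eq, ← mul_assoc, ← mul_assoc, ← leg₁_mul, ← leg₁_mul,
      repKinv_mul_repF hs]
    ext p r
    rw [Matrix.smul_apply, leg₁_mul_leg₂_apply, leg₁_mul_leg₂_apply, Matrix.smul_apply,
      smul_eq_mul, smul_eq_mul, mul_assoc]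
  rw [tensF, rCoeff_smul_add_pow hs hq h, Matrix.sum_apply]
  refine Finset.sum_congr rfl fun lm _ => ?_
  rw [(leg_commute _ _).mul_pow, mul_assoc, ← leg₁_pow, ← leg₂_pow, ← leg₁_pow,
    ← (leg_commute _ _).eq, ← mul_assoc, ← leg₁_mul, Matrix.smul_apply, leg₁_mul_leg₂_apply,
    repKinv, Matrix.diagonal_pow, Matrix.diagonal_mul, smul_eq_mul, Pi.pow_apply]
  have e : ((s ^ 2) ^ (-wt a p.1)) ^ lm.1 = s ^ (-(2 * lm.1 * wt a p.1)) := by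
    rw [← zpow_natCast, ← zpow_mul, ← zpow_natCast s, ← zpow_mul]
    congr 1
    push_cast
    ring
  rw [e]

theorem repE_pow_apply_eq_zero (d : ℕ) (k : ℕ) (i j : Idx d) (h : (i : ℕ) + k ≠ j) :
    (repE s d ^ k) i j = 0 := by
  induction k generalizing i with
  | zero => rw [pow_zero, Matrix.one_apply_ne]; rintro rfl; simp at h
  | succ k ih =>
    rw [pow_succ', Matrix.mul_apply]
    refine Finset.sum_eq_zero fun x _ => ?_
    by_cases hx : (i : ℕ) + 1 = x
    · rw [ih x (by omega), mul_zero]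
    · simp [repE, hx]

theorem repE_pow_eq_zero {d k : ℕ} (h : d < k) : repE s d ^ k = 0 := by
  ext i j
  exact repE_pow_apply_eq_zero d k i j (by omega)

/-- The matrix of `q ^ (w H / 2)`. -/
def cartan (s : ℂ) (d : ℕ) (w : ℤ) : Matrix (Idx d) (Idx d) ℂ :=
  Matrix.diagonal fun i => s ^ (wt d i * w)

theorem cartan_add (hs : s ≠ 0) (d : ℕ) (w w' : ℤ) :
    cartan s d (w + w') = cartan s d w * cartan s d w' := by
  rw [cartan, cartan, cartan, Matrix.diagonal_mul_diagonal]
  congr 1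
  ext i
  rw [mul_add, zpow_add₀ hs]

theorem repE_pow_mul_cartan (hs : s ≠ 0) (d : ℕ) (w : ℤ) (l : ℕ) :
    repE s d ^ l * cartan s d w = s ^ (-(2 * l * w)) • (cartan s d w * repE s d ^ l) := by
  ext i j
  rw [cartan, Matrix.mul_diagonal, Matrix.smul_apply, Matrix.diagonal_mul, smul_eq_mul]
  by_cases h : (i : ℕ) + l = j
  · have : wt d j * w = -(2 * l * w) + wt d i * w := by
      simp only [wt]; rw [← h]; push_cast; ring
    rw [this, zpow_add₀ hs]
    ring
  · rw [repE_pow_apply_eq_zero d l i j h]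
    simp

/-- A matrix on `V_d ⊗ V_n` as a matrix on `V_n` with entries in `End V_d`. -/
def blk {d n : ℕ} (M : Matrix (Idx d × Idx n) (Idx d × Idx n) ℂ) :
    Matrix (Idx n) (Idx n) (Matrix (Idx d) (Idx d) ℂ) :=
  Matrix.of fun j j' => Matrix.of fun i i' => M (i, j) (i', j')

theorem blk_apply {d n : ℕ} (M : Matrix (Idx d × Idx n) (Idx d × Idx n) ℂ) (j j' : Idx n)
    (i i' : Idx d) : blk M j j' i i' = M (i, j) (i', j') := rfl

theorem blk_mul {d n : ℕ} (M N : Matrix (Idx d × Idx n) (Idx d × Idx n) ℂ) :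
    blk (M * N) = blk M * blk N := by
  ext j j' i i'
  simp only [blk_apply, Matrix.mul_apply, Matrix.sum_apply, Fintype.sum_prod_type_right]

theorem blk_one {d n : ℕ} : blk (1 : Matrix (Idx d × Idx n) (Idx d × Idx n) ℂ) = 1 := by
  ext j j' i i'
  rw [blk_apply, Matrix.one_apply, Matrix.one_apply]
  by_cases h : j = j' <;> simp [h, Matrix.one_apply]

theorem blk_Rmat_apply (s : ℂ) (d n : ℕ) (j j' : Idx n) :
    blk (Rmat s d n) j j' = cartan s d (wt n j) *
      ∑ k ∈ Finset.range (d + 1), (rCoeff s k * (repF s n ^ k) j j') • repE s d ^ k := by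
  ext i i'
  rw [blk_apply, Rmat, Matrix.diagonal_mul, cartan, Matrix.diagonal_mul, Matrix.sum_apply,
    Matrix.sum_apply]
  congr 1
  refine Finset.sum_congr rfl fun k _ => ?_
  rw [Matrix.smul_apply, leg₁_mul_leg₂_apply, Matrix.smul_apply, smul_eq_mul, smul_eq_mul, rCoeff]
  ring

/-- This is (id ⊗ Δ)R = R₁₃R₁₂ in components. Moving E^l through the Cartan part of the second
factor produces exactly the K^{-l} contained in the powers of ΔF. -/
theorem blk_Rmat_mul (hs : s ≠ 0) (hq : ∀ k : ℕ, 0 < k → (s ^ 2) ^ k ≠ 1) (d a b : ℕ)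
    (p r : Idx a × Idx b) :
    blk (Rmat s d b) p.2 r.2 * blk (Rmat s d a) p.1 r.1 =
      cartan s d (wt b p.2 + wt a p.1) * ∑ k ∈ Finset.range (d + 1),
        (rCoeff s k • tensF s a b ^ k) p r • repE s d ^ k := by
  have e : ∀ l m : ℕ, ((rCoeff s l * (repF s b ^ l) p.2 r.2) • repE s d ^ l) *
      (cartan s d (wt a p.1) * ((rCoeff s m * (repF s a ^ m) p.1 r.1) • repE s d ^ m)) =
      cartan s d (wt a p.1) * ((rCoeff s l * rCoeff s m * (s ^ (-(2 * l * wt a p.1)) *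
        (repF s a ^ m) p.1 r.1 * (repF s b ^ l) p.2 r.2)) • repE s d ^ (l + m)) := by
    intro l m
    rw [← mul_assoc, smul_mul_assoc, repE_pow_mul_cartan hs, smul_mul_assoc, smul_mul_assoc,
      mul_smul_comm, mul_assoc (cartan _ _ _), ← pow_add, mul_smul_comm, smul_smul, smul_smul]
    congr 1
    ring
  rw [blk_Rmat_apply, blk_Rmat_apply, cartan_add hs, mul_assoc, mul_assoc]
  congr 1
  rw [Finset.mul_sum, Finset.sum_mul_sum]
  simp only [e]
  rw [sum_range_sum_range_of_add, Finset.mul_sum]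
  · refine Finset.sum_congr rfl fun k _ => ?_
    rw [tensF_pow_apply hs hq, Finset.sum_smul, Finset.mul_sum]
    refine Finset.sum_congr rfl fun lm hlm => ?_
    rw [Finset.HasAntidiagonal.mem_antidiagonal.mp hlm]
  · intro l m h
    rw [repE_pow_eq_zero (by omega), smul_zero, mul_zero]

variable (C : ClebschGordan s)

theorem ψ_mul_tensF_pow (a b c k : ℕ) :
    C.ψ a b c * tensF s a b ^ k = repF s c ^ k * C.ψ a b c := by
  induction k with
  | zero => simp
  | succ k ih => rw [pow_succ, ← Matrix.mul_assoc, ih, Matrix.mul_assoc, C.ψ_F, pow_succ,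
      Matrix.mul_assoc]

theorem tensK_apply (hs : s ≠ 0) (a b : ℕ) : tensK s a b =
    Matrix.diagonal fun p => (s ^ 2) ^ (wt a p.1 + wt b p.2) := by
  ext p r
  rw [tensK, leg₁_mul_leg₂_apply, repK, repK]
  by_cases h : p = r
  · subst h; simp [zpow_add₀ (pow_ne_zero 2 hs)]
  · rw [Matrix.diagonal_apply_ne _ h]
    by_cases h1 : p.1 = r.1
    · rw [Matrix.diagonal_apply_ne (i := p.2) _ fun h2 => h (Prod.ext h1 h2), mul_zero]
    · rw [Matrix.diagonal_apply_ne _ h1, zero_mul]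

/-- Commutation with K conserves the eigenvalue q^weight, and q is not a root of unity, so the
weight itself is conserved. -/
theorem ψ_weight (hs : s ≠ 0) (hq : ∀ k : ℕ, 0 < k → (s ^ 2) ^ k ≠ 1) {a b c : ℕ} {t : Idx c}
    {p : Idx a × Idx b} (h : C.ψ a b c t p ≠ 0) : wt c t = wt a p.1 + wt b p.2 := by
  have e := congrFun (congrFun (C.ψ_K a b c) t) p
  rw [tensK_apply hs, Matrix.mul_diagonal, repK, Matrix.diagonal_mul, mul_comm] at e
  exact (sq_zpow_inj hs hq (mul_right_cancel₀ h e)).symm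

theorem φ_weight (hs : s ≠ 0) (hq : ∀ k : ℕ, 0 < k → (s ^ 2) ^ k ≠ 1) {a b c : ℕ} {t : Idx c}
    {p : Idx a × Idx b} (h : C.φ a b c p t ≠ 0) : wt c t = wt a p.1 + wt b p.2 := by
  have e := congrFun (congrFun (C.φ_K a b c) p) t
  rw [tensK_apply hs, Matrix.diagonal_mul, repK, Matrix.mul_diagonal, mul_comm] at e
  exact (sq_zpow_inj hs hq (mul_left_cancel₀ h e)).symm

/-- The hexagon identity `R (1 ⊗ ψ) = (1 ⊗ ψ) R₁₃ R₁₂`. -/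
theorem blk_Rmat_mul_ψ (hs : s ≠ 0) (hq : ∀ k : ℕ, 0 < k → (s ^ 2) ^ k ≠ 1) (d a b c : ℕ) :
    blk (Rmat s d c) * const (Matrix (Idx d) (Idx d) ℂ) (C.ψ a b c) =
      const (Matrix (Idx d) (Idx d) ℂ) (C.ψ a b c) *
        (leg₂ a (blk (Rmat s d b)) * leg₁ b (blk (Rmat s d a))) := by
  ext1 t p
  rw [Matrix.mul_apply, Matrix.mul_apply]
  have e1 : ∀ x, const (Matrix (Idx d) (Idx d) ℂ) (C.ψ a b c) t x *
      (leg₂ a (blk (Rmat s d b)) * leg₁ b (blk (Rmat s d a)) :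
        Matrix (Idx a × Idx b) (Idx a × Idx b) _) x p =
      cartan s d (wt c t) * (C.ψ a b c t x • ∑ k ∈ Finset.range (d + 1),
        (rCoeff s k • tensF s a b ^ k) x p • repE s d ^ k) := by
    intro x
    rw [leg₂_mul_leg₁_apply, blk_Rmat_mul hs hq, const, Matrix.map_apply, ← Algebra.smul_def,
      mul_smul_comm]
    -- The Cartan part of the product depends on the weight of x; wherever ψ does not vanish this is
    -- the weight of t, so the factor can be pulled out of the sum.
    by_cases h : C.ψ a b c t x = 0
    · rw [h, zero_smul, zero_smul]
    · rw [ψ_weight C hs hq h, add_comm (wt a x.1)]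
  have e2 : ∀ u, blk (Rmat s d c) t u * const (Matrix (Idx d) (Idx d) ℂ) (C.ψ a b c) u p =
      cartan s d (wt c t) * ∑ k ∈ Finset.range (d + 1),
        (rCoeff s k * ((repF s c ^ k) t u * C.ψ a b c u p)) • repE s d ^ k := by
    intro u
    rw [blk_Rmat_apply, const, Matrix.map_apply, ← Algebra.commutes, ← Algebra.smul_def,
      ← mul_smul_comm, Finset.smul_sum]
    refine congrArg _ (Finset.sum_congr rfl fun k _ => ?_)
    rw [smul_smul]
    congr 1
    ring
  simp only [e1, e2, ← Finset.mul_sum]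
  congr 1
  rw [Finset.sum_comm]
  simp only [Finset.smul_sum]
  rw [Finset.sum_comm (s := Finset.univ (α := Idx a × Idx b))]
  refine Finset.sum_congr rfl fun k _ => ?_
  simp only [smul_smul, ← Finset.sum_smul]
  congr 1
  have := congrFun (congrFun (ψ_mul_tensF_pow C a b c k) t) p
  rw [Matrix.mul_apply, Matrix.mul_apply] at this
  rw [← Finset.mul_sum, ← this, Finset.mul_sum]
  refine Finset.sum_congr rfl fun x _ => ?_
  rw [Matrix.smul_apply, smul_eq_mul]
  ring

end Hexagon

/-! ### Invariant vectors, quantum dimension and the antipode -/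

section Fusion

variable {s : ℂ} {C : ClebschGordan s}

theorem mem_channels {a b c : ℕ} (h : Adm a b c) : c ∈ channels a b :=
  Finset.mem_filter.mpr ⟨Finset.mem_range.mpr (by have := h.2.1; omega), h⟩

section Mul

variable {A : Type*} [Semiring A] [Algebra ℂ A] {g S : ∀ n, Matrix (Idx n) (Idx n) A}

/-- The fusion relation compressed to one channel by ψφ = δ; for inadmissible labels both sides
vanish. -/
theorem FusesG.ψ_mul (h : FusesG C g) (a b c : ℕ) :
    const A (C.ψ a b c) * (leg₁ b (g a) * leg₂ a (g b)) = g c * const A (C.ψ a b c) := by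
  by_cases hc : Adm a b c
  · rw [h a b, Matrix.mul_sum, Finset.sum_eq_single c]
    · rw [← Matrix.mul_assoc, ← Matrix.mul_assoc, ← const_mul, C.ψ_φ_self a b c hc, const_one,
        Matrix.one_mul]
    · intro d _ hd
      rw [← Matrix.mul_assoc, ← Matrix.mul_assoc, ← const_mul, C.ψ_φ_ne a b c d hd.symm,
        const_zero, Matrix.zero_mul, Matrix.zero_mul]
    · exact fun hn => absurd (mem_channels hc) hn
  · rw [C.ψ_zero a b c hc, const_zero, Matrix.zero_mul, Matrix.mul_zero]

theorem FusesG.mul_φ (h : FusesG C g) (a b c : ℕ) :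
    leg₁ b (g a) * leg₂ a (g b) * const A (C.φ a b c) = const A (C.φ a b c) * g c := by
  by_cases hc : Adm a b c
  · rw [h a b, Matrix.sum_mul, Finset.sum_eq_single c]
    · rw [Matrix.mul_assoc, ← const_mul, C.ψ_φ_self a b c hc, const_one, Matrix.mul_one]
    · intro d _ hd
      rw [Matrix.mul_assoc, ← const_mul, C.ψ_φ_ne a b d c hd, const_zero, Matrix.mul_zero]
    · exact fun hn => absurd (mem_channels hc) hn
  · rw [C.φ_zero a b c hc, const_zero, Matrix.zero_mul, Matrix.mul_zero]

theorem FusesG.anti_mul_φ (h : FusesG C g) (hl : ∀ n, S n * g n = 1) (hr : ∀ n, g n * S n = 1)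
    (a b c : ℕ) :
    leg₂ a (S b) * leg₁ b (S a) * const A (C.φ a b c) = const A (C.φ a b c) * S c := by
  have e := congrArg (fun M => leg₂ a (S b) * leg₁ b (S a) * M * S c) (h.mul_φ a b c)
  simp only [Matrix.mul_assoc, hr, Matrix.mul_one] at e
  rw [Matrix.mul_assoc, ← e, ← Matrix.mul_assoc (leg₁ b (S a)), ← leg₁_mul, hl, leg₁_one,
    Matrix.one_mul, ← Matrix.mul_assoc (leg₂ a (S b)), ← leg₂_mul, hl, leg₂_one, Matrix.one_mul]

end Mul

/-- The component of `φ^{aa}_0` on `e_i ⊗ e_{a-i}`. -/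
def cup (C : ClebschGordan s) (a : ℕ) (i : Idx a) : ℂ := C.φ a a 0 (i, i.rev) 0

/-- The component of `ψ_{aa}^0` on `e_i ⊗ e_{a-i}`. -/
def cap (C : ClebschGordan s) (a : ℕ) (i : Idx a) : ℂ := C.ψ a a 0 0 (i, i.rev)

/-- The eigenvalue of `μ` on `e_i`. -/
def muW (s : ℂ) (a : ℕ) (i : Idx a) : ℂ := (s ^ 2) ^ wt a i

theorem muW_ne (hs : s ≠ 0) (a : ℕ) (i : Idx a) : muW s a i ≠ 0 :=
  zpow_ne_zero _ (pow_ne_zero _ hs)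

theorem wt_rev (a : ℕ) (i : Idx a) : wt a i.rev = -wt a i := by
  simp only [wt, Fin.val_rev]; omega

theorem muW_rev (a : ℕ) (i : Idx a) : muW s a i.rev = (muW s a i)⁻¹ := by
  rw [muW, wt_rev, zpow_neg, muW]

theorem sum_muW_inv (s : ℂ) (a : ℕ) : ∑ i, (muW s a i)⁻¹ = ∑ i, muW s a i := by
  rw [← Equiv.sum_comp Fin.revPerm]
  exact Finset.sum_congr rfl fun i _ => by rw [Fin.revPerm_apply, muW_rev, inv_inv]

theorem eq_rev_of_wt {a : ℕ} {i j : Idx a} (h : wt 0 (0 : Idx 0) = wt a i + wt a j) :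
    j = i.rev := by
  apply Fin.ext
  simp only [wt, Fin.val_rev] at h ⊢
  simp at h
  omega

theorem φ_zero_apply (hs : s ≠ 0) (hq : ∀ k : ℕ, 0 < k → (s ^ 2) ^ k ≠ 1) (a : ℕ) (i j : Idx a)
    (z : Idx 0) : C.φ a a 0 (i, j) z = if j = i.rev then cup C a i else 0 := by
  rw [idx_zero_eq z 0]
  split_ifs with h
  · rw [h, cup]
  · by_contra h0
    exact h (eq_rev_of_wt (φ_weight C hs hq h0))

theorem ψ_zero_apply (hs : s ≠ 0) (hq : ∀ k : ℕ, 0 < k → (s ^ 2) ^ k ≠ 1) (a : ℕ) (i j : Idx a)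
    (z : Idx 0) : C.ψ a a 0 z (i, j) = if j = i.rev then cap C a i else 0 := by
  rw [idx_zero_eq z 0]
  split_ifs with h
  · rw [h, cap]
  · by_contra h0
    exact h (eq_rev_of_wt (ψ_weight C hs hq h0))

theorem repE_zero : repE s 0 = 0 := by
  ext i j
  simp only [repE, Matrix.of_apply, Matrix.zero_apply]
  rw [if_neg (by omega)]

theorem tensE_apply (a b : ℕ) (p r : Idx a × Idx b) : tensE s a b p r =
    repE s a p.1 r.1 * repK s b p.2 r.2 + if p.1 = r.1 then repE s b p.2 r.2 else 0 := by
  rw [tensE, Matrix.add_apply, leg₁_mul_leg₂_apply]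
  rfl

theorem repE_succ_apply (a i : ℕ) (h : i < a) :
    repE s a ⟨i, by omega⟩ ⟨i + 1, by omega⟩ = qInt s (a - i) := by
  simp [repE]

/-- E acts as zero on V_0, hence ΔE annihilates φ^{aa}_0. The recursion is the coefficient of this
at e_i ⊗ e_{a-i-1}. -/
theorem cup_succ (hs : s ≠ 0) (hq : ∀ k : ℕ, 0 < k → (s ^ 2) ^ k ≠ 1) (a i : ℕ) (h : i < a) :
    qInt s (a - i) * muW s a ⟨a - i - 1, by omega⟩ * cup C a ⟨i + 1, by omega⟩ +
      qInt s (i + 1) * cup C a ⟨i, by omega⟩ = 0 := by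
  have e := congrFun (congrFun (C.φ_E a a 0) (⟨i, by omega⟩, ⟨a - i - 1, by omega⟩)) 0
  rw [repE_zero, Matrix.mul_zero, Matrix.zero_apply, Matrix.mul_apply] at e
  simp only [tensE_apply, add_mul, Finset.sum_add_distrib] at e
  rw [← e, Fintype.sum_prod_type, Fintype.sum_prod_type]
  congr 1
  · rw [Finset.sum_eq_single ⟨i + 1, by omega⟩, Finset.sum_eq_single ⟨a - i - 1, by omega⟩]
    · simp only []
      rw [repE_succ_apply _ _ h, repK, Matrix.diagonal_apply_eq, φ_zero_apply hs hq, if_pos, muW]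
      simp only [Fin.ext_iff, Fin.val_rev]; omega
    · intro y _ hy
      rw [repK, Matrix.diagonal_apply_ne _ (Ne.symm hy)]
      ring
    · simp
    · intro x _ hx
      refine Finset.sum_eq_zero fun y _ => ?_
      have : ¬ (i + 1 = (x : ℕ)) := fun h' => hx (Fin.ext h'.symm)
      simp [repE, this]
    · simp
  · rw [Finset.sum_eq_single ⟨i, by omega⟩, Finset.sum_eq_single ⟨a - i, by omega⟩]
    · simp only [if_true]
      have h1 : repE s a ⟨a - i - 1, by omega⟩ ⟨a - i, by omega⟩ = qInt s (i + 1) := by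
        simp only [repE, Matrix.of_apply]
        rw [if_pos (by omega)]
        congr 1
        omega
      rw [h1, φ_zero_apply hs hq, if_pos]
      simp only [Fin.ext_iff, Fin.val_rev]; omega
    · intro y _ hy
      have hn : ¬ y = (⟨i, by omega⟩ : Idx a).rev := by
        rintro rfl
        exact hy (Fin.ext (by simp only [Fin.val_rev]; omega))
      rw [φ_zero_apply hs hq, if_neg hn, mul_zero]
    · simp
    · intro x _ hx
      refine Finset.sum_eq_zero fun y _ => ?_
      rw [if_neg (Ne.symm hx), zero_mul]
    · simp

/-- Dually, ψ_{aa}^0 ΔE = 0, read on e_{i+1} ⊗ e_{a-i}. -/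
theorem cap_succ (hs : s ≠ 0) (hq : ∀ k : ℕ, 0 < k → (s ^ 2) ^ k ≠ 1) (a i : ℕ) (h : i < a) :
    qInt s (a - i) * muW s a ⟨a - i, by omega⟩ * cap C a ⟨i, by omega⟩ +
      qInt s (i + 1) * cap C a ⟨i + 1, by omega⟩ = 0 := by
  have e := congrFun (congrFun (C.ψ_E a a 0) 0) (⟨i + 1, by omega⟩, ⟨a - i, by omega⟩)
  rw [repE_zero, Matrix.zero_mul, Matrix.zero_apply, Matrix.mul_apply] at e
  simp only [tensE_apply, mul_add, Finset.sum_add_distrib] at e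
  rw [← e, Fintype.sum_prod_type, Fintype.sum_prod_type]
  congr 1
  · rw [Finset.sum_eq_single ⟨i, by omega⟩, Finset.sum_eq_single ⟨a - i, by omega⟩]
    · simp only []
      rw [repE_succ_apply _ _ h, repK, Matrix.diagonal_apply_eq, ψ_zero_apply hs hq, if_pos, muW]
      · ring
      · simp only [Fin.ext_iff, Fin.val_rev]; omega
    · intro y _ hy
      rw [repK, Matrix.diagonal_apply_ne _ hy]
      ring
    · simp
    · intro x _ hx
      refine Finset.sum_eq_zero fun y _ => ?_
      have : ¬ ((x : ℕ) + 1 = i + 1) := fun h' => hx (Fin.ext (by simpa using h'))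
      simp only [repE, Matrix.of_apply]
      rw [if_neg this, zero_mul, mul_zero]
    · simp
  · rw [Finset.sum_eq_single ⟨i + 1, by omega⟩, Finset.sum_eq_single ⟨a - i - 1, by omega⟩]
    · simp only [if_true]
      have h1 : repE s a ⟨a - i - 1, by omega⟩ ⟨a - i, by omega⟩ = qInt s (i + 1) := by
        simp only [repE, Matrix.of_apply]
        rw [if_pos (by omega)]
        congr 1
        omega
      rw [h1, ψ_zero_apply hs hq, if_pos]
      · ring
      · simp only [Fin.ext_iff, Fin.val_rev]; omega
    · intro y _ hy
      rw [ψ_zero_apply hs hq, if_neg, zero_mul]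
      rintro rfl
      exact hy (Fin.ext (by simp only [Fin.val_rev]; omega))
    · simp
    · intro x _ hx
      refine Finset.sum_eq_zero fun y _ => ?_
      rw [if_neg hx, mul_zero]
    · simp

theorem fin_const {a : ℕ} {f : Idx a → ℂ}
    (h : ∀ i (hi : i < a), f ⟨i + 1, by omega⟩ = f ⟨i, by omega⟩) (i : Idx a) : f i = f 0 := by
  obtain ⟨i, hi⟩ := i
  induction i with
  | zero => rfl
  | succ i ih => rw [h i (by omega), ih]

theorem muW_succ (hs : s ≠ 0) (a i : ℕ) (h : i < a) :
    muW s a ⟨i, by omega⟩ = s ^ 4 * muW s a ⟨i + 1, by omega⟩ := by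
  have h0 : s ^ 2 ≠ 0 := pow_ne_zero _ hs
  have : wt a ⟨i, by omega⟩ = 2 + wt a ⟨i + 1, by omega⟩ := by
    simp only [wt]; push_cast; ring
  rw [muW, this, zpow_add₀ h0, muW]
  congr 1
  norm_cast
  ring

theorem adm_self_zero (a : ℕ) : Adm a a 0 := ⟨by simp, by omega, by omega, by omega⟩

theorem sum_cap_mul_cup (hs : s ≠ 0) (hq : ∀ k : ℕ, 0 < k → (s ^ 2) ^ k ≠ 1) (a : ℕ) :
    ∑ i, cap C a i * cup C a i = 1 := by
  have e := congrFun (congrFun (C.ψ_φ_self a a 0 (adm_self_zero a)) 0) 0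
  rw [Matrix.mul_apply, Fintype.sum_prod_type, Matrix.one_apply_eq] at e
  rw [← e]
  refine Finset.sum_congr rfl fun i _ => ?_
  rw [Finset.sum_eq_single i.rev]
  · rfl
  · intro j _ hj
    rw [ψ_zero_apply hs hq, if_neg hj, zero_mul]
  · simp

/-- The two recursions make cap · cup proportional to μ, and ψφ = 1 fixes the factor. A by-product
is that the quantum dimension ∑ μ is nonzero and that no `cup` vanishes. -/
theorem cap_mul_cup (hs : s ≠ 0) (hq : ∀ k : ℕ, 0 < k → (s ^ 2) ^ k ≠ 1) (a : ℕ) (i : Idx a) :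
    cap C a i * cup C a i * ∑ j, muW s a j = muW s a i := by
  have h4 : s ^ 4 ≠ 0 := pow_ne_zero _ hs
  have hc : ∀ i, cap C a i * cup C a i * (muW s a i)⁻¹ = cap C a 0 * cup C a 0 * (muW s a 0)⁻¹ := by
    refine fin_const (f := fun i => cap C a i * cup C a i * (muW s a i)⁻¹) fun i hi => ?_
    have h1 := cup_succ (C := C) hs hq a i hi
    have h2 := cap_succ (C := C) hs hq a i hi
    have h3 := muW_succ hs a i hi
    have h5 := muW_succ hs a (a - i - 1) (by omega)
    have h6 : (⟨a - i - 1 + 1, by omega⟩ : Idx a) = ⟨a - i, by omega⟩ := Fin.ext (by simp; omega)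
    rw [h6] at h5
    have n1 := qInt_ne hs hq (n := a - i) (by omega)
    have n2 := qInt_ne hs hq (n := i + 1) (by omega)
    have n3 := muW_ne hs a ⟨i + 1, by omega⟩
    have n4 := muW_ne hs a ⟨a - i, by omega⟩
    rw [h5] at h1
    rw [h3]
    field_simp
    generalize cup C a ⟨i + 1, by omega⟩ = x at *
    generalize cup C a ⟨i, by omega⟩ = x' at *
    generalize cap C a ⟨i + 1, by omega⟩ = y at *
    generalize cap C a ⟨i, by omega⟩ = y' at *
    generalize qInt s (a - i) = u at *
    generalize qInt s (i + 1) = v at *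
    generalize muW s a ⟨a - i, by omega⟩ = m at *
    refine mul_left_cancel₀ (mul_ne_zero (mul_ne_zero n1 n2) n4) ?_
    linear_combination (v * y) * h1 - v * x' * h2
  have hsum := sum_cap_mul_cup (C := C) hs hq a
  have hi : ∀ j, cap C a j * cup C a j = cap C a 0 * cup C a 0 * (muW s a 0)⁻¹ * muW s a j := by
    intro j
    rw [← hc j, inv_mul_cancel_right₀ (muW_ne hs a j)]
  rw [hi i, mul_right_comm, Finset.mul_sum]
  simp only [← hi]
  rw [hsum, one_mul]

theorem sum_muW_ne (C : ClebschGordan s) (hs : s ≠ 0) (hq : ∀ k : ℕ, 0 < k → (s ^ 2) ^ k ≠ 1)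
    (a : ℕ) : ∑ j, muW s a j ≠ 0 := fun h => by
  have := cap_mul_cup (C := C) hs hq a 0
  rw [h, mul_zero] at this
  exact muW_ne hs a 0 this.symm

theorem cup_ne (hs : s ≠ 0) (hq : ∀ k : ℕ, 0 < k → (s ^ 2) ^ k ≠ 1) (a : ℕ) (i : Idx a) :
    cup C a i ≠ 0 := fun h => by
  have := cap_mul_cup (C := C) hs hq a i
  rw [h, mul_zero, zero_mul] at this
  exact muW_ne hs a i this.symm

/-- Exchanging the legs of the invariant vector amounts to the action of μ⁻¹ up to a constant. Its
value is irrelevant, since it is eliminated again in `FusesG.sum_anti_mul`. -/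
theorem exists_cup_rev (C : ClebschGordan s) (hs : s ≠ 0)
    (hq : ∀ k : ℕ, 0 < k → (s ^ 2) ^ k ≠ 1) (a : ℕ) :
    ∃ κ : ℂ, ∀ i, (muW s a i)⁻¹ * cup C a i = κ * cup C a i.rev := by
  refine ⟨(muW s a 0)⁻¹ * cup C a 0 / cup C a (Fin.rev 0), fun i => ?_⟩
  rw [← div_eq_iff (cup_ne hs hq a _)]
  refine fin_const (f := fun i => (muW s a i)⁻¹ * cup C a i / cup C a i.rev) (fun i hi => ?_) i
  have h1 := cup_succ (C := C) hs hq a i hi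
  have h2 := cup_succ (C := C) hs hq a (a - i - 1) (by omega)
  have h3 := muW_succ hs a i hi
  have r1 : (⟨i + 1, by omega⟩ : Idx a).rev = ⟨a - i - 1, by omega⟩ :=
    Fin.ext (by simp only [Fin.val_rev]; omega)
  have r2 : (⟨i, by omega⟩ : Idx a).rev = ⟨a - i, by omega⟩ :=
    Fin.ext (by simp only [Fin.val_rev]; omega)
  have r3 : (⟨a - i - 1 + 1, by omega⟩ : Idx a) = ⟨a - i, by omega⟩ := Fin.ext (by simp; omega)
  have r4 : (⟨a - (a - i - 1) - 1, by omega⟩ : Idx a) = ⟨i, by omega⟩ := Fin.ext (by simp; omega)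
  have m1 : muW s a ⟨a - i - 1, by omega⟩ = (muW s a ⟨i + 1, by omega⟩)⁻¹ := by
    rw [← r1, muW_rev]
  have n5 := cup_ne (C := C) hs hq a ⟨a - i - 1, by omega⟩
  have n6 := cup_ne (C := C) hs hq a ⟨a - i, by omega⟩
  rw [r3, r4, show a - (a - i - 1) = i + 1 by omega, show a - i - 1 + 1 = a - i by omega, h3] at h2
  rw [m1] at h1
  simp only [r1, r2]
  rw [h3]
  have n1 := qInt_ne hs hq (n := a - i) (by omega)
  have n2 := qInt_ne hs hq (n := i + 1) (by omega)
  have n3 := muW_ne hs a ⟨i + 1, by omega⟩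
  have h4 : s ^ 4 ≠ 0 := pow_ne_zero _ hs
  rw [div_eq_div_iff n5 n6]
  generalize cup C a ⟨i + 1, by omega⟩ = x at *
  generalize cup C a ⟨i, by omega⟩ = x' at *
  generalize cup C a ⟨a - i - 1, by omega⟩ = y at *
  generalize cup C a ⟨a - i, by omega⟩ = y' at *
  generalize qInt s (a - i) = u at *
  generalize qInt s (i + 1) = v at *
  generalize muW s a ⟨i + 1, by omega⟩ = m at *
  field_simp at h1 ⊢
  refine mul_left_cancel₀ n1 ?_
  linear_combination (s ^ 4 * y') * h1 - x' * h2

/-! ### The antipode as a twisted transpose -/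

section Transpose

variable {A : Type*} [Semiring A] [Algebra ℂ A] {g S : ∀ n, Matrix (Idx n) (Idx n) A}

theorem FusesG.sum_cup (h : FusesG C g) (g0 : g 0 = 1) (hs : s ≠ 0)
    (hq : ∀ k : ℕ, 0 < k → (s ^ 2) ^ k ≠ 1) (a : ℕ) (p p' : Idx a) :
    ∑ i, cup C a i • (g a p i * g a p' i.rev) = if p' = p.rev then algebraMap ℂ A (cup C a p) else 0 := by
  have e := congrFun (congrFun (h.mul_φ a a 0) (p, p')) 0
  rw [g0, Matrix.mul_one, Matrix.mul_apply, Fintype.sum_prod_type, const, Matrix.map_apply,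
    φ_zero_apply hs hq, apply_ite (algebraMap ℂ A), map_zero] at e
  rw [← e]
  refine Finset.sum_congr rfl fun i _ => ?_
  rw [Finset.sum_eq_single i.rev]
  · rw [leg₁_mul_leg₂_apply, Matrix.map_apply, φ_zero_apply hs hq, if_pos rfl, Algebra.smul_def,
      Algebra.commutes]
  · intro j _ hj
    rw [Matrix.map_apply, φ_zero_apply hs hq, if_neg hj, map_zero, mul_zero]
  · simp

/-- Multiplying the invariance (g ⊗ g)φ = φ from the left by S on the first leg removes one g, so
S(g) is the transpose of g conjugated by the invariant vector. -/
theorem FusesG.anti_eq (h : FusesG C g) (g0 : g 0 = 1) (hl : ∀ n, S n * g n = 1) (hs : s ≠ 0)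
    (hq : ∀ k : ℕ, 0 < k → (s ^ 2) ^ k ≠ 1) (a : ℕ) (i j : Idx a) :
    cup C a j • S a i j = cup C a i • g a j.rev i.rev := by
  have e : ∑ p, S a i p * ∑ k, cup C a k • (g a p k * g a j.rev k.rev) = cup C a j • S a i j := by
    simp only [h.sum_cup g0 hs hq]
    rw [Finset.sum_eq_single j]
    · rw [if_pos rfl, Algebra.smul_def, Algebra.commutes]
    · intro p _ hp
      rw [if_neg fun h => hp (Fin.rev_injective h).symm, mul_zero]
    · simp
  rw [← e]
  simp only [Finset.mul_sum]
  rw [Finset.sum_comm]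
  have e2 : ∀ k, ∑ p, S a i p * cup C a k • (g a p k * g a j.rev k.rev) =
      (if i = k then cup C a k • g a j.rev k.rev else 0) := by
    intro k
    have := congrFun (congrFun (hl a) i) k
    rw [Matrix.mul_apply, Matrix.one_apply] at this
    simp only [mul_smul_comm, ← mul_assoc]
    rw [← Finset.smul_sum, ← Finset.sum_mul, this]
    split_ifs <;> simp
  simp only [e2]
  simp

/-- The inverse of `g` for the opposite order of the product. -/
theorem FusesG.sum_anti_mul (h : FusesG C g) (g0 : g 0 = 1) (hl : ∀ n, S n * g n = 1) (hs : s ≠ 0)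
    (hq : ∀ k : ℕ, 0 < k → (s ^ 2) ^ k ≠ 1) (a : ℕ) (p r : Idx a) :
    ∑ x, (muW s a x)⁻¹ • (S a x r * g a p x) =
      if p = r then algebraMap ℂ A (muW s a r)⁻¹ else 0 := by
  obtain ⟨κ, hκ⟩ := exists_cup_rev C hs hq a
  have hr := cup_ne (C := C) hs hq a r
  -- Replacing S by the twisted transpose turns the sum into the invariance of φ^{aa}_0 for g once
  -- more, with the summation index reversed; μ⁻¹ is absorbed by κ.
  have e : cup C a r • ∑ x, (muW s a x)⁻¹ • (S a x r * g a p x) =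
      κ • ∑ i, cup C a i • (g a r.rev i * g a p i.rev) := by
    rw [← Equiv.sum_comp Fin.revPerm (fun i => cup C a i • (g a r.rev i * g a p i.rev)),
      Finset.smul_sum, Finset.smul_sum]
    refine Finset.sum_congr rfl fun x _ => ?_
    rw [Fin.revPerm_apply, Fin.rev_rev, smul_comm, ← smul_mul_assoc (cup C a r),
      h.anti_eq g0 hl hs hq, smul_mul_assoc, smul_smul, smul_smul, hκ]
  rw [h.sum_cup g0 hs hq, Fin.rev_rev] at e
  have e3 : ∑ x, (muW s a x)⁻¹ • (S a x r * g a p x) =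
      (cup C a r)⁻¹ • cup C a r • ∑ x, (muW s a x)⁻¹ • (S a x r * g a p x) := by
    rw [smul_smul, inv_mul_cancel₀ hr, one_smul]
  rw [e3, e]
  split_ifs with hpr
  · rw [Algebra.smul_def, Algebra.smul_def, ← map_mul, ← map_mul]
    congr 1
    rw [← hκ]
    field_simp
  · simp

end Transpose

end Fusion

/-! ### R⁻¹ as a representation of `Γ`, its twist, and the special vertices -/

section RMatrix

variable {s : ℂ}

theorem blk_Rmat_mul_inv (C : ClebschGordan s) (hs : s ≠ 0) (d n : ℕ) :
    blk (Rmat s d n) * blk (Rmat s d n)⁻¹ = 1 := by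
  rw [← blk_mul, Rmat_mul_inv (C := C) hs, blk_one]

theorem blk_Rmat_inv_mul (C : ClebschGordan s) (hs : s ≠ 0) (d n : ℕ) :
    blk (Rmat s d n)⁻¹ * blk (Rmat s d n) = 1 := by
  rw [← blk_mul, Rmat_inv_mul (C := C) hs, blk_one]

/-- The matrices `R⁻¹` form a representation of the algebra `Γ`. -/
theorem blk_Rmat_inv_fuses (C : ClebschGordan s) (hs : s ≠ 0) (hq : ∀ k : ℕ, 0 < k → (s ^ 2) ^ k ≠ 1) (d : ℕ) :
    FusesG C fun n => blk (Rmat s d n)⁻¹ := by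
  intro a b
  -- Inverting the hexagon identity reverses R₁₃R₁₂, so the inverses appear in the order of g₁g₂.
  have e : ∀ c, const (Matrix (Idx d) (Idx d) ℂ) (C.ψ a b c) *
      (leg₁ b (blk (Rmat s d a)⁻¹) * leg₂ a (blk (Rmat s d b)⁻¹)) =
      blk (Rmat s d c)⁻¹ * const (Matrix (Idx d) (Idx d) ℂ) (C.ψ a b c) := by
    intro c
    have h := congrArg (fun M : Matrix _ (Idx a × Idx b) (Matrix (Idx d) (Idx d) ℂ) =>
      blk (Rmat s d c)⁻¹ * M *
      (leg₁ b (blk (Rmat s d a)⁻¹) * leg₂ a (blk (Rmat s d b)⁻¹))) (blk_Rmat_mul_ψ C hs hq d a b c)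
    rw [← Matrix.mul_assoc (blk (Rmat s d c)⁻¹) (blk (Rmat s d c)), blk_Rmat_inv_mul C hs,
      Matrix.one_mul] at h
    rw [h]
    simp only [Matrix.mul_assoc]
    rw [← Matrix.mul_assoc (leg₁ b (blk (Rmat s d a))), ← leg₁_mul, blk_Rmat_mul_inv C hs, leg₁_one,
      Matrix.one_mul, ← leg₂_mul, blk_Rmat_mul_inv C hs, leg₂_one, Matrix.mul_one]
  have h1 : ∑ c ∈ channels a b, const (Matrix (Idx d) (Idx d) ℂ) (C.φ a b c) *
      const (Matrix (Idx d) (Idx d) ℂ) (C.ψ a b c) = 1 := by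
    simp only [← const_mul]
    rw [← const_sum, C.complete, const_one]
  rw [← Matrix.one_mul (leg₁ b _ * _), ← h1, Matrix.sum_mul]
  refine Finset.sum_congr rfl fun c _ => ?_
  rw [Matrix.mul_assoc, e, Matrix.mul_assoc]

theorem Rmat_zero_right (s : ℂ) (d : ℕ) : Rmat s d 0 = 1 := by
  have hF : repF s 0 = 0 := by
    ext i j
    simp only [repF, Matrix.of_apply, Matrix.zero_apply]
    rw [if_neg (by omega)]
  have hw : ∀ j : Idx 0, wt 0 j = 0 := fun j => by simp only [wt]; omega
  have h : blk (Rmat s d 0) = blk 1 := by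
    ext1 j j'
    rw [blk_Rmat_apply, Finset.sum_range_succ', hF, idx_zero_eq j j', hw, blk_one]
    simp [rCoeff_zero, cartan]
  ext ⟨i, j⟩ ⟨i', j'⟩
  exact congrFun (congrFun (congrFun (congrFun h j) j') i) i'

theorem Rmat_apply (s : ℂ) (a b : ℕ) (i i' : Idx a) (j j' : Idx b) :
    Rmat s a b (i, j) (i', j') = s ^ (wt a i * wt b j) * ∑ k ∈ Finset.range (a + 1),
      rCoeff s k * (repF s b ^ k) j j' * (repE s a ^ k) i i' := by
  rw [← blk_apply (Rmat s a b), blk_Rmat_apply, cartan, Matrix.diagonal_mul, Matrix.sum_apply]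
  rfl

theorem repF_pow_apply_eq_zero (d : ℕ) (k : ℕ) (i j : Idx d) (h : (i : ℕ) ≠ j + k) :
    (repF s d ^ k) i j = 0 := by
  induction k generalizing j with
  | zero => rw [pow_zero, Matrix.one_apply_ne]; rintro rfl; simp at h
  | succ k ih =>
    rw [pow_succ, Matrix.mul_apply]
    refine Finset.sum_eq_zero fun x _ => ?_
    by_cases hx : (x : ℕ) = j + 1
    · rw [ih x (by omega), zero_mul]
    · simp [repF, hx]

/-- E kills the highest weight vector of the first leg, which leaves only the term k = 0. In
`Rmat_apply_lowest` the same is done by F on the lowest vector of the second leg. -/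
theorem Rmat_apply_highest (s : ℂ) (a b : ℕ) (p : Idx a × Idx b) (j : Idx b) :
    Rmat s a b p (0, j) = if p = (0, j) then s ^ (wt a 0 * wt b j) else 0 := by
  obtain ⟨i, j'⟩ := p
  rw [Rmat_apply, Finset.sum_range_succ', Finset.sum_eq_zero]
  · simp only [rCoeff_zero, pow_zero, Matrix.one_apply, Prod.mk.injEq]
    split_ifs <;> simp_all
  · intro k _
    rw [repE_pow_apply_eq_zero a (k + 1) i 0 (by simp), mul_zero]

theorem Rmat_apply_lowest (s : ℂ) (a b : ℕ) (p : Idx a × Idx b) (i : Idx a) :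
    Rmat s a b p (i, Fin.last b) =
      if p = (i, Fin.last b) then s ^ (wt a i * wt b (Fin.last b)) else 0 := by
  obtain ⟨i', j'⟩ := p
  rw [Rmat_apply, Finset.sum_range_succ', Finset.sum_eq_zero]
  · simp only [rCoeff_zero, pow_zero, Matrix.one_apply, Prod.mk.injEq]
    split_ifs <;> simp_all
  · intro k _
    rw [repF_pow_apply_eq_zero b (k + 1) j' (Fin.last b) (by simp; omega), mul_zero, zero_mul]

theorem Rmat_inv_apply_lowest (C : ClebschGordan s) (hs : s ≠ 0) (a b : ℕ) (p : Idx a × Idx b) (i : Idx a) :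
    (Rmat s a b)⁻¹ p (i, Fin.last b) =
      if p = (i, Fin.last b) then (s ^ (wt a i * wt b (Fin.last b)))⁻¹ else 0 := by
  have e := congrFun (congrFun (Rmat_inv_mul (C := C) hs a b) p) (i, Fin.last b)
  rw [Matrix.mul_apply] at e
  simp only [Rmat_apply_lowest] at e
  simp only [mul_ite, mul_zero, Finset.sum_ite_eq', Finset.mem_univ, if_true] at e
  rw [← eq_mul_inv_iff_mul_eq₀ (zpow_ne_zero _ hs)] at e
  rw [e, Matrix.one_apply]
  split_ifs <;> simp

/-- By the braid axiom P R is a combination of the maps φψ, so it intertwines everything that acts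
through the irreducible components. For the generators this says R Δ = Δ^op R. -/
theorem Rmat_intertwines (C : ClebschGordan s) (a b : ℕ) {T : Matrix (Idx a × Idx b) (Idx a × Idx b) ℂ}
    {T' : Matrix (Idx b × Idx a) (Idx b × Idx a) ℂ} {t : ∀ c, Matrix (Idx c) (Idx c) ℂ}
    (hφ : ∀ c, T' * C.φ b a c = C.φ b a c * t c) (hψ : ∀ c, C.ψ a b c * T = t c * C.ψ a b c) :
    Rmat s a b * T = T'.submatrix Prod.swap Prod.swap * Rmat s a b := by
  have h : (Rmat s a b).submatrix Prod.swap id * T = T' * (Rmat s a b).submatrix Prod.swap id := by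
    rw [C.braid, Matrix.sum_mul, Matrix.mul_sum]
    refine Finset.sum_congr rfl fun c _ => ?_
    rw [Matrix.smul_mul, Matrix.mul_smul, Matrix.mul_assoc, hψ, ← Matrix.mul_assoc,
      ← Matrix.mul_assoc, hφ]
  have h2 := congrArg (fun M => M.submatrix (Prod.swap : Idx a × Idx b → _) id) h
  rw [Matrix.submatrix_mul _ _ _ id _ Function.bijective_id,
    Matrix.submatrix_mul _ _ _ Prod.swap _ Prod.swap_bijective] at h2
  simpa using h2

theorem Rmat_mul_tensK (C : ClebschGordan s) (hs : s ≠ 0) (a b : ℕ) :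
    Rmat s a b * tensK s a b = tensK s a b * Rmat s a b := by
  rw [Rmat_intertwines C a b (C.φ_K b a) (C.ψ_K a b)]
  congr 1
  rw [tensK_apply hs, tensK_apply hs, Matrix.submatrix_diagonal _ _ Prod.swap_injective]
  congr 1
  ext p
  simp [add_comm]

theorem inv_mul_eq_of_mul_eq {m : Type*} [Fintype m] [DecidableEq m] {R S X Y : Matrix m m ℂ}
    (h1 : R * S = 1) (h2 : S * R = 1) (h : R * X = Y * R) : S * Y = X * S := by
  calc S * Y = S * (Y * R) * S := by rw [Matrix.mul_assoc, Matrix.mul_assoc, h1, Matrix.mul_one]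
    _ = X * S := by rw [← h, ← Matrix.mul_assoc, h2, Matrix.one_mul]

theorem Rmat_weight (C : ClebschGordan s) (hs : s ≠ 0) (hq : ∀ k : ℕ, 0 < k → (s ^ 2) ^ k ≠ 1) {a b : ℕ}
    {p r : Idx a × Idx b} (h : Rmat s a b p r ≠ 0) :
    wt a p.1 + wt b p.2 = wt a r.1 + wt b r.2 := by
  have e := congrFun (congrFun (Rmat_mul_tensK C hs a b) p) r
  rw [tensK_apply hs, Matrix.diagonal_mul, Matrix.mul_diagonal, mul_comm] at e
  exact (sq_zpow_inj hs hq (mul_right_cancel₀ h e)).symm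

/-- The contraction of two of the four indices of `X` with the matrix `N`. -/
def twistTr {c : ℕ} (N : Matrix (Idx c) (Idx c) ℂ)
    (X : Matrix (Idx c × Idx c) (Idx c × Idx c) ℂ) : Matrix (Idx c) (Idx c) ℂ :=
  Matrix.of fun r w => ∑ t, ∑ u, X (r, t) (u, w) * N u t

section TwistTr

variable {c : ℕ} (N A : Matrix (Idx c) (Idx c) ℂ) (X Y : Matrix (Idx c × Idx c) (Idx c × Idx c) ℂ)

theorem twistTr_add : twistTr N (X + Y) = twistTr N X + twistTr N Y := by
  ext r w
  simp [twistTr, add_mul, Finset.sum_add_distrib]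

theorem twistTr_mul_leg₂ : twistTr N (X * leg₂ c A) = twistTr N X * A := by
  ext r w
  simp only [twistTr, Matrix.of_apply, Matrix.mul_apply, Fintype.sum_prod_type, leg₂, mul_ite,
    mul_zero, Finset.sum_mul]
  rw [Finset.sum_comm]
  conv_rhs => rw [Finset.sum_comm]; enter [2, t]; rw [Finset.sum_comm]
  rw [Finset.sum_comm]
  refine Finset.sum_congr rfl fun t _ => Finset.sum_congr rfl fun u _ => ?_
  rw [Finset.sum_comm]
  refine Finset.sum_congr rfl fun v _ => ?_
  simp
  ring

theorem twistTr_leg₁_mul : twistTr N (leg₁ c A * X) = A * twistTr N X := by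
  ext r w
  simp only [twistTr, Matrix.of_apply, Matrix.mul_apply, Fintype.sum_prod_type, leg₁, ite_mul,
    zero_mul, Finset.mul_sum]
  conv_rhs => rw [Finset.sum_comm]; enter [2, t]; rw [Finset.sum_comm]
  refine Finset.sum_congr rfl fun t _ => Finset.sum_congr rfl fun u _ => ?_
  rw [Finset.sum_mul]
  refine Finset.sum_congr rfl fun v _ => ?_
  simp
  ring

theorem twistTr_mul_leg₁ : twistTr N (X * leg₁ c A) = twistTr (A * N) X := by
  ext r w
  simp only [twistTr, Matrix.of_apply, Matrix.mul_apply, Fintype.sum_prod_type, leg₁, mul_ite,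
    mul_zero, Finset.sum_mul, Finset.mul_sum]
  refine Finset.sum_congr rfl fun t _ => ?_
  rw [Finset.sum_comm]
  refine Finset.sum_congr rfl fun u _ => Finset.sum_congr rfl fun v _ => ?_
  simp
  ring

theorem twistTr_leg₂_mul : twistTr N (leg₂ c A * X) = twistTr (N * A) X := by
  ext r w
  simp only [twistTr, Matrix.of_apply, Matrix.mul_apply, Fintype.sum_prod_type, leg₂, ite_mul,
    zero_mul, Finset.sum_mul, Finset.mul_sum]
  rw [Finset.sum_comm]
  conv_rhs => rw [Finset.sum_comm]
  refine Finset.sum_congr rfl fun u _ => ?_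
  conv_rhs => rw [Finset.sum_comm]
  refine Finset.sum_congr rfl fun t _ => ?_
  rw [Finset.sum_comm]
  refine Finset.sum_congr rfl fun v _ => ?_
  simp
  ring

end TwistTr

theorem repK_mul_repKinv (hs : s ≠ 0) (c : ℕ) : repK s c * repKinv s c = 1 := by
  rw [repK, repKinv, Matrix.diagonal_mul_diagonal, ← Matrix.diagonal_one]
  congr 1
  ext i
  rw [zpow_neg, mul_inv_cancel₀ (zpow_ne_zero _ (pow_ne_zero _ hs))]

theorem repKinv_mul_repK (hs : s ≠ 0) (c : ℕ) : repKinv s c * repK s c = 1 :=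
  mul_eq_one_comm.mp (repK_mul_repKinv hs c)

/-- The twist of an intertwiner is a scalar. -/
theorem twistTr_scalar (hs : s ≠ 0) (hq : ∀ k : ℕ, 0 < k → (s ^ 2) ^ k ≠ 1) {c : ℕ}
    {X : Matrix (Idx c × Idx c) (Idx c × Idx c) ℂ} (hK : X * tensK s c c = tensK s c c * X)
    (hF : X * (tensF s c c).submatrix Prod.swap Prod.swap = tensF s c c * X) :
    ∃ v : ℂ, ∀ r w, ∑ t, muW s c t * X (r, t) (t, w) = if r = w then v else 0 := by
  have hsw : (tensF s c c).submatrix Prod.swap Prod.swap =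
      leg₂ c (repF s c) + leg₁ c (repF s c) * leg₂ c (repKinv s c) := by
    have e : ∀ M N : Matrix (Idx c) (Idx c) ℂ, (leg₁ c M * leg₂ c N).submatrix Prod.swap Prod.swap =
        leg₁ c N * leg₂ c M := by
      intro M N
      ext p r
      rw [Matrix.submatrix_apply, leg₁_mul_leg₂_apply, leg₁_mul_leg₂_apply, mul_comm]
      rfl
    have e1 := e (repF s c) 1
    rw [leg₁_one, leg₂_one, mul_one, one_mul] at e1
    rw [tensF, Matrix.submatrix_add, Pi.add_apply, Pi.add_apply, e1, e]
  -- Schur's lemma by hand: commutation with K makes T diagonal because the weights are distinct,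
  -- and commutation with F makes its diagonal entries equal.
  set T := twistTr (repK s c) X with hT
  have hTK : T * repK s c = repK s c * T := by
    have h := congrArg (twistTr 1) hK
    rwa [tensK, ← Matrix.mul_assoc, twistTr_mul_leg₂, twistTr_mul_leg₁, mul_assoc, twistTr_leg₁_mul,
      twistTr_leg₂_mul, Matrix.one_mul, Matrix.mul_one] at h
  have hTF : T * repF s c = repF s c * T := by
    have h1 := congrArg (twistTr (repK s c)) hF
    rw [hsw, mul_add, twistTr_add, twistTr_mul_leg₂, ← mul_assoc, twistTr_mul_leg₂,
      twistTr_mul_leg₁, tensF, add_mul, twistTr_add, twistTr_leg₁_mul, mul_assoc, twistTr_leg₁_mul,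
      twistTr_leg₂_mul] at h1
    -- Besides T F = F T, the relation for F contains the terms in which F acts inside the trace.
    -- They agree by the relation for K, traced with F inserted.
    have h2 := congrArg (twistTr (repF s c)) hK
    rw [tensK, ← Matrix.mul_assoc, twistTr_mul_leg₂, twistTr_mul_leg₁, mul_assoc, twistTr_leg₁_mul,
      twistTr_leg₂_mul] at h2
    have h3 : twistTr (repF s c * repK s c) X * repKinv s c =
        repKinv s c * twistTr (repK s c * repF s c) X := by
      rw [← Matrix.one_mul (twistTr (repF s c * repK s c) X), ← repKinv_mul_repK hs, mul_assoc,
        mul_assoc, ← mul_assoc (repK s c), ← h2, mul_assoc _ (repK s c), repK_mul_repKinv hs,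
        mul_one]
    rw [h3] at h1
    exact add_right_cancel h1
  have hTa : ∀ r w, T r w = ∑ t, muW s c t * X (r, t) (t, w) := by
    intro r w
    simp only [hT, twistTr, Matrix.of_apply, repK]
    refine Finset.sum_congr rfl fun t _ => ?_
    rw [Finset.sum_eq_single t]
    · rw [Matrix.diagonal_apply_eq, mul_comm, muW]
    · intro u _ hu
      rw [Matrix.diagonal_apply_ne _ hu, mul_zero]
    · simp
  have hdiag : ∀ r w, r ≠ w → T r w = 0 := by
    intro r w hrw
    by_contra h0
    have e := congrFun (congrFun hTK r) w
    rw [repK, Matrix.mul_diagonal, Matrix.diagonal_mul, mul_comm] at e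
    have := sq_zpow_inj hs hq (mul_right_cancel₀ h0 e)
    simp only [wt] at this
    exact hrw (Fin.ext (by omega))
  have hconst : ∀ i, T i i = T 0 0 := by
    refine fin_const (f := fun i => T i i) fun i hi => ?_
    have e := congrFun (congrFun hTF ⟨i + 1, by omega⟩) ⟨i, by omega⟩
    rw [Matrix.mul_apply, Matrix.mul_apply, Finset.sum_eq_single ⟨i + 1, by omega⟩,
      Finset.sum_eq_single ⟨i, by omega⟩] at e
    · have hF : repF s c ⟨i + 1, by omega⟩ ⟨i, by omega⟩ = qInt s (i + 1) := by simp [repF]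
      rw [hF, mul_comm] at e
      exact mul_left_cancel₀ (qInt_ne hs hq (by omega)) e
    · intro u _ hu
      rw [hdiag u _ hu, mul_zero]
    · simp
    · intro u _ hu
      rw [hdiag _ _ hu.symm, zero_mul]
    · simp
  refine ⟨T 0 0, fun r w => ?_⟩
  rw [← hTa]
  split_ifs with h
  · rw [h, hconst]
  · exact hdiag r w h

theorem wt_zero (c : ℕ) : wt c 0 = c := by simp [wt]

theorem wt_last (c : ℕ) : wt c (Fin.last c) = -c := by simp [wt]; ring

/-- Since the twist is a scalar, it may be read off on the lowest vector, where R⁻¹ is diagonal: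
q^{-c} q^{-c²/2} = v_c. -/
theorem twist_Rmat_inv (C : ClebschGordan s) (hs : s ≠ 0) (hq : ∀ k : ℕ, 0 < k → (s ^ 2) ^ k ≠ 1) (c : ℕ)
    (r w : Idx c) :
    ∑ t, muW s c t * (Rmat s c c)⁻¹ (r, t) (t, w) = if r = w then ribbon s c else 0 := by
  have h1 := Rmat_mul_inv (C := C) hs c c
  have h2 := Rmat_inv_mul (C := C) hs c c
  obtain ⟨v, hv⟩ := twistTr_scalar hs hq (X := (Rmat s c c)⁻¹)
    (inv_mul_eq_of_mul_eq h1 h2 (Rmat_mul_tensK C hs c c))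
    (inv_mul_eq_of_mul_eq h1 h2 (Rmat_intertwines C c c (C.φ_F c c) (C.ψ_F c c)))
  have h := hv (Fin.last c) (Fin.last c)
  rw [Finset.sum_eq_single (Fin.last c), if_pos rfl, Rmat_inv_apply_lowest C hs, if_pos rfl, wt_last,
    muW, wt_last] at h
  · have : ribbon s c = v := by
      rw [← h, ribbon, ← zpow_natCast, ← zpow_natCast s 2, ← zpow_neg, ← zpow_neg, ← zpow_mul,
        ← zpow_add₀ hs]
      congr 1
      push_cast
      ring
    rw [this, hv]
  · intro t _ ht
    rw [Rmat_inv_apply_lowest C hs, if_neg, mul_zero]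
    simp [ht]
  · simp

/-- With its legs flipped, R satisfies the hypotheses of `twistTr_scalar`. On the highest vector the
scalar is q^c q^{c²/2} = v_c⁻¹. -/
theorem twist_Rmat (C : ClebschGordan s) (hs : s ≠ 0) (hq : ∀ k : ℕ, 0 < k → (s ^ 2) ^ k ≠ 1) (c : ℕ)
    (r w : Idx c) :
    ∑ t, muW s c t * Rmat s c c (t, r) (w, t) = if r = w then (ribbon s c)⁻¹ else 0 := by
  have hK := congrArg (fun M => Matrix.submatrix M Prod.swap Prod.swap) (Rmat_mul_tensK C hs c c)
  have hF := congrArg (fun M => Matrix.submatrix M Prod.swap Prod.swap)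
    (Rmat_intertwines C c c (C.φ_F c c) (C.ψ_F c c))
  simp only [Matrix.submatrix_mul _ _ _ Prod.swap _ Prod.swap_bijective] at hK hF
  have hKs : (tensK s c c).submatrix Prod.swap Prod.swap = tensK s c c := by
    rw [tensK_apply hs, Matrix.submatrix_diagonal _ _ Prod.swap_injective]
    congr 1
    ext p
    simp [add_comm]
  rw [hKs] at hK
  rw [Matrix.submatrix_submatrix, Prod.swap_swap_eq, Matrix.submatrix_id_id] at hF
  obtain ⟨v, hv⟩ := twistTr_scalar hs hq hK hF
  simp only [Matrix.submatrix_apply, Prod.swap_prod_mk] at hv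
  have h := hv 0 0
  rw [Finset.sum_eq_single 0, if_pos rfl, Rmat_apply_highest, if_pos rfl, wt_zero,
    muW, wt_zero] at h
  · have : (ribbon s c)⁻¹ = v := by
      rw [← h, ribbon, inv_inv, ← zpow_natCast, ← zpow_natCast s 2, ← zpow_mul,
        ← zpow_add₀ hs]
      congr 1
      push_cast
      ring
    rw [this, hv]
  · intro t _ ht
    rw [Rmat_apply_highest, if_neg, mul_zero]
    simp [ht]
  · simp

/-- The relation between `R` and `R⁻¹` for the opposite product in the second leg. -/
theorem sum_Rmat_mul_inv (C : ClebschGordan s) (hs : s ≠ 0) (hq : ∀ k : ℕ, 0 < k → (s ^ 2) ^ k ≠ 1) (d n : ℕ)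
    (b b' : Idx n) (t t' : Idx d) :
    ∑ a, ∑ x, (muW s n a)⁻¹ * (Rmat s d n (t', a) (x, b') * (Rmat s d n)⁻¹ (x, b) (t, a)) =
      if b = b' ∧ t' = t then (muW s n b')⁻¹ else 0 := by
  -- In the representation R⁻¹ of `Γ` the role of S(g) is played by R.
  have h := (blk_Rmat_inv_fuses C hs hq d).sum_anti_mul (S := fun n => blk (Rmat s d n))
    (by simp only [Rmat_zero_right, inv_one, blk_one]) (fun n => blk_Rmat_mul_inv C hs d n) hs hq n b b'
  have h2 := congrFun (congrFun h t') t
  rw [Matrix.sum_apply] at h2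
  simp only [Matrix.smul_apply, Matrix.mul_apply, blk_apply, smul_eq_mul, Finset.mul_sum] at h2
  rw [h2]
  by_cases hb : b = b' <;> simp [hb, Matrix.algebraMap_matrix_apply]

/-- The vertex of an Out state at which the trace is closed. -/
def outTw (C : ClebschGordan s) (b a c : ℕ) (x : Idx a) (r : Idx c) (p : Idx b) : ℂ :=
  (ribbon s c)⁻¹ * ∑ t, ∑ w, ∑ y,
    (Rmat s c a)⁻¹ (r, y) (t, x) * muMat s c t w * C.ψ b a c w (p, y)

/-- The vertex of an In state at which the trace is closed. -/
def inTw (C : ClebschGordan s) (b a c : ℕ) (x : Idx a) (p : Idx c) (r : Idx b) : ℂ :=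
  ribbon s c * ∑ w, ∑ t, ∑ y,
    muMat s c w t * Rmat s c a (t, x) (p, y) * C.φ b a c (r, y) w

theorem outTw_eq (C : ClebschGordan s) (b a c : ℕ) (x : Idx a) (r : Idx c) (p : Idx b) : outTw C b a c x r p =
    (ribbon s c)⁻¹ * ∑ t, ∑ y, muW s c t * (Rmat s c a)⁻¹ (r, y) (t, x) * C.ψ b a c t (p, y) := by
  rw [outTw]
  congr 1
  refine Finset.sum_congr rfl fun t _ => ?_
  rw [Finset.sum_eq_single t]
  · refine Finset.sum_congr rfl fun y _ => ?_
    rw [muMat, repK, Matrix.diagonal_apply_eq, muW]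
    ring
  · intro w _ hw
    refine Finset.sum_eq_zero fun y _ => ?_
    rw [muMat, repK, Matrix.diagonal_apply_ne _ hw.symm, mul_zero, zero_mul]
  · simp

theorem inTw_eq (C : ClebschGordan s) (b a c : ℕ) (x : Idx a) (p : Idx c) (r : Idx b) : inTw C b a c x p r =
    ribbon s c * ∑ t, ∑ y, muW s c t * Rmat s c a (t, x) (p, y) * C.φ b a c (r, y) t := by
  rw [inTw]
  congr 1
  refine Finset.sum_congr rfl fun t _ => ?_
  rw [Finset.sum_eq_single t]
  · refine Finset.sum_congr rfl fun y _ => ?_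
    rw [muMat, repK, Matrix.diagonal_apply_eq, muW]
  · intro w _ hw
    refine Finset.sum_eq_zero fun y _ => ?_
    rw [muMat, repK, Matrix.diagonal_apply_ne _ hw.symm, zero_mul, zero_mul]
  · simp

theorem ribbon_ne (hs : s ≠ 0) (c : ℕ) : ribbon s c ≠ 0 := inv_ne_zero (pow_ne_zero _ hs)

/-- ψ fuses R⁻¹_{cb}R⁻¹_{ca} to R⁻¹_{cc}ψ, and the trace against μ turns R⁻¹_{cc} into v_c, which
cancels the prefactor of the special vertex. This is the mechanism behind cyclicity and behind the
gauge behaviour of the special vertex. -/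
theorem sum_Rmat_inv_outTw (C : ClebschGordan s) (hs : s ≠ 0) (hq : ∀ k : ℕ, 0 < k → (s ^ 2) ^ k ≠ 1) (b a c : ℕ)
    (x : Idx a) (r : Idx c) (p' : Idx b) :
    ∑ r', ∑ p, (Rmat s c b)⁻¹ (r, p) (r', p') * outTw C b a c x r' p = C.ψ b a c r (p', x) := by
  have h : ∀ t, ∑ p, ∑ y, ∑ r', C.ψ b a c t (p, y) *
      ((Rmat s c b)⁻¹ (r, p) (r', p') * (Rmat s c a)⁻¹ (r', y) (t, x)) =
      ∑ w, (Rmat s c c)⁻¹ (r, t) (t, w) * C.ψ b a c w (p', x) := by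
    intro t
    have e0 := congrFun (congrFun ((blk_Rmat_inv_fuses C hs hq c).ψ_mul b a c) t) (p', x)
    rw [Matrix.mul_apply, Matrix.mul_apply] at e0
    simp only [leg₁_mul_leg₂_apply] at e0
    have e := congrFun (congrFun e0 r) t
    simp only [Fintype.sum_prod_type, const, Matrix.map_apply,
      ← Algebra.smul_def, ← Algebra.commutes (C.ψ b a c _ _), Matrix.sum_apply, Matrix.smul_apply,
      Matrix.mul_apply, blk_apply, smul_eq_mul, Finset.mul_sum] at e
    rw [e]
    exact Finset.sum_congr rfl fun w _ => mul_comm _ _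
  have h2 : ∑ t, muW s c t * ∑ w, (Rmat s c c)⁻¹ (r, t) (t, w) * C.ψ b a c w (p', x) =
      ribbon s c * C.ψ b a c r (p', x) := by
    simp only [Finset.mul_sum, ← mul_assoc]
    rw [Finset.sum_comm]
    simp only [← Finset.sum_mul, twist_Rmat_inv C hs hq]
    simp
  rw [← inv_mul_cancel_left₀ (ribbon_ne hs c) (C.ψ b a c r (p', x)), ← h2]
  simp only [← h, outTw_eq, Finset.mul_sum]
  rw [Finset.sum_comm]
  conv_rhs => rw [Finset.sum_comm]
  refine Finset.sum_congr rfl fun p _ => ?_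
  rw [Finset.sum_comm]
  refine Finset.sum_congr rfl fun t _ => ?_
  rw [Finset.sum_comm]
  refine Finset.sum_congr rfl fun y _ => Finset.sum_congr rfl fun r' _ => ?_
  ring

/-- Mirror image for φ: here R has the part of S(g), so the factors fuse in the reversed order, and
the twist v_c⁻¹ of R_{cc} cancels the prefactor v_c. -/
theorem sum_inTw_Rmat (C : ClebschGordan s) (hs : s ≠ 0) (hq : ∀ k : ℕ, 0 < k → (s ^ 2) ^ k ≠ 1) (b a c : ℕ)
    (x : Idx a) (i : Idx c) (k : Idx b) :
    ∑ p, ∑ r, Rmat s c b (p, k) (i, r) * inTw C b a c x p r = C.φ b a c (k, x) i := by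
  have h : ∀ t, ∑ r, ∑ y, ∑ p, C.φ b a c (r, y) t *
      (Rmat s c a (t, x) (p, y) * Rmat s c b (p, k) (i, r)) =
      ∑ w, C.φ b a c (k, x) w * Rmat s c c (t, w) (i, t) := by
    intro t
    have e0 := congrFun (congrFun ((blk_Rmat_inv_fuses C hs hq c).anti_mul_φ
      (fun n => blk_Rmat_mul_inv C hs c n) (fun n => blk_Rmat_inv_mul C hs c n) b a c) (k, x)) t
    rw [Matrix.mul_apply, Matrix.mul_apply] at e0
    simp only [leg₂_mul_leg₁_apply] at e0
    have e := congrFun (congrFun e0 t) i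
    simp only [Fintype.sum_prod_type, const, Matrix.map_apply,
      ← Algebra.smul_def, ← Algebra.commutes (C.φ b a c _ _), Matrix.sum_apply, Matrix.smul_apply,
      Matrix.mul_apply, blk_apply, smul_eq_mul, Finset.mul_sum] at e
    exact e
  have h2 : ∑ t, muW s c t * ∑ w, C.φ b a c (k, x) w * Rmat s c c (t, w) (i, t) =
      (ribbon s c)⁻¹ * C.φ b a c (k, x) i := by
    simp only [Finset.mul_sum, mul_left_comm (muW s c _)]
    rw [Finset.sum_comm]
    simp only [← Finset.mul_sum, twist_Rmat C hs hq]
    simp [mul_comm]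
  rw [← mul_inv_cancel_left₀ (ribbon_ne hs c) (C.φ b a c (k, x) i), ← h2]
  simp only [← h, inTw_eq, Finset.mul_sum]
  rw [Finset.sum_comm]
  conv_rhs => rw [Finset.sum_comm]
  refine Finset.sum_congr rfl fun p _ => ?_
  rw [Finset.sum_comm]
  refine Finset.sum_congr rfl fun t _ => ?_
  rw [Finset.sum_comm]
  refine Finset.sum_congr rfl fun y _ => Finset.sum_congr rfl fun r' _ => ?_
  ring

end RMatrix

/-! ### Traces of cyclic words and their rotation -/

section Words

theorem sum_pi_congr_update {ι : Type*} [Fintype ι] [DecidableEq ι] {J : ι → Type*}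
    [∀ i, Fintype (J i)] {M : Type*} [AddCommMonoid M] (i : ι) [Nonempty (J i)]
    {f g : (∀ i, J i) → M}
    (h : ∀ x, ∑ t, f (Function.update x i t) = ∑ t, g (Function.update x i t)) :
    ∑ x, f x = ∑ x, g x := by
  obtain ⟨t₀⟩ := ‹Nonempty (J i)›
  have e : ∀ f : (∀ i, J i) → M, ∑ x, f x =
      ∑ y : ∀ j : {j // j ≠ i}, J j, ∑ t,
        f (Function.update ((Equiv.piSplitAt i J).symm (t₀, y)) i t) := by
    intro f
    rw [← Equiv.sum_comp (Equiv.piSplitAt i J).symm, Fintype.sum_prod_type_right]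
    refine Finset.sum_congr rfl fun y _ => Finset.sum_congr rfl fun t _ => congrArg f ?_
    ext j
    by_cases hj : j = i
    · subst hj; simp
    · simp [hj]
  rw [e f, e g]
  exact Finset.sum_congr rfl fun y _ => h _

/-- Lets an exchange at the vertex i act on the two indices p_i and r_{i-1} alone, with all others
frozen. -/
theorem sum_sum_pi_congr_update {ι : Type*} [Fintype ι] [DecidableEq ι] {J J' : ι → Type*}
    [∀ i, Fintype (J i)] [∀ i, Fintype (J' i)] {M : Type*} [AddCommMonoid M] (i i' : ι)
    [Nonempty (J i)] [Nonempty (J' i')] {f g : (∀ i, J i) → (∀ i, J' i) → M}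
    (h : ∀ x y, ∑ t, ∑ u, f (Function.update x i t) (Function.update y i' u) =
      ∑ t, ∑ u, g (Function.update x i t) (Function.update y i' u)) :
    ∑ x, ∑ y, f x y = ∑ x, ∑ y, g x y := by
  refine sum_pi_congr_update i fun x => ?_
  rw [Finset.sum_comm, Finset.sum_comm (f := fun t y => g (Function.update x i t) y)]
  refine sum_pi_congr_update i' fun y => ?_
  rw [Finset.sum_comm, h x y, Finset.sum_comm]

theorem sum_pi_shift {n : ℕ} [NeZero n] {J : Fin n → Type*} [∀ i, Fintype (J i)] {M : Type*}
    [AddCommMonoid M] (f : (∀ i, J (i - 1)) → M) :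
    ∑ x, f x = ∑ x : ∀ i, J i, f fun i => x (i - 1) :=
  ((Equiv.piCongrLeft' J (Equiv.subRight (1 : Fin n)).symm).sum_comp f).symm

variable {n : ℕ} [NeZero n] {J : Fin n → Type*} [∀ i, Fintype (J i)]
  {A : Type*} [Semiring A] [Algebra ℂ A]

/-- The trace of a cyclic chain of matrices `N i` over `A` and `w i` over `ℂ`, where the matrix
elements over `A` are multiplied in the order given by the list `l`. -/
def traceWord (w : ∀ i, J (i - 1) → J i → ℂ) (N : ∀ i, J i → J i → A) (l : List (Fin n)) : A :=
  ∑ p : ∀ i, J i, ∑ r : ∀ i, J i,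
    (∏ i, w i (r (i - 1)) (p i)) • (l.map fun i => N i (p i) (r i)).prod

theorem traceWord_congr {w : ∀ i, J (i - 1) → J i → ℂ} {N : ∀ i, J i → J i → A}
    {l l' : List (Fin n)} (h : ∀ p r : ∀ i, J i, (l.map fun i => N i (p i) (r i)).prod =
      (l'.map fun i => N i (p i) (r i)).prod) : traceWord w N l = traceWord w N l' := by
  simp only [traceWord, h]

theorem prod_update_apply {n : ℕ} [NeZero n] {J : Fin n → Type*} (w : ∀ i, J (i - 1) → J i → ℂ) (i : Fin n) (M : J (i - 1) → J i → ℂ)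
    (p r : ∀ i, J i) (t : J i) (u : J (i - 1)) :
    ∏ j, Function.update w i M j (Function.update r (i - 1) u (j - 1)) (Function.update p i t j) =
      M u t * ∏ j ∈ Finset.univ.erase i, w j (r (j - 1)) (p j) := by
  rw [← Finset.mul_prod_erase _ _ (Finset.mem_univ i)]
  congr 1
  · rw [Function.update_self, Function.update_self, Function.update_self]
  · refine Finset.prod_congr rfl fun j hj => ?_
    have hji := Finset.ne_of_mem_erase hj
    rw [Function.update_of_ne hji, Function.update_of_ne hji, Function.update_of_ne]
    exact fun h => hji (sub_left_injective h)

/-- Exchange of two neighbouring factors of a word. -/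
theorem traceWord_exchange [∀ i, Nonempty (J i)] (w : ∀ i, J (i - 1) → J i → ℂ)
    (N : ∀ i, J i → J i → A) (i : Fin n) (hi : i ≠ i - 1) (M T : J (i - 1) → J i → ℂ)
    (h : ∀ j k, ∑ p, ∑ r, M r p • (N i p k * N (i - 1) j r) =
      ∑ p, ∑ r, T r p • (N (i - 1) j r * N i p k)) (l l' : List (Fin n))
    (hl : i ∉ l ∧ i - 1 ∉ l) (hl' : i ∉ l' ∧ i - 1 ∉ l') :
    traceWord (Function.update w i M) N (l ++ i :: (i - 1) :: l') =
      traceWord (Function.update w i T) N (l ++ (i - 1) :: i :: l') := by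
  refine sum_sum_pi_congr_update i (i - 1) fun p r => ?_
  have hmap : ∀ (l : List (Fin n)) (_ : i ∉ l ∧ i - 1 ∉ l) (t u),
      (l.map fun j => N j (Function.update p i t j) (Function.update r (i - 1) u j)) =
      l.map fun j => N j (p j) (r j) := by
    intro l hl t u
    refine List.map_congr_left fun j hj => ?_
    rw [Function.update_of_ne fun h : j = i => hl.1 (h ▸ hj),
      Function.update_of_ne fun h : j = i - 1 => hl.2 (h ▸ hj)]
  simp only [prod_update_apply, List.map_append, List.map_cons, List.prod_append, List.prod_cons,
    hmap l hl, hmap l' hl', Function.update_self, Function.update_of_ne hi,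
    Function.update_of_ne hi.symm]
  set c := ∏ j ∈ Finset.univ.erase i, w j (r (j - 1)) (p j)
  have e : ∀ (m : ℂ) (P x y Q : A), (m * c) • (P * (x * (y * Q))) = c • (P * (m • (x * y)) * Q) := by
    intro m P x y Q
    rw [mul_comm, ← smul_smul, mul_smul_comm, smul_mul_assoc]
    simp only [mul_assoc]
  simp only [e, ← Finset.smul_sum, ← Finset.mul_sum, ← Finset.sum_mul, h]

/-- The words of the two numberings are 0, l, n-2, n-1 and n-1, 0, l, n-2 with the same middle part
l; in cyclic notation n-1 is 0 - 1. The four ends are named because they take part in the exchanges.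
-/
theorem finRange_eq_cyclic (m : ℕ) : ∃ l : List (Fin (m + 3)),
    List.finRange (m + 3) = 0 :: (l ++ [0 - 1 - 1, 0 - 1]) ∧
    (List.finRange (m + 3)).map (· - 1) = (0 - 1) :: 0 :: (l ++ [0 - 1 - 1]) ∧
    ∀ j ∈ l, j ≠ 0 ∧ j ≠ 0 - 1 ∧ j ≠ 0 - 1 - 1 := by
  have h1 : (0 : Fin (m + 3)) - 1 = Fin.last _ := by
    rw [sub_eq_iff_eq_add]; exact (Fin.last_add_one _).symm
  have h2 : (0 : Fin (m + 3)) - 1 - 1 = Fin.castSucc (Fin.succ (Fin.last m)) := by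
    rw [h1]
    apply Fin.ext
    rw [Fin.val_sub_one_of_ne_zero]
    · simp
    · simp [Fin.ext_iff]
  refine ⟨(List.finRange m).map fun j => j.castSucc.succ.castSucc, ?_, ?_, ?_⟩
  · rw [h2, h1, List.finRange_succ_last, List.finRange_succ, List.finRange_succ_last]
    simp [Function.comp_def]
  · rw [h2, h1, List.finRange_succ, List.map_cons, List.map_map]
    have : ((fun x => x - 1) ∘ Fin.succ : Fin (m + 2) → Fin (m + 3)) = Fin.castSucc := by
      ext j
      simp [Fin.val_sub_one_of_ne_zero]
    rw [this, List.finRange_succ, List.finRange_succ_last]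
    simp [Function.comp_def, h1]
  · intro j hj
    obtain ⟨i, -, rfl⟩ := List.mem_map.mp hj
    rw [h2, h1]
    simp only [ne_eq, Fin.ext_iff]
    simp
    omega

/-- Cyclicity of the trace, for matrices over `A` with exchange relations between neighbours. -/
theorem traceWord_cyclic [∀ i, Nonempty (J i)] (hn : 3 ≤ n) (T M : ∀ i, J (i - 1) → J i → ℂ)
    (N : ∀ i, J i → J i → A)
    (hex : ∀ i j k, ∑ p, ∑ r, M i r p • (N i p k * N (i - 1) j r) =
      ∑ p, ∑ r, T i r p • (N (i - 1) j r * N i p k))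
    (hcomm : ∀ i j, i ≠ j → i ≠ j - 1 → j ≠ i - 1 → ∀ p r p' r', Commute (N i p r) (N j p' r')) :
    traceWord (Function.update T 0 (M 0)) N (List.finRange n) =
      traceWord (Function.update T (0 - 1) (M (0 - 1))) N ((List.finRange n).map (· - 1)) := by
  obtain ⟨m, rfl⟩ : ∃ m, n = m + 3 := ⟨n - 3, by omega⟩
  obtain ⟨l, h1, h2, hl⟩ := finRange_eq_cyclic m
  have hnd : (List.finRange (m + 3)).Nodup := List.nodup_finRange _
  rw [h1] at hnd
  have hz : (0 : Fin (m + 3)) - 1 ≠ 0 := fun h => by simp [h] at hnd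
  have hy : (0 : Fin (m + 3)) - 1 ≠ 0 - 1 - 1 := fun h => hz.symm (sub_left_injective h)
  have hy0 : (0 : Fin (m + 3)) ≠ 0 - 1 - 1 := fun h => by
    rw [← h] at hnd
    simp at hnd
  -- The regular coefficient at the other position is displayed as an update, the form in which
  -- `traceWord_exchange` applies.
  have e0 : Function.update T 0 (M 0) =
      Function.update (Function.update T 0 (M 0)) (0 - 1) (T (0 - 1)) := by
    rw [Function.update_comm hz.symm, Function.update_eq_self]
  have e1 : Function.update T (0 - 1) (M (0 - 1)) =
      Function.update (Function.update T (0 - 1) (M (0 - 1))) 0 (T 0) := by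
    rw [Function.update_comm hz, Function.update_eq_self]
  rw [h2, h1, e0, e1]
  -- Both traces are brought to special coefficients at 0 and at 0 - 1: the first by exchanging its
  -- last two factors, the second by exchanging its first two.
  have s1 := traceWord_exchange (Function.update T 0 (M 0)) N (0 - 1) hy (M (0 - 1)) (T (0 - 1))
    (hex _) (0 :: l) []
    ⟨by simpa only [List.mem_cons, not_or] using ⟨hz, fun h => (hl _ h).2.1 rfl⟩, by
      simpa only [List.mem_cons, not_or] using ⟨hy0.symm, fun h => (hl _ h).2.2 rfl⟩⟩ (by simp)
  have s2 := traceWord_exchange (Function.update T (0 - 1) (M (0 - 1))) N 0 hz.symm (M 0) (T 0)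
    (hex _) [] (l ++ [0 - 1 - 1]) (by simp)
    ⟨by simpa only [List.mem_append, List.mem_singleton, not_or] using
        ⟨fun h => (hl _ h).1 rfl, hy0⟩,
      by simpa only [List.mem_append, List.mem_singleton, not_or] using
        ⟨fun h => (hl _ h).2.1 rfl, hy⟩⟩
  rw [Function.update_comm hz.symm] at s1
  rw [List.nil_append, List.nil_append] at s2
  simp only [List.cons_append] at s1
  rw [← s2, ← s1]
  refine traceWord_congr fun p r => ?_
  -- The link 0 - 1 still has to pass the middle part, which contains neither of its neighbours.
  have hc : Commute (l.map fun i => N i (p i) (r i)).prod (N (0 - 1) (p (0 - 1)) (r (0 - 1))) := by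
    refine Commute.list_prod_left _ _ fun x hx => ?_
    obtain ⟨j, hj, rfl⟩ := List.mem_map.mp hx
    exact hcomm j _ (hl j hj).2.1 (hl j hj).2.2
      (fun h => (hl j hj).1 (sub_left_injective h).symm) _ _ _ _
  simp only [List.map_cons, List.map_append, List.map_nil, List.prod_cons, List.prod_append,
    List.prod_nil, mul_one]
  rw [← mul_assoc (List.prod _), hc.eq]
  simp only [mul_assoc]

end Words

variable {V : Type*}

/-! ### Entrywise relations of link variables, and exchanges along a loop -/

section Entries

variable {A : Type*} [Semiring A] [Algebra ℂ A] {a b : ℕ}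

theorem leg₁_mul_const_mul_leg₂_apply (M : Matrix (Idx a) (Idx a) A) (N : Matrix (Idx b) (Idx b) A)
    (X : Matrix (Idx a × Idx b) (Idx a × Idx b) ℂ) (i j : Idx a) (k l : Idx b) :
    (leg₁ b M * const A X * leg₂ a N) (i, k) (j, l) =
      ∑ u, ∑ v, X (u, k) (j, v) • (M i u * N v l) := by
  have h : ∀ y, (leg₁ b M * const A X : Matrix (Idx a × Idx b) (Idx a × Idx b) A) (i, k) y =
      ∑ u, X (u, k) y • M i u := by
    intro y
    rw [Matrix.mul_apply, Fintype.sum_prod_type]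
    simp [leg₁, const, Algebra.smul_def, Algebra.commutes]
  rw [Matrix.mul_apply, Fintype.sum_prod_type]
  simp only [h, Finset.sum_mul, leg₂, Matrix.of_apply, mul_ite, mul_zero, smul_mul_assoc]
  rw [Finset.sum_eq_single j (by
    intro x _ hx
    simp [hx]) (by simp)]
  simp only [if_true]
  rw [Finset.sum_comm]

theorem leg₂_mul_const_mul_leg₁_apply (M : Matrix (Idx a) (Idx a) A) (N : Matrix (Idx b) (Idx b) A)
    (X : Matrix (Idx a × Idx b) (Idx a × Idx b) ℂ) (i j : Idx a) (k l : Idx b) :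
    (leg₂ a N * const A X * leg₁ b M) (i, k) (j, l) =
      ∑ v, ∑ u, X (i, v) (u, l) • (N k v * M u j) := by
  have h : ∀ y, (leg₂ a N * const A X : Matrix (Idx a × Idx b) (Idx a × Idx b) A) (i, k) y =
      ∑ v, X (i, v) y • N k v := by
    intro y
    rw [Matrix.mul_apply, Fintype.sum_prod_type]
    simp [leg₂, const, Algebra.smul_def, Algebra.commutes]
  rw [Matrix.mul_apply, Fintype.sum_prod_type]
  simp only [h, Finset.sum_mul, leg₁, Matrix.of_apply, mul_ite, mul_zero, smul_mul_assoc]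
  rw [Finset.sum_comm, Finset.sum_eq_single l (by
    intro x _ hx
    simp [hx]) (by simp)]
  simp only [if_true]
  rw [Finset.sum_comm]

end Entries

section Relations

variable {s : ℂ} {C : ClebschGordan s} {G : SimpleGraph V} {cil : Ciliation G}

theorem field_rel ⦃x y : FreeAlgebra ℂ (FieldVar G)⦄ (h : FieldRel C cil x y) :
    RingQuot.mkAlgHom ℂ (FieldRel C cil) x = RingQuot.mkAlgHom ℂ (FieldRel C cil) y :=
  RingQuot.mkAlgHom_rel ℂ h

theorem uMat_endEnd {l l' : G.Dart} (h : l.snd = l'.snd) (hlt : cil.lt l.snd l.fst l'.fst)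
    (a b : ℕ) : const (Lam C cil) (Rmat s a b) * leg₁ b (uMat C cil l a) * leg₂ a (uMat C cil l' b) =
      leg₂ a (uMat C cil l' b) * leg₁ b (uMat C cil l a) := by
  have := rel_mat field_rel (FieldRel.endEnd (C := C) (cil := cil) l l' h hlt a b)
  simp only [map_matMul, const_map, leg₁_map _ _ _ (map_zero _), leg₂_map _ _ _ (map_zero _)] at this
  exact this

theorem uMat_startEnd {l l' : G.Dart} (h : l.fst = l'.snd) (hlt : cil.lt l.fst l.snd l'.fst)
    (a b : ℕ) : leg₁ b (uMat C cil l a) * const (Lam C cil) (Rmat s a b)⁻¹ *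
      leg₂ a (uMat C cil l' b) = leg₂ a (uMat C cil l' b) * leg₁ b (uMat C cil l a) := by
  have := rel_mat field_rel (FieldRel.startEnd (C := C) (cil := cil) l l' h hlt a b)
  simp only [map_matMul, const_map, leg₁_map _ _ _ (map_zero _), leg₂_map _ _ _ (map_zero _)] at this
  exact this

theorem uMat_startStart {l l' : G.Dart} (h : l.fst = l'.fst) (hlt : cil.lt l.fst l.snd l'.snd)
    (a b : ℕ) : leg₁ b (uMat C cil l a) * leg₂ a (uMat C cil l' b) * const (Lam C cil) (Rmat s a b) =
      leg₂ a (uMat C cil l' b) * leg₁ b (uMat C cil l a) := by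
  have := rel_mat field_rel (FieldRel.startStart (C := C) (cil := cil) l l' h hlt a b)
  simp only [map_matMul, const_map, leg₁_map _ _ _ (map_zero _), leg₂_map _ _ _ (map_zero _)] at this
  exact this

theorem uMat_disjoint {l l' : G.Dart} (h₁ : l.fst ≠ l'.fst) (h₂ : l.fst ≠ l'.snd)
    (h₃ : l.snd ≠ l'.fst) (h₄ : l.snd ≠ l'.snd) (a b : ℕ) (i j : Idx a) (k m : Idx b) :
    Commute (uMat C cil l a i j) (uMat C cil l' b k m) := by
  have := rel_mat field_rel (FieldRel.disjoint (C := C) (cil := cil) l l' h₁ h₂ h₃ h₄ a b)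
  simp only [map_matMul, leg₁_map _ _ _ (map_zero _), leg₂_map _ _ _ (map_zero _)] at this
  have := congrFun (congrFun this (i, k)) (j, m)
  rwa [leg₁_mul_leg₂_apply, leg₂_mul_leg₁_apply] at this

theorem uMat_mul_symm (l : G.Dart) (n : ℕ) : uMat C cil l n * uMat C cil l.symm n = 1 := by
  have := rel_mat field_rel (FieldRel.inverse (C := C) (cil := cil) l n)
  rwa [map_matMul, Matrix.map_one _ (map_zero _) (map_one _)] at this

theorem uMat_symm_mul (l : G.Dart) (n : ℕ) : uMat C cil l.symm n * uMat C cil l n = 1 := by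
  have := uMat_mul_symm (C := C) (cil := cil) l.symm n
  rwa [SimpleGraph.Dart.symm_symm] at this

theorem uMat_fusion (l : G.Dart) (a b : ℕ) : leg₁ b (uMat C cil l a) * leg₂ a (uMat C cil l b) =
    ∑ c ∈ channels a b, const (Lam C cil) (C.φ a b c) * uMat C cil l c *
        const (Lam C cil) ((C.ψ b a c).submatrix id Prod.swap) := by
  have := rel_mat field_rel (FieldRel.fusion (C := C) (cil := cil) l a b)
  simp only [map_matMul, map_matSum, const_map, leg₁_map _ _ _ (map_zero _),
    leg₂_map _ _ _ (map_zero _)] at this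
  exact this

theorem uMat_zero (l : G.Dart) : uMat C cil l 0 = 1 := by
  have := rel_mat (M := freeU l 0) (N := 1) field_rel (fun i j => by
    rw [idx_zero_eq i j, Matrix.one_apply_eq]; exact FieldRel.triv (C := C) (cil := cil) l j j)
  rwa [Matrix.map_one _ (map_zero _) (map_one _)] at this

/-- The exchange relation for a link ending and a link departing at the same vertex. -/
theorem uMat_endStart {l l' : G.Dart} (h : l.snd = l'.fst)
    (hlt : cil.lt l.snd l.fst l'.snd) (a b : ℕ) :
    leg₂ a (uMat C cil l' b) * const (Lam C cil) (Rmat s a b) * leg₁ b (uMat C cil l a) =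
      leg₁ b (uMat C cil l a) * leg₂ a (uMat C cil l' b) := by
  have e := uMat_startStart (C := C) (cil := cil) (l := l.symm) (l' := l') h hlt a b
  have h1 : leg₁ b (uMat C cil l a) * leg₁ b (uMat C cil l.symm a) = 1 := by
    rw [← leg₁_mul, uMat_mul_symm, leg₁_one]
  have h2 : leg₁ b (uMat C cil l.symm a) * leg₁ b (uMat C cil l a) = 1 := by
    rw [← leg₁_mul, uMat_symm_mul, leg₁_one]
  calc _ = leg₁ b (uMat C cil l a) * (leg₁ b (uMat C cil l.symm a) * leg₂ a (uMat C cil l' b) *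
        const (Lam C cil) (Rmat s a b)) * leg₁ b (uMat C cil l a) := by
        rw [← mul_assoc, ← mul_assoc, h1, one_mul]
    _ = _ := by rw [e, mul_assoc, mul_assoc, h2, mul_one]

end Relations

namespace Loop

variable {G : SimpleGraph V} {cil : Ciliation G} {n : ℕ} [NeZero n]

/-- The cilium order is strict, so at each vertex the incoming and the outgoing edge differ; for n ≤
2 the predecessor and the successor would coincide. -/
theorem three_le (L : Loop cil n) : 3 ≤ n := by
  have h0 := NeZero.ne n
  have h : (0 : Fin n) - 1 ≠ 0 + 1 := fun h => cil.irrefl _ _ (by simpa only [h] using L.cil_lt 0)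
  by_contra hn
  obtain rfl | rfl : n = 1 ∨ n = 2 := by omega
  · exact h (Subsingleton.elim _ _)
  · have e : ∀ x y : Fin 2, x - y = x + y := by decide
    exact h (e _ _)

theorem back_symm (L : Loop cil n) (i : Fin n) : (L.back i).symm = L.fwd i := rfl

theorem rotate_back (L : Loop cil n) (i : Fin n) : L.rotate.back i = L.back (i - 1) := by
  apply SimpleGraph.Dart.ext
  simp only [back, rotate]
  rw [sub_add_eq_add_sub]

theorem rotate_fwd (L : Loop cil n) (i : Fin n) : L.rotate.fwd i = L.fwd (i - 1) := by
  rw [← back_symm, rotate_back, back_symm]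

end Loop

section Exchange

variable {s : ℂ} {C : ClebschGordan s} {G : SimpleGraph V} {cil : Ciliation G} {n : ℕ} [NeZero n]
  (L : Loop cil n)

theorem back_commute {i j : Fin n} (h1 : i ≠ j) (h2 : i ≠ j - 1) (h3 : j ≠ i - 1) (a b : ℕ)
    (p r : Idx a) (p' r' : Idx b) :
    Commute (uMat C cil (L.back i) a p r) (uMat C cil (L.back j) b p' r') :=
  uMat_disjoint (fun h => h1 (add_left_injective _ (L.inj h)))
    (fun h => h2 (eq_sub_of_add_eq (L.inj h))) (fun h => h3 (eq_sub_of_add_eq (L.inj h).symm))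
    (fun h => h1 (L.inj h)) _ _ _ _ _ _

theorem fwd_commute {i j : Fin n} (h1 : i ≠ j) (h2 : i ≠ j - 1) (h3 : j ≠ i - 1) (a b : ℕ)
    (p r : Idx a) (p' r' : Idx b) :
    Commute (uMat C cil (L.fwd i) a p r) (uMat C cil (L.fwd j) b p' r') :=
  uMat_disjoint (fun h => h1 (L.inj h)) (fun h => h3 (eq_sub_of_add_eq (L.inj h).symm))
    (fun h => h2 (eq_sub_of_add_eq (L.inj h))) (fun h => h1 (add_left_injective _ (L.inj h)))
    _ _ _ _ _ _

theorem back_fwd_commute {i j : Fin n} (h1 : i ≠ j) (h2 : i ≠ j - 1) (h3 : j ≠ i - 1) (a b : ℕ)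
    (p r : Idx a) (p' r' : Idx b) :
    Commute (uMat C cil (L.back i) a p r) (uMat C cil (L.fwd j) b p' r') :=
  uMat_disjoint (fun h => h2 (eq_sub_of_add_eq (L.inj h)))
    (fun h => h1 (add_left_injective _ (L.inj h))) (fun h => h1 (L.inj h))
    (fun h => h3 (eq_sub_of_add_eq (L.inj h).symm)) _ _ _ _ _ _

/-- Both links meet at x_i: `L.back (i - 1)` departs there along the incoming edge of the loop and
`L.back i` ends there along the outgoing edge. The condition on the cilia selects the relation with
R⁻¹. The three exchanges below arise at the same vertex from other orientations. -/
theorem back_exchange (i : Fin n) (a b : ℕ) (j k : Idx a) (p t : Idx b) :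
    ∑ u, ∑ v, (Rmat s a b)⁻¹ (u, p) (k, v) •
      (uMat C cil (L.back (i - 1)) a j u * uMat C cil (L.back i) b v t) =
    uMat C cil (L.back i) b p t * uMat C cil (L.back (i - 1)) a j k := by
  have h : (L.back (i - 1)).fst = (L.back i).snd := congrArg L.x (sub_add_cancel i 1)
  have hlt : cil.lt (L.back (i - 1)).fst (L.back (i - 1)).snd (L.back i).fst := by
    rw [h]; exact L.cil_lt i
  have e := congrFun (congrFun (uMat_startEnd (C := C) h hlt a b) (j, p)) (k, t)
  rwa [leg₂_mul_leg₁_apply, leg₁_mul_const_mul_leg₂_apply] at e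

theorem fwd_exchange (i : Fin n) (a b : ℕ) (j k : Idx a) (p t : Idx b) :
    ∑ v, ∑ u, Rmat s a b (j, v) (u, t) •
      (uMat C cil (L.fwd i) b p v * uMat C cil (L.fwd (i - 1)) a u k) =
    uMat C cil (L.fwd (i - 1)) a j k * uMat C cil (L.fwd i) b p t := by
  have h : (L.fwd (i - 1)).snd = (L.fwd i).fst := congrArg L.x (sub_add_cancel i 1)
  have hlt : cil.lt (L.fwd (i - 1)).snd (L.fwd (i - 1)).fst (L.fwd i).snd := by
    rw [h]; exact L.cil_lt i
  have e := congrFun (congrFun (uMat_endStart (C := C) h hlt a b) (j, p)) (k, t)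
  rwa [leg₁_mul_leg₂_apply, leg₂_mul_const_mul_leg₁_apply] at e

theorem fwd_back_exchange (i : Fin n) (a b : ℕ) (j k : Idx a) (p t : Idx b) :
    ∑ u, ∑ v, Rmat s a b (j, p) (u, v) •
      (uMat C cil (L.fwd (i - 1)) a u k * uMat C cil (L.back i) b v t) =
    uMat C cil (L.back i) b p t * uMat C cil (L.fwd (i - 1)) a j k := by
  have h : (L.fwd (i - 1)).snd = (L.back i).snd := congrArg L.x (sub_add_cancel i 1)
  have hlt : cil.lt (L.fwd (i - 1)).snd (L.fwd (i - 1)).fst (L.back i).fst := by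
    rw [h]; exact L.cil_lt i
  have e := congrFun (congrFun (uMat_endEnd (C := C) h hlt a b) (j, p)) (k, t)
  rw [leg₂_mul_leg₁_apply, mul_assoc, Matrix.mul_apply, Fintype.sum_prod_type] at e
  simpa only [leg₁_mul_leg₂_apply, const, Matrix.map_apply, ← Algebra.smul_def] using e

theorem back_fwd_exchange (hs : s ≠ 0) (i : Fin n) (a b : ℕ) (j k : Idx a) (p t : Idx b) :
    uMat C cil (L.back (i - 1)) a j k * uMat C cil (L.fwd i) b p t =
    ∑ u, ∑ v, (Rmat s a b)⁻¹ (u, v) (k, t) •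
      (uMat C cil (L.fwd i) b p v * uMat C cil (L.back (i - 1)) a j u) := by
  have h : (L.back (i - 1)).fst = (L.fwd i).fst := congrArg L.x (sub_add_cancel i 1)
  have hlt : cil.lt (L.back (i - 1)).fst (L.back (i - 1)).snd (L.fwd i).snd := by
    rw [h]; exact L.cil_lt i
  have e := congrArg (· * const (Lam C cil) (Rmat s a b)⁻¹)
    (uMat_startStart (C := C) h hlt a b)
  simp only [mul_assoc] at e
  rw [← const_mul, Rmat_mul_inv (C := C) hs, const_one, mul_one, ← mul_assoc] at e
  have e := congrFun (congrFun e (j, p)) (k, t)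
  rw [leg₁_mul_leg₂_apply, Matrix.mul_apply, Fintype.sum_prod_type] at e
  simpa only [leg₂_mul_leg₁_apply, const, Matrix.map_apply, ← Algebra.commutes ((Rmat s a b)⁻¹ _ _),
    ← Algebra.smul_def] using e

end Exchange

/-! ### Cyclicity of the Out and In states -/

section Cyclicity

variable {s : ℂ} (C : ClebschGordan s) {G : SimpleGraph V} {cil : Ciliation G} {n : ℕ} [NeZero n]

/-- The regular vertices of an Out state. -/
def outReg (α β : Fin n → ℕ) (a : ∀ i, Idx (α i)) (i : Fin n) (r : Idx (β (i - 1)))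
    (p : Idx (β i)) : ℂ := C.ψ (β i) (α i) (β (i - 1)) r (p, a i)

/-- The regular vertices of an In state. -/
def inReg (α β : Fin n → ℕ) (a : ∀ i, Idx (α i)) (i : Fin n) (p : Idx (β (i - 1)))
    (r : Idx (β i)) : ℂ := C.φ (β i) (α i) (β (i - 1)) (r, a i) p

/-- The special vertices of an Out state. -/
def outSpec (α β : Fin n → ℕ) (a : ∀ i, Idx (α i)) (i : Fin n) (r : Idx (β (i - 1)))
    (p : Idx (β i)) : ℂ := outTw C (β i) (α i) (β (i - 1)) (a i) r p

/-- The special vertices of an In state. -/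
def inSpec (α β : Fin n → ℕ) (a : ∀ i, Idx (α i)) (i : Fin n) (p : Idx (β (i - 1)))
    (r : Idx (β i)) : ℂ := inTw C (β i) (α i) (β (i - 1)) (a i) p r

/-- The vertices of an Out state. -/
def outVert (α β : Fin n → ℕ) (a : ∀ i, Idx (α i)) : ∀ i, Idx (β (i - 1)) → Idx (β i) → ℂ :=
  Function.update (outReg C α β a) 0 (outSpec C α β a 0)

/-- The vertices of an In state. -/
def inVert (α β : Fin n → ℕ) (a : ∀ i, Idx (α i)) : ∀ i, Idx (β (i - 1)) → Idx (β i) → ℂ :=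
  Function.update (inReg C α β a) 0 (inSpec C α β a 0)

theorem outCoeff_eq (α β : Fin n → ℕ) (a : ∀ i, Idx (α i)) (p r : ∀ i, Idx (β i)) :
    outCoeff C α β a p r = ∏ i, outVert C α β a i (r (i - 1)) (p i) := by
  rw [← Finset.mul_prod_erase _ _ (Finset.mem_univ (0 : Fin n)), outCoeff, mul_right_comm]
  congr 1
  refine Finset.prod_congr rfl fun i hi => ?_
  rw [outVert, Function.update_of_ne (Finset.ne_of_mem_erase hi)]; rfl

theorem inCoeff_eq (α β : Fin n → ℕ) (a : ∀ i, Idx (α i)) (p r : ∀ i, Idx (β i)) :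
    inCoeff C α β a p r = ∏ i, inVert C α β a i (p (i - 1)) (r i) := by
  rw [← Finset.mul_prod_erase _ _ (Finset.mem_univ (0 : Fin n)), inCoeff, mul_right_comm]
  congr 1
  refine Finset.prod_congr rfl fun i hi => ?_
  rw [inVert, Function.update_of_ne (Finset.ne_of_mem_erase hi)]; rfl

theorem outState_eq (L : Loop cil n) (α β : Fin n → ℕ) (a : ∀ i, Idx (α i)) :
    outState C L α β a = traceWord (outVert C α β a)
      (fun i p r => uMat C cil (L.back i) (β i) p r) (List.finRange n) := by
  simp only [outState, traceWord, outCoeff_eq, List.ofFn_eq_map]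

/-- The In state multiplies its links in descending order and joins the row of link i-1 to the
column of link i. In the opposite algebra, with rows and columns exchanged, it is a trace word of
the same shape as the Out state. -/
theorem inState_eq (L : Loop cil n) (α β : Fin n → ℕ) (a : ∀ i, Idx (α i)) :
    MulOpposite.op (inState C L α β a) = traceWord (inVert C α β a)
      (fun i r p => MulOpposite.op (uMat C cil (L.fwd i) (β i) p r)) (List.finRange n) := by
  rw [inState, traceWord, Finset.sum_comm]
  simp only [inCoeff_eq, Finset.op_sum, MulOpposite.op_smul, List.ofFn_eq_map,
    MulOpposite.op_list_prod, List.map_reverse, List.reverse_reverse, List.map_map]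
  rfl

theorem update_shift {J : Fin n → Type*} (T M : ∀ i, J i) (i : Fin n) :
    Function.update (fun i => T (i - 1)) 0 (M (0 - 1)) i =
      Function.update T (0 - 1) (M (0 - 1)) (i - 1) := by
  by_cases h : i = 0
  · subst h; simp
  · rw [Function.update_of_ne h, Function.update_of_ne fun h' => h (sub_left_injective h')]

/-- Renumbering shifts only summation indices, so the rotated state is the old word in shifted order
with its special vertex at 0 - 1. -/
theorem traceWord_shift {J : Fin n → Type*} [∀ i, Fintype (J i)] {A : Type*} [Semiring A]
    [Algebra ℂ A] (T M : ∀ i, J (i - 1) → J i → ℂ) (N : ∀ i, J i → J i → A) :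
    traceWord (J := fun i => J (i - 1)) (Function.update (fun i => T (i - 1)) 0 (M (0 - 1)))
      (fun i => N (i - 1)) (List.finRange n) =
    traceWord (Function.update T (0 - 1) (M (0 - 1))) N ((List.finRange n).map (· - 1)) := by
  rw [traceWord, sum_pi_shift]
  simp only [sum_pi_shift (J := J)]
  rw [traceWord]
  refine Finset.sum_congr rfl fun p _ => Finset.sum_congr rfl fun r _ => ?_
  rw [List.map_map]
  congr 1
  refine Fintype.prod_equiv (Equiv.subRight (1 : Fin n)) _ _ fun i => ?_
  rw [Equiv.subRight_apply, ← update_shift]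

theorem outState_rotate (hs : s ≠ 0) (hq : ∀ k : ℕ, 0 < k → (s ^ 2) ^ k ≠ 1) (L : Loop cil n)
    (α β : Fin n → ℕ) (a : ∀ i, Idx (α i)) :
    outState C L.rotate (fun i => α (i - 1)) (fun i => β (i - 1)) (fun i => a (i - 1)) =
      outState C L α β a := by
  rw [outState_eq, outState_eq, outVert, outVert, traceWord_cyclic (J := fun i => Idx (β i)) L.three_le _ (outSpec C α β a),
    ← traceWord_shift]
  · simp only [Loop.rotate_back]
    rfl
  · intro i j k
    -- A regular vertex is the special one contracted with R⁻¹, and the same R⁻¹ comes out of the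
    -- exchange of the two links.
    have h : ∀ r p, outReg C α β a i r p = ∑ r', ∑ p', (Rmat s (β (i - 1)) (β i))⁻¹ (r, p') (r', p) *
        outSpec C α β a i r' p' := fun r p => (sum_Rmat_inv_outTw C hs hq _ _ _ _ _ _).symm
    simp only [h, Finset.sum_smul, ← back_exchange, Finset.smul_sum, smul_smul]
    rw [Finset.sum_comm]
    conv_rhs => enter [2, p]; rw [Finset.sum_comm]
    conv_rhs => rw [Finset.sum_comm]
    refine Finset.sum_congr rfl fun r' _ => ?_
    conv_rhs => enter [2, p]; rw [Finset.sum_comm]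
    conv_rhs => rw [Finset.sum_comm]
    refine Finset.sum_congr rfl fun p' _ => ?_
    conv_rhs => rw [Finset.sum_comm]
    refine Finset.sum_congr rfl fun u _ => Finset.sum_congr rfl fun v _ => ?_
    rw [mul_comm]
  · exact fun i j h1 h2 h3 p r p' r' => back_commute L h1 h2 h3 _ _ _ _ _ _

theorem inState_rotate (hs : s ≠ 0) (hq : ∀ k : ℕ, 0 < k → (s ^ 2) ^ k ≠ 1) (L : Loop cil n)
    (α β : Fin n → ℕ) (a : ∀ i, Idx (α i)) :
    inState C L.rotate (fun i => α (i - 1)) (fun i => β (i - 1)) (fun i => a (i - 1)) =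
      inState C L α β a := by
  apply MulOpposite.op_injective
  rw [inState_eq, inState_eq, inVert, inVert, traceWord_cyclic (J := fun i => Idx (β i)) L.three_le _ (inSpec C α β a),
    ← traceWord_shift]
  · simp only [Loop.rotate_fwd]
    rfl
  · intro i j k
    -- As for the Out state, with R in place of R⁻¹.
    have h : ∀ p r, inReg C α β a i p r = ∑ p', ∑ r', Rmat s (β (i - 1)) (β i) (p', r) (p, r') *
        inSpec C α β a i p' r' := fun r p => (sum_inTw_Rmat C hs hq _ _ _ _ _ _).symm
    simp only [h, Finset.sum_smul, ← MulOpposite.op_mul, ← fwd_exchange L, Finset.op_sum,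
      MulOpposite.op_smul, Finset.smul_sum, smul_smul]
    rw [Finset.sum_comm]
    conv_rhs => enter [2, p]; rw [Finset.sum_comm]
    conv_rhs => rw [Finset.sum_comm]
    refine Finset.sum_congr rfl fun r' _ => ?_
    conv_rhs => enter [2, p]; rw [Finset.sum_comm]
    conv_rhs => rw [Finset.sum_comm]
    refine Finset.sum_congr rfl fun p' _ => ?_
    refine Finset.sum_congr rfl fun u _ => Finset.sum_congr rfl fun v _ => ?_
    rw [mul_comm]
  · exact fun i j h1 h2 h3 p r p' r' => (fwd_commute L h1 h2 h3 _ _ _ _ _ _).op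

end Cyclicity

/-! ### Ordered products and their regrouping -/

section OrderedProducts

variable {n : ℕ} {A : Type*} [Semiring A] [Algebra ℂ A]

theorem prod_ofFn_sum {J : Fin n → Type*} [∀ i, Fintype (J i)] (f : ∀ i, J i → A) :
    (List.ofFn fun i => ∑ t, f i t).prod = ∑ x : ∀ i, J i, (List.ofFn fun i => f i (x i)).prod := by
  have := (MultilinearMap.mkPiAlgebraFin ℂ n A).map_sum (g := f)
  simpa only [MultilinearMap.mkPiAlgebraFin_apply] using this

theorem prod_ofFn_smul (c : Fin n → ℂ) (f : Fin n → A) :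
    (List.ofFn fun i => c i • f i).prod = (∏ i, c i) • (List.ofFn f).prod := by
  have := (MultilinearMap.mkPiAlgebraFin ℂ n A).map_smul_univ c f
  simpa only [MultilinearMap.mkPiAlgebraFin_apply] using this

theorem prod_reverse_ofFn {M : Type*} [Monoid M] (f : Fin n → M) :
    (List.ofFn f).reverse.prod = MulOpposite.unop (List.ofFn fun i => MulOpposite.op (f i)).prod := by
  rw [MulOpposite.unop_list_prod, List.ofFn_eq_map, List.ofFn_eq_map, List.map_map]
  rfl

theorem prod_reverse_ofFn_sum {J : Fin n → Type*} [∀ i, Fintype (J i)] (f : ∀ i, J i → A) :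
    (List.ofFn fun i => ∑ t, f i t).reverse.prod =
      ∑ x : ∀ i, J i, (List.ofFn fun i => f i (x i)).reverse.prod := by
  simp only [prod_reverse_ofFn, Finset.op_sum]
  rw [prod_ofFn_sum fun i t => MulOpposite.op (f i t), Finset.unop_sum]

/-- The alternating word X₀Y₀X₁⋯Y_{k-1}X_k, bracketed in two ways. -/
theorem prod_ofFn_shift {M : Type*} [Monoid M] (k : ℕ) (X : Fin (k + 1) → M) (Y : Fin k → M) :
    X 0 * (List.ofFn fun i => Y i * X i.succ).prod =
      (List.ofFn fun i => X i.castSucc * Y i).prod * X (Fin.last k) := by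
  induction k with
  | zero => simp
  | succ k ih =>
    have := ih (fun i => X i.succ) fun i => Y i.succ
    rw [List.ofFn_succ, List.prod_cons, List.ofFn_succ, List.prod_cons, mul_assoc, mul_assoc]
    simp only [Fin.succ_castSucc, Fin.succ_last] at this
    rw [Fin.castSucc_zero, mul_assoc, ← this]

/-- Regrouping of an ordered product by the vertices of a loop. -/
theorem prod_ofFn_regroup [NeZero n] {M : Type*} [Monoid M] (X Y : Fin n → M)
    (hX : ∀ i, i ≠ 0 → Commute (Y (0 - 1)) (X i))
    (hY : ∀ i, i ≠ 0 - 1 → Commute (Y (0 - 1)) (Y i)) :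
    (List.ofFn fun i => X i * Y i).prod =
      (List.ofFn fun i => if i = 0 then X i * Y (i - 1) else Y (i - 1) * X i).prod := by
  obtain ⟨k, rfl⟩ : ∃ k, n = k + 1 := ⟨n - 1, by have := NeZero.pos n; omega⟩
  have h0 : (0 : Fin (k + 1)) - 1 = Fin.last k := by
    rw [sub_eq_iff_eq_add]; exact (Fin.last_add_one k).symm
  have hs : ∀ i : Fin k, i.succ - 1 = i.castSucc := by
    intro i
    rw [sub_eq_iff_eq_add, Fin.coeSucc_eq_succ]
  rw [h0] at hX hY
  rw [List.ofFn_succ', List.prod_concat, List.ofFn_succ, List.prod_cons, if_pos rfl, h0]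
  simp only [Fin.succ_ne_zero, if_false, hs]
  -- The last Y closes the word; it commutes with everything except X 0 and is carried back to stand
  -- directly behind it.
  have hc : Commute (Y (Fin.last k)) (List.ofFn fun i : Fin k => Y i.castSucc * X i.succ).prod := by
    refine Commute.list_prod_right _ _ fun x hx => ?_
    obtain ⟨i, rfl⟩ := List.mem_ofFn.mp hx
    exact (hY _ (Fin.castSucc_lt_last i).ne).mul_right (hX _ (Fin.succ_ne_zero i))
  rw [← mul_assoc, ← prod_ofFn_shift k X fun i => Y i.castSucc, mul_assoc, mul_assoc, hc.eq]

theorem prod_ofFn_tmul {B : Type*} [Semiring B] [Algebra ℂ B] (f : Fin n → A) (g : Fin n → B) :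
    (List.ofFn fun i => f i ⊗ₜ[ℂ] g i).prod = (List.ofFn f).prod ⊗ₜ[ℂ] (List.ofFn g).prod := by
  induction n with
  | zero => simp [Algebra.TensorProduct.one_def]
  | succ n ih => simp [List.ofFn_succ, ih]

theorem prod_reverse_ofFn_tmul {B : Type*} [Semiring B] [Algebra ℂ B] (f : Fin n → A)
    (g : Fin n → B) : (List.ofFn fun i => f i ⊗ₜ[ℂ] g i).reverse.prod =
      (List.ofFn f).reverse.prod ⊗ₜ[ℂ] (List.ofFn g).reverse.prod := by
  induction n with
  | zero => simp [Algebra.TensorProduct.one_def]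
  | succ n ih => simp [List.ofFn_succ, ih]

end OrderedProducts

/-! ### Gauge behaviour of regular and special vertices -/

section Vertices

theorem sum_comm_pairs {ι₁ ι₂ ι₃ ι₄ M : Type*} [Fintype ι₁] [Fintype ι₂] [Fintype ι₃] [Fintype ι₄]
    [AddCommMonoid M] (f : ι₁ → ι₂ → ι₃ → ι₄ → M) :
    ∑ a, ∑ b, ∑ c, ∑ d, f a b c d = ∑ c, ∑ d, ∑ a, ∑ b, f a b c d := by
  simpa only [Fintype.sum_prod_type] using
    Finset.sum_comm (s := Finset.univ) (t := Finset.univ)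
      (f := fun (p : ι₁ × ι₂) (q : ι₃ × ι₄) => f p.1 p.2 q.1 q.2)

variable {s : ℂ} {C : ClebschGordan s}

/-- The contraction involves one column and one row index of R⁻¹, so the inverse matrix is of no
use; the inverse for the opposite product, `sum_Rmat_mul_inv`, undoes it. -/
theorem Rmat_inv_cancel (C : ClebschGordan s) (hs : s ≠ 0)
    (hq : ∀ k : ℕ, 0 < k → (s ^ 2) ^ k ≠ 1) {M : Type*} [AddCommMonoid M] [Module ℂ M] {d n : ℕ}
    {Z Z' : Idx d → Idx n → M}
    (h : ∀ x a, ∑ t, ∑ b, (Rmat s d n)⁻¹ (x, b) (t, a) • Z t b =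
      ∑ t, ∑ b, (Rmat s d n)⁻¹ (x, b) (t, a) • Z' t b) (t' : Idx d) (b' : Idx n) :
    Z t' b' = Z' t' b' := by
  have key : ∀ Z : Idx d → Idx n → M, ∑ a, ∑ x, ((muW s n a)⁻¹ * Rmat s d n (t', a) (x, b')) •
      ∑ t, ∑ b, (Rmat s d n)⁻¹ (x, b) (t, a) • Z t b = (muW s n b')⁻¹ • Z t' b' := by
    intro Z
    have e : ∀ t b, ∑ a, ∑ x, (((muW s n a)⁻¹ * Rmat s d n (t', a) (x, b')) *
        (Rmat s d n)⁻¹ (x, b) (t, a)) • Z t b =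
        if b = b' ∧ t' = t then (muW s n b')⁻¹ • Z t b else 0 := by
      intro t b
      simp only [← Finset.sum_smul, mul_assoc, sum_Rmat_mul_inv C hs hq, ite_smul, zero_smul]
    have e2 : ∑ t, ∑ b, (if b = b' ∧ t' = t then (muW s n b')⁻¹ • Z t b else 0) =
        (muW s n b')⁻¹ • Z t' b' := by
      rw [Finset.sum_eq_single t', Finset.sum_eq_single b']
      · simp
      · intro b _ hb; simp [hb]
      · simp
      · intro t _ ht; simp [ht.symm]
      · simp
    rw [← e2]
    simp only [← e, Finset.smul_sum, smul_smul]
    exact sum_comm_pairs _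
  have := key Z
  simp only [h, key] at this
  exact (smul_right_injective M (inv_ne_zero (muW_ne hs n b')) this).symm

theorem Rmat_cancel (C : ClebschGordan s) (hs : s ≠ 0)
    (hq : ∀ k : ℕ, 0 < k → (s ^ 2) ^ k ≠ 1) {M : Type*} [AddCommMonoid M] [Module ℂ M] {d n : ℕ}
    {Z Z' : Idx d → Idx n → M}
    (h : ∀ a x, ∑ t, ∑ b, Rmat s d n (t, a) (x, b) • Z t b =
      ∑ t, ∑ b, Rmat s d n (t, a) (x, b) • Z' t b) (t' : Idx d) (b' : Idx n) :
    Z t' b' = Z' t' b' := by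
  have key : ∀ Z : Idx d → Idx n → M, ∑ a, ∑ x,
      ((muW s n a)⁻¹ * (Rmat s d n)⁻¹ (x, b') (t', a)) •
      ∑ t, ∑ b, Rmat s d n (t, a) (x, b) • Z t b = (muW s n b')⁻¹ • Z t' b' := by
    intro Z
    have e : ∀ t b, ∑ a, ∑ x, (((muW s n a)⁻¹ * (Rmat s d n)⁻¹ (x, b') (t', a)) *
        Rmat s d n (t, a) (x, b)) • Z t b =
        if b' = b ∧ t = t' then (muW s n b)⁻¹ • Z t b else 0 := by
      intro t b
      simp only [← Finset.sum_smul, mul_assoc, mul_comm ((Rmat s d n)⁻¹ _ _),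
        sum_Rmat_mul_inv C hs hq, ite_smul, zero_smul]
    have e2 : ∑ t, ∑ b, (if b' = b ∧ t = t' then (muW s n b)⁻¹ • Z t b else 0) =
        (muW s n b')⁻¹ • Z t' b' := by
      rw [Finset.sum_eq_single t', Finset.sum_eq_single b']
      · simp
      · intro b _ hb; simp [hb.symm]
      · simp
      · intro t _ ht; simp [ht]
      · simp
    rw [← e2]
    simp only [← e, Finset.smul_sum, smul_smul]
    exact sum_comm_pairs _
  have := key Z
  simp only [h, key] at this
  exact (smul_right_injective M (inv_ne_zero (muW_ne hs n b')) this).symm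

section Identities

variable {B : Type*} [Semiring B] [Algebra ℂ B] {g S : ∀ n, Matrix (Idx n) (Idx n) B}

/-- At a regular vertex two gauge factors merge into one: multiply ψ g₁ g₂ = g ψ by S(g) on the left
and by S on the second leg on the right. -/
theorem FusesG.sum_anti_ψ_mul (h : FusesG C g) (hl : ∀ n, S n * g n = 1)
    (hr : ∀ n, g n * S n = 1) (b a c : ℕ) (x : Idx a) (ρ : Idx c) (π : Idx b) :
    ∑ r, ∑ p, C.ψ b a c r (p, x) • (S c ρ r * g b p π) =
      ∑ y, C.ψ b a c ρ (π, y) • S a y x := by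
  have e : S c * const B (C.ψ b a c) * leg₁ a (g b) = const B (C.ψ b a c) * leg₂ b (S a) := by
    have h1 := congrArg (fun M : Matrix (Idx c) (Idx b × Idx a) B => S c * M * leg₂ b (S a))
      (h.ψ_mul b a c)
    simp only [Matrix.mul_assoc] at h1
    rw [← leg₂_mul, hr, leg₂_one, Matrix.mul_one, ← Matrix.mul_assoc (S c) (g c), hl,
      Matrix.one_mul] at h1
    rw [Matrix.mul_assoc, h1]
  have e := congrFun (congrFun e ρ) (π, x)
  rw [Matrix.mul_apply, Matrix.mul_apply, Fintype.sum_prod_type, Fintype.sum_prod_type] at e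
  simp only [Matrix.mul_apply, Finset.sum_mul, leg₁, leg₂, Matrix.of_apply, mul_ite, mul_zero,
    Finset.sum_ite_eq', Finset.mem_univ, if_true, const, Matrix.map_apply,
    ← Algebra.commutes (C.ψ _ _ _ _ _), ← Algebra.smul_def, smul_mul_assoc] at e
  refine (Finset.sum_comm.trans e).trans ?_
  rw [Finset.sum_eq_single π (fun z _ hz => Finset.sum_eq_zero fun y _ => if_neg hz) (by simp)]
  exact Finset.sum_congr rfl fun y _ => if_pos rfl

theorem FusesG.sum_anti_φ_mul (h : FusesG C g) (hl : ∀ n, S n * g n = 1) (b a c : ℕ) (x : Idx a)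
    (ρ : Idx b) (π : Idx c) :
    ∑ p, ∑ r, C.φ b a c (r, x) p • (S b ρ r * g c p π) =
      ∑ y, C.φ b a c (ρ, y) π • g a x y := by
  have e : leg₁ a (S b) * (const B (C.φ b a c) * g c) = leg₂ b (g a) * const B (C.φ b a c) := by
    rw [← h.mul_φ, ← Matrix.mul_assoc, ← Matrix.mul_assoc, ← leg₁_mul, hl, leg₁_one,
      Matrix.one_mul]
  have e := congrFun (congrFun e (ρ, x)) π
  rw [Matrix.mul_apply, Matrix.mul_apply, Fintype.sum_prod_type, Fintype.sum_prod_type] at e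
  simp only [Matrix.mul_apply, Finset.mul_sum, leg₁, leg₂, Matrix.of_apply, ite_mul, zero_mul,
    const, Matrix.map_apply, ← Algebra.commutes (C.φ _ _ _ _ _) (g _ _ _), ← Algebra.smul_def,
    mul_smul_comm] at e
  rw [Finset.sum_comm]
  rw [Finset.sum_eq_single (s := Finset.univ) (a := ρ) (f := fun z => ∑ y, if ρ = z then _ else _)
    (fun z _ hz => Finset.sum_eq_zero fun y _ => if_neg hz.symm) (by simp)] at e
  refine Eq.trans ?_ (e.trans (Finset.sum_congr rfl fun y _ => if_pos rfl))
  refine Finset.sum_congr rfl fun y _ => ?_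
  rw [Finset.sum_eq_single (s := Finset.univ) (a := x)]
  · exact Finset.sum_congr rfl fun y _ => by rw [if_pos rfl]
  · exact fun z _ hz => Finset.sum_eq_zero fun y _ => by rw [if_neg hz.symm, smul_zero]
  · simp

theorem FusesG.startEnd_apply (h : FusesG C g) (hs : s ≠ 0) (hl : ∀ n, S n * g n = 1)
    (hr : ∀ n, g n * S n = 1) (a b : ℕ) (i j : Idx a) (k l : Idx b) :
    ∑ u, ∑ v, (Rmat s a b)⁻¹ (u, k) (j, v) • (S a i u * g b v l) =
      ∑ v, ∑ u, (Rmat s a b)⁻¹ (i, v) (u, l) • (g b k v * S a u j) := by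
  rw [← leg₁_mul_const_mul_leg₂_apply, ← leg₂_mul_const_mul_leg₁_apply]
  have e : leg₁ b (S a) * const B (Rmat s a b)⁻¹ * leg₂ a (g b) =
      leg₂ a (g b) * const B (Rmat s a b)⁻¹ * leg₁ b (S a) := by
    refine mon_startEnd (h.exchange a b) ?_ ?_ ?_ ?_
    · rw [← const_mul, Rmat_mul_inv (C := C) hs, const_one]
    · rw [← const_mul, Rmat_inv_mul (C := C) hs, const_one]
    · rw [← leg₁_mul, hl, leg₁_one]
    · rw [← leg₁_mul, hr, leg₁_one]
  rw [e]

theorem FusesG.endStart_apply (h : FusesG C g) (hl : ∀ n, S n * g n = 1)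
    (hr : ∀ n, g n * S n = 1) (a b : ℕ) (i j : Idx a) (k l : Idx b) :
    ∑ v, ∑ u, Rmat s a b (i, v) (u, l) • (S b k v * g a u j) =
      ∑ u, ∑ v, Rmat s a b (u, k) (j, v) • (g a i u * S b v l) := by
  rw [← leg₁_mul_const_mul_leg₂_apply, ← leg₂_mul_const_mul_leg₁_apply]
  have h1 : leg₂ a (S b) * leg₂ a (g b) = 1 := by rw [← leg₂_mul, hl, leg₂_one]
  have h2 : leg₂ a (g b) * leg₂ a (S b) = 1 := by rw [← leg₂_mul, hr, leg₂_one]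
  have e := congrArg (fun M : Matrix (Idx a × Idx b) (Idx a × Idx b) B =>
    leg₂ a (S b) * M * leg₂ a (S b)) (h.exchange a b)
  simp only [mul_assoc] at e
  rw [h2, mul_one, ← mul_assoc (leg₂ a (S b)) (leg₂ a (g b)), h1, one_mul] at e
  rw [mul_assoc, mul_assoc, e]

/-- At the special vertex g and S(g) meet in the order opposite to that of a regular vertex. After
contraction with R⁻¹ the exchange relation restores the regular order and R⁻¹ turns the special
vertex into ψ, so the regular identity applies; then R⁻¹ is cancelled. -/
theorem FusesG.sum_outTw_mul (h : FusesG C g) (hs : s ≠ 0)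
    (hq : ∀ k : ℕ, 0 < k → (s ^ 2) ^ k ≠ 1) (hl : ∀ n, S n * g n = 1)
    (hr : ∀ n, g n * S n = 1) (b a c : ℕ) (x : Idx a) (ρ : Idx c) (π : Idx b) :
    ∑ r, ∑ p, outTw C b a c x r p • (g b p π * S c ρ r) =
      ∑ y, outTw C b a c y ρ π • S a y x := by
  refine Rmat_inv_cancel C hs hq
    (Z := fun ρ π => ∑ r, ∑ p, outTw C b a c x r p • (g b p π * S c ρ r))
    (Z' := fun ρ π => ∑ y, outTw C b a c y ρ π • S a y x) (fun i p' => ?_) ρ π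
  have e1 : ∀ r p, ∑ t, ∑ k, (Rmat s c b)⁻¹ (i, k) (t, p') • (g b p k * S c t r) =
      ∑ u, ∑ v, (Rmat s c b)⁻¹ (u, p) (r, v) • (S c i u * g b v p') := by
    intro r p
    rw [h.startEnd_apply hs hl hr, Finset.sum_comm]
  have e2 := h.sum_anti_ψ_mul hl hr b a c x i p'
  simp only [← sum_Rmat_inv_outTw C hs hq b a c, Finset.sum_smul] at e2
  simp only [Finset.smul_sum, smul_smul]
  calc _ = ∑ r, ∑ p, outTw C b a c x r p •
        ∑ t, ∑ k, (Rmat s c b)⁻¹ (i, k) (t, p') • (g b p k * S c t r) := by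
        simp only [Finset.smul_sum, smul_smul]
        rw [sum_comm_pairs]
        simp only [mul_comm]
    _ = _ := by
        simp only [e1, Finset.smul_sum, smul_smul]
        rw [sum_comm_pairs]
        simp only [mul_comm (outTw C b a c x _ _)]
        rw [e2, Finset.sum_comm]
        refine Finset.sum_congr rfl fun t _ => ?_
        rw [Finset.sum_comm]

/-- The argument of `FusesG.sum_outTw_mul` with R instead of R⁻¹ and φ instead of ψ. -/
theorem FusesG.sum_inTw_mul (h : FusesG C g) (hs : s ≠ 0)
    (hq : ∀ k : ℕ, 0 < k → (s ^ 2) ^ k ≠ 1) (hl : ∀ n, S n * g n = 1)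
    (hr : ∀ n, g n * S n = 1) (b a c : ℕ) (x : Idx a) (ρ : Idx b) (π : Idx c) :
    ∑ p, ∑ r, inTw C b a c x p r • (g c p π * S b ρ r) =
      ∑ y, inTw C b a c y π ρ • g a x y := by
  refine Rmat_cancel C hs hq
    (Z := fun π ρ => ∑ p, ∑ r, inTw C b a c x p r • (g c p π * S b ρ r))
    (Z' := fun π ρ => ∑ y, inTw C b a c y π ρ • g a x y) (fun k j => ?_) π ρ
  have e2 := h.sum_anti_φ_mul hl b a c x k j
  simp only [← sum_inTw_Rmat C hs hq b a c, Finset.sum_smul] at e2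
  simp only [Finset.smul_sum, smul_smul]
  calc _ = ∑ p, ∑ r, inTw C b a c x p r •
        ∑ t, ∑ v, Rmat s c b (t, k) (j, v) • (g c p t * S b v r) := by
        simp only [Finset.smul_sum, smul_smul]
        rw [sum_comm_pairs]
        simp only [mul_comm]
    _ = _ := by
        simp only [← h.endStart_apply hl hr, Finset.smul_sum, smul_smul]
        rw [sum_comm_pairs, Finset.sum_comm]
        simp only [mul_comm (inTw C b a c x _ _)]
        rw [e2, Finset.sum_comm]
        refine Finset.sum_congr rfl fun t _ => ?_
        rw [Finset.sum_comm]

end Identities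

end Vertices

/-! ### From gauge factors on links to gauge factors at vertices -/

section DoubleSums

theorem mul_mul_apply {B : Type*} [Semiring B] {k : ℕ} (M N P : Matrix (Idx k) (Idx k) B) (p r : Idx k) :
    (M * N * P) p r = ∑ π, ∑ ρ, M p π * N π ρ * P ρ r := by
  rw [Matrix.mul_apply, Finset.sum_comm]
  exact Finset.sum_congr rfl fun ρ _ => by rw [Matrix.mul_apply, Finset.sum_mul]

variable {B : Type*} [Semiring B] [Algebra ℂ B]

/-- To be read with c as the vertex coefficients, F as the link variables and H as the gauge
factors: contracting c with H in the second tensor factor reproduces the state with new external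
indices. -/
theorem sum_tmul_exchange {ι₁ ι₂ ι₃ M N : Type*} [Fintype ι₁] [Fintype ι₂] [Fintype ι₃]
    [AddCommMonoid M] [Module ℂ M] [AddCommMonoid N] [Module ℂ N] (c : ι₁ → ι₁ → ℂ)
    (F : ι₂ → ι₂ → M) (H : ι₁ → ι₁ → ι₂ → ι₂ → N) (d : ι₃ → ι₂ → ι₂ → ℂ) (G : ι₃ → N)
    (h : ∀ π ρ, ∑ p, ∑ r, c p r • H p r π ρ = ∑ b, d b π ρ • G b) :
    ∑ p, ∑ r, c p r • ∑ π, ∑ ρ, F π ρ ⊗ₜ[ℂ] H p r π ρ =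
      ∑ b, (∑ π, ∑ ρ, d b π ρ • F π ρ) ⊗ₜ[ℂ] G b := by
  calc _ = ∑ π, ∑ ρ, F π ρ ⊗ₜ[ℂ] ∑ p, ∑ r, c p r • H p r π ρ := by
        simp only [Finset.smul_sum, TensorProduct.tmul_sum, TensorProduct.tmul_smul]
        exact sum_comm_pairs _
    _ = _ := by
        simp only [h, TensorProduct.tmul_sum, TensorProduct.tmul_smul, TensorProduct.sum_tmul,
          TensorProduct.smul_tmul']
        exact (Finset.sum_congr rfl fun π _ => Finset.sum_comm).trans Finset.sum_comm

variable {n : ℕ} {J : Fin n → Type*} [∀ i, Fintype (J i)]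

theorem prod_ofFn_sum₂ (f : ∀ i, J i → J i → B) : (List.ofFn fun i => ∑ t, ∑ u, f i t u).prod =
    ∑ x : ∀ i, J i, ∑ y : ∀ i, J i, (List.ofFn fun i => f i (x i) (y i)).prod := by
  simp only [prod_ofFn_sum]

theorem prod_reverse_ofFn_sum₂ (f : ∀ i, J i → J i → B) :
    (List.ofFn fun i => ∑ t, ∑ u, f i t u).reverse.prod =
    ∑ x : ∀ i, J i, ∑ y : ∀ i, J i, (List.ofFn fun i => f i (x i) (y i)).reverse.prod := by
  simp only [prod_reverse_ofFn_sum]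

end DoubleSums

section CyclicWords

variable {n : ℕ} [NeZero n] {B : Type*} [Semiring B] [Algebra ℂ B] {J K : Fin n → Type*}
  [∀ i, Fintype (J i)] [∀ i, Fintype (K i)]

/-- The coaction groups gauge factors by links, while the vertex identities need them grouped by
vertices. At the vertex 0 the factor X of the first link precedes the factor Y of the last link,
whence the exceptional order for i = 0. -/
theorem sum_prod_ofFn_vertex (w : ∀ i, K i → J (i - 1) → J i → ℂ) (X Y : ∀ i, J i → J i → B)
    (T : ∀ i, K i → K i → B)
    (hX : ∀ i, i ≠ 0 → ∀ j k l m, Commute (Y (0 - 1) j k) (X i l m))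
    (hY : ∀ i, i ≠ 0 - 1 → ∀ j k l m, Commute (Y (0 - 1) j k) (Y i l m))
    (hw : ∀ i x π ρ, ∑ r, ∑ p, w i x r p •
      (if i = 0 then X i p π * Y (i - 1) ρ r else Y (i - 1) ρ r * X i p π) =
        ∑ y, w i y ρ π • T i y x) (a : ∀ i, K i) (π ρ : ∀ i, J i) :
    ∑ p : ∀ i, J i, ∑ r : ∀ i, J i, (∏ i, w i (a i) (r (i - 1)) (p i)) •
        (List.ofFn fun i => X i (p i) (π i) * Y i (ρ i) (r i)).prod =
      ∑ b : ∀ i, K i, (∏ i, w i (b i) (ρ (i - 1)) (π i)) •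
        (List.ofFn fun i => T i (b i) (a i)).prod := by
  have e : ∀ p r : ∀ i, J i, (List.ofFn fun i => X i (p i) (π i) * Y i (ρ i) (r i)).prod =
      (List.ofFn fun i => if i = 0 then X i (p i) (π i) * Y (i - 1) (ρ (i - 1)) (r (i - 1))
        else Y (i - 1) (ρ (i - 1)) (r (i - 1)) * X i (p i) (π i)).prod :=
    fun p r => prod_ofFn_regroup (fun i => X i (p i) (π i)) (fun i => Y i (ρ i) (r i))
      (fun i h => hX i h _ _ _ _) fun i h => hY i h _ _ _ _
  simp only [e, ← prod_ofFn_smul]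
  rw [← prod_ofFn_sum fun i y => w i y (ρ (i - 1)) (π i) • T i y (a i)]
  simp only [← hw]
  -- The index r_{i-1} belongs to the vertex i, so the family r is renumbered by vertices before the
  -- sums are distributed.
  rw [prod_ofFn_sum, Finset.sum_comm, sum_pi_shift]
  refine Finset.sum_congr rfl fun r _ => ?_
  rw [prod_ofFn_sum]

theorem sum_prod_reverse_ofFn_vertex (w : ∀ i, K i → J (i - 1) → J i → ℂ)
    (X Y : ∀ i, J i → J i → B) (T : ∀ i, K i → K i → B)
    (hY : ∀ i, i ≠ 0 → ∀ j k l m, Commute (X (0 - 1) j k) (Y i l m))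
    (hX : ∀ i, i ≠ 0 - 1 → ∀ j k l m, Commute (X (0 - 1) j k) (X i l m))
    (hw : ∀ i x π ρ, ∑ p, ∑ r, w i x p r •
      (if i = 0 then X (i - 1) p π * Y i ρ r else Y i ρ r * X (i - 1) p π) =
        ∑ y, w i y π ρ • T i x y) (a : ∀ i, K i) (π ρ : ∀ i, J i) :
    ∑ p : ∀ i, J i, ∑ r : ∀ i, J i, (∏ i, w i (a i) (p (i - 1)) (r i)) •
        (List.ofFn fun i => X i (p i) (π i) * Y i (ρ i) (r i)).reverse.prod =
      ∑ b : ∀ i, K i, (∏ i, w i (b i) (π (i - 1)) (ρ i)) •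
        (List.ofFn fun i => T i (a i) (b i)).reverse.prod := by
  refine MulOpposite.op_injective ?_
  have := sum_prod_ofFn_vertex w (fun i r ρ => MulOpposite.op (Y i ρ r))
    (fun i π p => MulOpposite.op (X i p π)) (fun i y x => MulOpposite.op (T i x y))
    (fun i h j k l m => (hY i h _ _ _ _).op) (fun i h j k l m => (hX i h _ _ _ _).op)
    (fun i x ρ π => by
      have := congrArg MulOpposite.op (hw i x π ρ)
      simpa only [Finset.op_sum, MulOpposite.op_smul, apply_ite MulOpposite.op,
        MulOpposite.op_mul] using this) a ρ π
  rw [Finset.sum_comm] at this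
  simpa only [Finset.op_sum, MulOpposite.op_smul, prod_reverse_ofFn, MulOpposite.op_mul,
    MulOpposite.op_unop] using this

end CyclicWords

/-! ### Gauge transformation of the states -/

section GaugeTransformation

variable {s : ℂ} (C : ClebschGordan s) {G : SimpleGraph V} [DecidableEq V]

theorem gAt_fuses (z : V) : FusesG C (gAt C false z) :=
  (gMat_fuses C).map (PiTensorProduct.singleAlgHom (R := ℂ) (A := fun _ : V => Gam C) z)

theorem gAt_anti_mul (z : V) (k : ℕ) : gAt C true z k * gAt C false z k = 1 := by
  rw [gAt, gAt, ← map_matMul, gMat_anti_mul, Matrix.map_one _ (map_zero _) (map_one _)]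

theorem gAt_mul_anti (z : V) (k : ℕ) : gAt C false z k * gAt C true z k = 1 := by
  rw [gAt, gAt, ← map_matMul, gMat_mul_anti, Matrix.map_one _ (map_zero _) (map_one _)]

theorem gAt_commute {z w : V} (h : z ≠ w) (t t' : Bool) (a b : ℕ) (i j : Idx a) (k l : Idx b) :
    Commute (gAt C t z a i j) (gAt C t' w b k l) :=
  Commute.tprod (R := ℂ) (A := fun _ : V => Gam C)
    (a₁ := Pi.mulSingle z (gMat C t a i j)) (a₂ := Pi.mulSingle w (gMat C t' b k l))
    (Pi.mulSingle_commute (f := fun _ : V => Gam C) h _ _)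

theorem coaction_uMat (hs : s ≠ 0) (cil : Ciliation G) (l : G.Dart) (k : ℕ) (p r : Idx k) :
    coaction C cil hs (uMat C cil l k p r) = ∑ π, ∑ ρ, uMat C cil l k π ρ ⊗ₜ[ℂ]
      (gAt C false l.snd k p π * gAt C true l.fst k ρ r) := by
  have e := congrFun (congrFun (freeU_map_coact (inclU C cil)
    (fun t z n => (gMat C t n).map (inclG C cil z)) l k) p) r
  have e1 : coaction C cil hs (uMat C cil l k p r) = freeCoact (inclU C cil)
      (fun t z n => (gMat C t n).map (inclG C cil z)) (freeU l k p r) := by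
    rw [coaction, uMat, Matrix.map_apply, RingQuot.liftAlgHom_mkAlgHom_apply]
  rw [e1]
  refine e.trans ?_
  rw [mul_mul_apply]
  refine Finset.sum_congr rfl fun π _ => Finset.sum_congr rfl fun ρ _ => ?_
  simp only [Matrix.map_apply, inclG, inclU, AlgHom.comp_apply,
    Algebra.TensorProduct.includeRight_apply, Algebra.TensorProduct.includeLeft_apply,
    Algebra.TensorProduct.tmul_mul_tmul, one_mul, mul_one]
  rfl

variable {cil : Ciliation G} {n : ℕ} [NeZero n]

/-- The vertex of an Out state, as a function of the basis vector attached to it. -/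
def outAt (α β : Fin n → ℕ) (i : Fin n) (x : Idx (α i)) (r : Idx (β (i - 1))) (p : Idx (β i)) : ℂ :=
  if i = 0 then outTw C (β i) (α i) (β (i - 1)) x r p else C.ψ (β i) (α i) (β (i - 1)) r (p, x)

/-- The vertex of an In state, as a function of the basis vector attached to it. -/
def inAt (α β : Fin n → ℕ) (i : Fin n) (x : Idx (α i)) (p : Idx (β (i - 1))) (r : Idx (β i)) : ℂ :=
  if i = 0 then inTw C (β i) (α i) (β (i - 1)) x p r else C.φ (β i) (α i) (β (i - 1)) (r, x) p

theorem outVert_apply (α β : Fin n → ℕ) (a : ∀ i, Idx (α i)) (i : Fin n) (r : Idx (β (i - 1)))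
    (p : Idx (β i)) : outVert C α β a i r p = outAt C α β i (a i) r p := by
  rw [outVert, outAt]
  by_cases h : i = 0
  · subst h; rw [Function.update_self, if_pos rfl]; rfl
  · rw [Function.update_of_ne h, if_neg h]; rfl

theorem inVert_apply (α β : Fin n → ℕ) (a : ∀ i, Idx (α i)) (i : Fin n) (p : Idx (β (i - 1)))
    (r : Idx (β i)) : inVert C α β a i p r = inAt C α β i (a i) p r := by
  rw [inVert, inAt]
  by_cases h : i = 0
  · subst h; rw [Function.update_self, if_pos rfl]; rfl
  · rw [Function.update_of_ne h, if_neg h]; rfl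

theorem coaction_outState (hs : s ≠ 0) (hq : ∀ k : ℕ, 0 < k → (s ^ 2) ^ k ≠ 1) (L : Loop cil n)
    (α β : Fin n → ℕ) (a : ∀ i, Idx (α i)) :
    coaction C cil hs (outState C L α β a) = ∑ b : ∀ i, Idx (α i), outState C L α β b ⊗ₜ[ℂ]
      (List.ofFn fun i => gAt C true (L.x i) (α i) (b i) (a i)).prod := by
  have hne : (0 : Fin n) - 1 + 1 = 0 := by simp
  have key : ∀ π ρ : ∀ i, Idx (β i), _ := sum_prod_ofFn_vertex (B := GaugeAlg C V) (outAt C α β)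
    (fun i p π => gAt C false (L.x i) (β i) p π)
    (fun i ρ r => gAt C true (L.x (i + 1)) (β i) ρ r) (fun i y x => gAt C true (L.x i) (α i) y x)
    (fun i h _ _ _ _ => gAt_commute C (by rw [hne]; exact fun e => h (L.inj e).symm) _ _ _ _ _ _ _ _)
    (fun i h _ _ _ _ => gAt_commute C (fun e => h (by
      have := L.inj e; rw [hne] at this; exact (eq_sub_of_add_eq this.symm)))  _ _ _ _ _ _ _ _)
    (fun i x π ρ => by
      -- The antipode factor of the link i - 1 sits at x_{(i-1)+1}, which is the vertex x_i.
      rw [sub_add_cancel]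
      by_cases h : i = 0
      · simp only [if_pos h, outAt]
        exact (gAt_fuses C _).sum_outTw_mul hs hq (gAt_anti_mul C _) (gAt_mul_anti C _) _ _ _ _ _ _
      · simp only [if_neg h, outAt]
        exact (gAt_fuses C _).sum_anti_ψ_mul (gAt_anti_mul C _) (gAt_mul_anti C _) _ _ _ _ _ _) a
  have e : ∀ p r : ∀ i, Idx (β i), coaction C cil hs
      (List.ofFn fun i => uMat C cil (L.back i) (β i) (p i) (r i)).prod =
      ∑ π : ∀ i, Idx (β i), ∑ ρ : ∀ i, Idx (β i),
        (List.ofFn fun i => uMat C cil (L.back i) (β i) (π i) (ρ i)).prod ⊗ₜ[ℂ]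
        (List.ofFn fun i => gAt C false (L.x i) (β i) (p i) (π i) *
          gAt C true (L.x (i + 1)) (β i) (ρ i) (r i)).prod := by
    intro p r
    rw [map_list_prod, List.map_ofFn]
    simp only [Function.comp_def, coaction_uMat]
    refine (prod_ofFn_sum₂ (B := LamGauge C cil) (fun i (π ρ : Idx (β i)) =>
      uMat C cil (L.back i) (β i) π ρ ⊗ₜ[ℂ] (gAt C false (L.x i) (β i) (p i) π *
        gAt C true (L.x (i + 1)) (β i) ρ (r i)))).trans ?_
    exact Finset.sum_congr rfl fun π _ => Finset.sum_congr rfl fun ρ _ => prod_ofFn_tmul _ _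
  simp only [outState, outCoeff_eq, outVert_apply, map_sum, map_smul, e]
  exact sum_tmul_exchange _ _ _ _ _ key

theorem coaction_inState (hs : s ≠ 0) (hq : ∀ k : ℕ, 0 < k → (s ^ 2) ^ k ≠ 1) (L : Loop cil n)
    (α β : Fin n → ℕ) (a : ∀ i, Idx (α i)) :
    coaction C cil hs (inState C L α β a) = ∑ b : ∀ i, Idx (α i), inState C L α β b ⊗ₜ[ℂ]
      (List.ofFn fun i => gAt C false (L.x i) (α i) (a i) (b i)).prod := by
  have hne : (0 : Fin n) - 1 + 1 = 0 := by simp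
  -- The In word yields the vertex factors in descending order; factors at distinct vertices
  -- commute, so the order may be restored.
  have hr : ∀ b : ∀ i, Idx (α i), (List.ofFn fun i => gAt C false (L.x i) (α i) (a i) (b i)).prod =
      (List.ofFn fun i => gAt C false (L.x i) (α i) (a i) (b i)).reverse.prod := by
    intro b
    refine (List.reverse_perm _).symm.prod_eq' ?_
    rw [List.pairwise_ofFn]
    exact fun i j h => gAt_commute C (fun e => h.ne (L.inj e)) _ _ _ _ _ _ _ _
  have key : ∀ π ρ : ∀ i, Idx (β i), _ := sum_prod_reverse_ofFn_vertex (B := GaugeAlg C V)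
    (inAt C α β)
    (fun i p π => gAt C false (L.x (i + 1)) (β i) p π)
    (fun i ρ r => gAt C true (L.x i) (β i) ρ r) (fun i y x => gAt C false (L.x i) (α i) y x)
    (fun i h _ _ _ _ => gAt_commute C (by rw [hne]; exact fun e => h (L.inj e).symm) _ _ _ _ _ _ _ _)
    (fun i h _ _ _ _ => gAt_commute C (fun e => h (by
      have := L.inj e; rw [hne] at this; exact (eq_sub_of_add_eq this.symm)))  _ _ _ _ _ _ _ _)
    (fun i x π ρ => by
      rw [sub_add_cancel]
      by_cases h : i = 0
      · simp only [if_pos h, inAt]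
        exact (gAt_fuses C _).sum_inTw_mul hs hq (gAt_anti_mul C _) (gAt_mul_anti C _) _ _ _ _ _ _
      · simp only [if_neg h, inAt]
        exact (gAt_fuses C _).sum_anti_φ_mul (gAt_anti_mul C _) _ _ _ _ _ _) a
  have e : ∀ p r : ∀ i, Idx (β i), coaction C cil hs
      (List.ofFn fun i => uMat C cil (L.fwd i) (β i) (p i) (r i)).reverse.prod =
      ∑ π : ∀ i, Idx (β i), ∑ ρ : ∀ i, Idx (β i),
        (List.ofFn fun i => uMat C cil (L.fwd i) (β i) (π i) (ρ i)).reverse.prod ⊗ₜ[ℂ]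
        (List.ofFn fun i => gAt C false (L.x (i + 1)) (β i) (p i) (π i) *
          gAt C true (L.x i) (β i) (ρ i) (r i)).reverse.prod := by
    intro p r
    rw [map_list_prod, List.map_reverse, List.map_ofFn]
    simp only [Function.comp_def, coaction_uMat]
    refine (prod_reverse_ofFn_sum₂ (B := LamGauge C cil) (fun i (π ρ : Idx (β i)) =>
      uMat C cil (L.fwd i) (β i) π ρ ⊗ₜ[ℂ] (gAt C false (L.x (i + 1)) (β i) (p i) π *
        gAt C true (L.x i) (β i) ρ (r i)))).trans ?_
    exact Finset.sum_congr rfl fun π _ => Finset.sum_congr rfl fun ρ _ =>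
      prod_reverse_ofFn_tmul _ _
  simp only [inState, inCoeff_eq, inVert_apply, map_sum, map_smul, e, hr]
  exact sum_tmul_exchange _ _ _ _ _ key

end GaugeTransformation

/-! ### Consequences of invariance for the integral of one link -/

section HaarForm

variable {s : ℂ} {C : ClebschGordan s} {G : SimpleGraph V} {cil : Ciliation G}

/-- The representation of `Γ` given by matrices that satisfy its relations. -/
def gamLift {B : Type*} [Ring B] [Algebra ℂ B] (g S : ∀ n, Matrix (Idx n) (Idx n) B)
    (h : FusesG C g) (g0 : g 0 = 1) (hl : ∀ n, S n * g n = 1) (hr : ∀ n, g n * S n = 1) :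
    Gam C →ₐ[ℂ] B :=
  RingQuot.liftAlgHom ℂ ⟨FreeAlgebra.lift ℂ fun w => (if w.anti then S else g) w.spin w.row w.col, by
    have hf : ∀ n, (freeG false n).map (FreeAlgebra.lift ℂ fun w : GroupVar =>
        (if w.anti then S else g) w.spin w.row w.col) = g n := by
      intro n; ext i j
      rw [Matrix.map_apply, freeG, Matrix.of_apply, FreeAlgebra.lift_ι_apply]; rfl
    have ht : ∀ n, (freeG true n).map (FreeAlgebra.lift ℂ fun w : GroupVar =>
        (if w.anti then S else g) w.spin w.row w.col) = S n := by
      intro n; ext i j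
      rw [Matrix.map_apply, freeG, Matrix.of_apply, FreeAlgebra.lift_ι_apply]; rfl
    have key : ∀ {m n : Type} {M N : Matrix m n (FreeAlgebra ℂ GroupVar)},
        M.map (FreeAlgebra.lift ℂ fun w : GroupVar => (if w.anti then S else g) w.spin w.row w.col) =
        N.map (FreeAlgebra.lift ℂ fun w : GroupVar => (if w.anti then S else g) w.spin w.row w.col) →
        ∀ p r, FreeAlgebra.lift ℂ (fun w : GroupVar =>
            (if w.anti then S else g) w.spin w.row w.col) (M p r) =
          FreeAlgebra.lift ℂ (fun w : GroupVar =>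
            (if w.anti then S else g) w.spin w.row w.col) (N p r) :=
      fun e p r => congrFun (congrFun e p) r
    intro x y hxy
    cases hxy with
    | fusion a b p r =>
      refine key ?_ p r
      simp only [map_matMul, map_matSum, const_map, leg₁_map _ _ _ (map_zero _),
        leg₂_map _ _ _ (map_zero _), hf]
      exact h a b
    | triv i j =>
      refine (congrFun (congrFun (hf 0) i) j).trans ?_
      rw [g0, idx_zero_eq i j, Matrix.one_apply_eq, map_one]
    | anti_mul n i j =>
      refine key ?_ i j
      rw [map_matMul, hf, ht, hl, Matrix.map_one _ (map_zero _) (map_one _)]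
    | mul_anti n i j =>
      refine key ?_ i j
      rw [map_matMul, hf, ht, hr, Matrix.map_one _ (map_zero _) (map_one _)]⟩

theorem gamLift_gMat {B : Type*} [Ring B] [Algebra ℂ B] (g S : ∀ n, Matrix (Idx n) (Idx n) B)
    (h : FusesG C g) (g0 : g 0 = 1) (hl : ∀ n, S n * g n = 1) (hr : ∀ n, g n * S n = 1)
    (t : Bool) (n : ℕ) (i j : Idx n) :
    gamLift g S h g0 hl hr (gMat C t n i j) = (if t then S else g) n i j := by
  rw [gamLift, gMat, Matrix.map_apply, RingQuot.liftAlgHom_mkAlgHom_apply, freeG, Matrix.of_apply]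
  exact FreeAlgebra.lift_ι_apply _ _

theorem one_fuses : FusesG C fun n => (1 : Matrix (Idx n) (Idx n) ℂ) := by
  intro a b
  simp only [leg₁_one, leg₂_one, Matrix.mul_one, ← const_mul, ← const_sum, C.complete, const_one]

/-- The counit of `Γ`. -/
def gamCounit (C : ClebschGordan s) : Gam C →ₐ[ℂ] ℂ :=
  gamLift (fun _ => 1) (fun _ => 1) one_fuses rfl (fun _ => mul_one 1) (fun _ => mul_one 1)

theorem gamCounit_gMat (t : Bool) (n : ℕ) (i j : Idx n) :
    gamCounit C (gMat C t n i j) = (1 : Matrix (Idx n) (Idx n) ℂ) i j := by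
  rw [gamCounit, gamLift_gMat]; cases t <;> rfl

theorem fieldSubalg_univ : fieldSubalg C cil Set.univ = ⊤ := by
  have h : (⊤ : Subalgebra ℂ (Lam C cil)) =
      (⊤ : Subalgebra ℂ (FreeAlgebra ℂ (FieldVar G))).map (RingQuot.mkAlgHom ℂ (FieldRel C cil)) := by
    rw [Algebra.map_top, eq_comm, AlgHom.range_eq_top]
    exact RingQuot.mkAlgHom_surjective ℂ _
  rw [h, ← FreeAlgebra.adjoin_range_ι, AlgHom.map_adjoin, fieldSubalg]
  congr 1
  ext A
  constructor
  · rintro ⟨l, -, n, i, j, rfl⟩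
    exact ⟨_, ⟨⟨l, n, i, j⟩, rfl⟩, rfl⟩
  · rintro ⟨_, ⟨⟨l, n, i, j⟩, rfl⟩, rfl⟩
    exact ⟨l, trivial, n, i, j, rfl⟩

theorem uMat_mem {X : Set G.Dart} {l : G.Dart} (h : l ∈ X) (k : ℕ) (i j : Idx k) :
    uMat C cil l k i j ∈ fieldSubalg C cil X :=
  Algebra.subset_adjoin ⟨l, h, k, i, j, rfl⟩

variable [DecidableEq V] {hs : s ≠ 0} {h : Lam C cil →ₗ[ℂ] ℂ}

/-- 1 belongs to the subalgebra of the empty set of links, so h(A) = h(1)h(A) for an A with h(A) ≠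
0. -/
theorem IsHaar.map_one (H : IsHaar C cil hs h) : h 1 = 1 := by
  obtain ⟨A, hA⟩ : ∃ A, h A ≠ 0 := by
    by_contra hn
    push Not at hn
    exact H.ne_zero (LinearMap.ext hn)
  have e := H.factor ∅ Set.univ (by simp) 1 (one_mem _) A (by rw [fieldSubalg_univ]; trivial)
  rw [one_mul] at e
  exact (mul_eq_right₀ hA).mp e.symm

/-- Evaluates a product functional on the gauge algebra; the product over all vertices is where
finiteness of the vertex set enters. -/
theorem lift_gAt_mul_gAt {z w : V} (hzw : z ≠ w) [Fintype V] (f : V → Gam C →ₗ[ℂ] ℂ)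
    (hf : ∀ v, v ≠ z → v ≠ w → f v 1 = 1) (t t' : Bool) (a b : ℕ) (i j : Idx a) (k l : Idx b) :
    PiTensorProduct.lift ((MultilinearMap.mkPiAlgebra ℂ V ℂ).compLinearMap f)
      (gAt C t z a i j * gAt C t' w b k l) = f z (gMat C t a i j) * f w (gMat C t' b k l) := by
  have e : gAt C t z a i j * gAt C t' w b k l = PiTensorProduct.tprod ℂ
      (Pi.mulSingle z (gMat C t a i j) * Pi.mulSingle w (gMat C t' b k l) : V → Gam C) :=
    PiTensorProduct.tprod_mul_tprod _ _
  rw [e, PiTensorProduct.lift.tprod, MultilinearMap.compLinearMap_apply,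
    MultilinearMap.mkPiAlgebra_apply, Finset.prod_eq_mul z w hzw]
  · simp [Pi.mulSingle_eq_of_ne hzw, Pi.mulSingle_eq_of_ne hzw.symm]
  · intro v _ hv
    simp [Pi.mulSingle_eq_of_ne hv.1, Pi.mulSingle_eq_of_ne hv.2, hf v hv.1 hv.2]
  · simp
  · simp

/-- Invariance is tested with the representation R⁻¹ of `Γ` at the end point of l and with the
counit at every other vertex. The counit removes S(g) at the departure point, and the column of
integrals comes out invariant. -/
theorem IsHaar.sum_Rmat_inv [Finite V] (H : IsHaar C cil hs h)
    (hq : ∀ k : ℕ, 0 < k → (s ^ 2) ^ k ≠ 1) (l : G.Dart) (d k : ℕ) (i j : Idx d) (p r : Idx k) :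
    ∑ π, (Rmat s d k)⁻¹ (i, p) (j, π) * h (uMat C cil l k π r) =
      if i = j then h (uMat C cil l k p r) else 0 := by
  classical
  have := Fintype.ofFinite V
  have e := H.invariant (uMat C cil l k p r)
  rw [coaction_uMat] at e
  simp only [map_sum, TensorProduct.map_tmul, LinearMap.id_apply] at e
  set θ : Gam C →ₐ[ℂ] Matrix (Idx d) (Idx d) ℂ := gamLift (fun n => blk (Rmat s d n)⁻¹)
    (fun n => blk (Rmat s d n)) (blk_Rmat_inv_fuses C hs hq d)
    (by simp only [Rmat_zero_right, inv_one, blk_one]) (blk_Rmat_mul_inv C hs d)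
    (blk_Rmat_inv_mul C hs d) with hθ
  set f : V → Gam C →ₗ[ℂ] ℂ := fun v => if v = l.snd then
    (Matrix.entryLinearMap ℂ ℂ i j).comp θ.toLinearMap else (gamCounit C).toLinearMap with hf
  have hfv : ∀ v, v ≠ l.snd → ∀ x, f v x = gamCounit C x := fun v hv x => by
    simp only [hf, if_neg hv]; rfl
  have hfl : ∀ x, f l.snd x = θ x i j := fun x => by simp only [hf, if_pos rfl]; rfl
  have e1 : PiTensorProduct.lift ((MultilinearMap.mkPiAlgebra ℂ V ℂ).compLinearMap f) 1 =
      (1 : Matrix (Idx d) (Idx d) ℂ) i j := by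
    rw [PiTensorProduct.one_def, PiTensorProduct.lift.tprod, MultilinearMap.compLinearMap_apply,
      MultilinearMap.mkPiAlgebra_apply, Finset.prod_eq_single l.snd]
    · rw [hfl, Pi.one_apply, _root_.map_one]
    · intro v _ hv
      rw [hfv v hv, Pi.one_apply, _root_.map_one]
    · simp
  have e2 := congrArg (fun x => PiTensorProduct.lift
    ((MultilinearMap.mkPiAlgebra ℂ V ℂ).compLinearMap f) (TensorProduct.lid ℂ _ x)) e
  simp only [map_sum, TensorProduct.lid_tmul, map_smul, e1] at e2
  simp only [lift_gAt_mul_gAt (C := C) l.fst_ne_snd.symm f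
    (fun v hv _ => by rw [hfv v hv, _root_.map_one]), hfl, hfv _ l.fst_ne_snd, gamCounit_gMat, hθ,
    gamLift_gMat, Matrix.one_apply, smul_eq_mul, mul_ite, mul_one, mul_zero, Finset.sum_ite_eq',
    Finset.mem_univ, if_true] at e2
  rw [← e2]
  exact Finset.sum_congr rfl fun π _ => mul_comm _ _

theorem IsHaar.sum_Rmat [Finite V] (H : IsHaar C cil hs h)
    (hq : ∀ k : ℕ, 0 < k → (s ^ 2) ^ k ≠ 1) (l : G.Dart) (d k : ℕ) (i j : Idx d) (p r : Idx k) :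
    ∑ π, Rmat s d k (i, p) (j, π) * h (uMat C cil l k π r) =
      if i = j then h (uMat C cil l k p r) else 0 := by
  have e : ∀ i' p', h (uMat C cil l k p' r) * (1 : Matrix (Idx d) (Idx d) ℂ) i' j =
      ∑ π, (Rmat s d k)⁻¹ (i', p') (j, π) * h (uMat C cil l k π r) := by
    intro i' p'
    rw [H.sum_Rmat_inv hq, Matrix.one_apply, mul_ite, mul_one, mul_zero]
  have e3 := congrArg (fun M : Matrix (Idx d × Idx k) (Idx d × Idx k) ℂ =>
    ∑ π, M (i, p) (j, π) * h (uMat C cil l k π r)) (Rmat_mul_inv (C := C) hs d k)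
  simp only [Matrix.mul_apply, Finset.sum_mul, mul_assoc] at e3
  rw [Finset.sum_comm] at e3
  simp only [← Finset.mul_sum, ← e, Fintype.sum_prod_type] at e3
  simp only [Matrix.one_apply, mul_ite, mul_one, mul_zero, Prod.mk.injEq, ite_mul, one_mul,
    zero_mul] at e3
  rw [Finset.sum_comm] at e3
  simp only [Finset.sum_ite_eq', Finset.mem_univ, if_true] at e3
  rw [e3]
  by_cases hij : i = j <;> simp [hij]

/-- The case d = 1 suffices. A diagonal entry of R acts as q^{H/2} and kills the components of
nonzero weight; an off-diagonal entry is a multiple of F, which does not annihilate the vector of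
weight zero if k > 0. -/
theorem IsHaar.uMat_eq_zero [Finite V] (H : IsHaar C cil hs h)
    (hq : ∀ k : ℕ, 0 < k → (s ^ 2) ^ k ≠ 1) (l : G.Dart) {k : ℕ} (hk : k ≠ 0) (p r : Idx k) :
    h (uMat C cil l k p r) = 0 := by
  have hw : ∀ p : Idx k, wt k p ≠ 0 → h (uMat C cil l k p r) = 0 := by
    intro p hp
    have e := H.sum_Rmat hq l 1 k 0 0 p r
    simp only [Rmat_apply_highest, Prod.mk.injEq, true_and, ite_mul, zero_mul, Finset.sum_ite_eq,
      Finset.mem_univ, if_true] at e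
    have h1 : wt 1 (0 : Idx 1) = 1 := rfl
    rw [h1, one_mul, mul_left_eq_self₀] at e
    refine e.resolve_left fun e => hp (sq_zpow_inj hs hq ?_)
    rw [zpow_zero, ← zpow_natCast, zpow_comm, e, one_zpow]
  by_cases hp : wt k p = 0
  · have hpk : (p : ℕ) < k := by rw [wt] at hp; omega
    have e := H.sum_Rmat hq l 1 k 0 1 ⟨p + 1, by omega⟩ r
    rw [if_neg (by simp), Finset.sum_eq_single p
      (fun π _ hπ => by
        rw [hw π fun hπ0 => hπ (Fin.ext (by rw [wt] at hp hπ0; omega)), mul_zero]) (by simp),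
      Rmat_apply, Finset.sum_range_succ, Finset.sum_range_one, pow_zero, pow_one, pow_one,
      Matrix.one_apply_ne (by simp [Fin.ext_iff]), mul_zero, zero_mul, zero_add] at e
    refine (mul_eq_zero.mp e).resolve_left ?_
    have h1 : repF s k ⟨p + 1, by omega⟩ p = qInt s (p + 1) := by simp [repF]
    have h2 : repE s 1 0 1 = qInt s 1 := by simp [repE]
    have h3 : rCoeff s 1 ≠ 0 := by
      simp [rCoeff, qFact, qInt_ne hs hq, sq_sub_inv_ne hs hq]
    rw [h1, h2]
    exact mul_ne_zero (zpow_ne_zero _ hs) (mul_ne_zero (mul_ne_zero h3 (qInt_ne hs hq (by omega)))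
      (qInt_ne hs hq one_pos))
  · exact hw p hp

end HaarForm

/-! ### Opposite links and the Schur orthogonality weights -/

section Reversal

variable {s : ℂ} {C : ClebschGordan s} {G : SimpleGraph V} {cil : Ciliation G}

/-- Invariance of φ^{aa}_0 under u ⊗ u. The fusion rule of u flips the legs of ψ, so the invariant
vector enters flipped on one side, as `cup C a j.rev`. -/
theorem sum_cup_uMat (hs : s ≠ 0) (hq : ∀ k : ℕ, 0 < k → (s ^ 2) ^ k ≠ 1) (l : G.Dart) (a : ℕ)
    (i k : Idx a) : ∑ j, cup C a j.rev • (uMat C cil l a i j * uMat C cil l a k j.rev) =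
      if k = i.rev then algebraMap ℂ (Lam C cil) (cup C a i) else 0 := by
  have e : leg₁ a (uMat C cil l a) * leg₂ a (uMat C cil l a) *
      const (Lam C cil) ((C.φ a a 0).submatrix Prod.swap id : Matrix _ (Idx 0) ℂ) =
      const (Lam C cil) (C.φ a a 0) := by
    rw [uMat_fusion, Matrix.sum_mul, Finset.sum_eq_single 0]
    · rw [Matrix.mul_assoc, ← const_mul, ψ_φ_swap_self C (adm_self_zero a), const_one,
        Matrix.mul_one, uMat_zero, Matrix.mul_one]
    · intro c _ hc
      rw [Matrix.mul_assoc, ← const_mul, ψ_φ_swap_ne C hc, const_zero, Matrix.mul_zero]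
    · exact fun h => absurd (mem_channels (adm_self_zero a)) h
  have e := congrFun (congrFun e (i, k)) 0
  rw [Matrix.mul_apply, Fintype.sum_prod_type, const, const, Matrix.map_apply,
    φ_zero_apply hs hq, apply_ite (algebraMap ℂ _), map_zero] at e
  rw [← e]
  refine Finset.sum_congr rfl fun j _ => ?_
  rw [Finset.sum_eq_single j.rev]
  · rw [leg₁_mul_leg₂_apply, Matrix.map_apply, Matrix.submatrix_apply, Prod.swap_prod_mk, id,
      φ_zero_apply hs hq, if_pos (Fin.rev_rev j).symm, Algebra.smul_def, Algebra.commutes]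
  · intro x _ hx
    rw [Matrix.map_apply, Matrix.submatrix_apply, Prod.swap_prod_mk, id, φ_zero_apply hs hq,
      if_neg fun h => hx (by rw [h, Fin.rev_rev]), map_zero, mul_zero]
  · simp

/-- u(-l) inverts u(l), so the invariance of φ^{aa}_0 makes it a twisted transpose of u(l). Products
of u(l) and u(-l) can then be fused on the single link l. -/
theorem uMat_symm_apply (hs : s ≠ 0) (hq : ∀ k : ℕ, 0 < k → (s ^ 2) ^ k ≠ 1) (l : G.Dart) (a : ℕ)
    (i j : Idx a) : uMat C cil l.symm a i j =
      ((cup C a j)⁻¹ * cup C a i.rev) • uMat C cil l a j.rev i.rev := by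
  have e : ∑ x, uMat C cil l.symm a i x *
      ∑ y, cup C a y.rev • (uMat C cil l a x y * uMat C cil l a j.rev y.rev) =
      cup C a i.rev • uMat C cil l a j.rev i.rev := by
    have h1 := fun y => congrFun (congrFun (uMat_symm_mul (C := C) (cil := cil) l a) i) y
    simp only [Matrix.mul_apply] at h1
    simp only [Finset.mul_sum, mul_smul_comm, ← mul_assoc]
    rw [Finset.sum_comm]
    simp only [← Finset.smul_sum, ← Finset.sum_mul, h1, Matrix.one_apply, ite_mul, one_mul,
      zero_mul, smul_ite, smul_zero, Finset.sum_ite_eq, Finset.mem_univ, if_true]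
  simp only [sum_cup_uMat hs hq, Fin.rev_inj, mul_ite, mul_zero, Finset.sum_ite_eq,
    Finset.mem_univ, if_true, ← Algebra.commutes, ← Algebra.smul_def] at e
  rw [mul_smul, ← e, smul_smul, inv_mul_cancel₀ (cup_ne hs hq a j), one_smul]

/-- The value of the invariant measure on a matrix element of `u(l)` in the representation `a`
times a matrix element of `u(-l)` in the representation `b`. -/
def pairing (C : ClebschGordan s) (a b : ℕ) (p r : Idx a) (p' r' : Idx b) : ℂ :=
  (cup C b r')⁻¹ * cup C b p'.rev * (C.φ a b 0 (p, r'.rev) 0 * C.ψ b a 0 0 (p'.rev, r))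

theorem not_adm_zero {a b : ℕ} (h : a ≠ b) : ¬ Adm a b 0 := fun hA => h (by
  obtain ⟨-, h1, h2, h3⟩ := hA; omega)

theorem pairing_ne {a b : ℕ} (h : a ≠ b) (p r : Idx a) (p' r' : Idx b) :
    pairing C a b p r p' r' = 0 := by
  rw [pairing, C.φ_zero _ _ _ (not_adm_zero h), Matrix.zero_apply, zero_mul, mul_zero]

/-- Schur orthogonality: the product of cup and cap components that is left over is evaluated by
`cap_mul_cup` at the reversed index, which gives μ⁻¹ over the quantum dimension. -/
theorem pairing_self (hs : s ≠ 0) (hq : ∀ k : ℕ, 0 < k → (s ^ 2) ^ k ≠ 1) (a : ℕ)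
    (p r p' r' : Idx a) : pairing C a a p r p' r' =
      if p' = r ∧ r' = p then (muW s a r)⁻¹ * (∑ j, muW s a j)⁻¹ else 0 := by
  rw [pairing, φ_zero_apply hs hq, ψ_zero_apply hs hq, Fin.rev_rev]
  simp only [Fin.rev_inj]
  by_cases h1 : r' = p
  · by_cases h2 : p' = r
    · subst h1 h2
      have h3 := cap_mul_cup (C := C) hs hq a p'.rev
      rw [muW_rev] at h3
      have h4 := cup_ne (C := C) hs hq a r'
      rw [if_pos rfl, if_pos rfl, if_pos ⟨rfl, rfl⟩, ← h3, mul_assoc _ (∑ j, muW s a j),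
        mul_inv_cancel₀ (sum_muW_ne C hs hq a)]
      field_simp
    · rw [if_neg (Ne.symm h2), if_neg (c := p' = r ∧ _) fun h => h2 h.1, mul_zero, mul_zero]
  · rw [if_neg h1, if_neg (c := p' = r ∧ _) fun h => h1 h.2, zero_mul, mul_zero]

theorem uMat_mul_symm_apply (hs : s ≠ 0) (hq : ∀ k : ℕ, 0 < k → (s ^ 2) ^ k ≠ 1) (l : G.Dart)
    (a b : ℕ) (p r : Idx a) (p' r' : Idx b) :
    uMat C cil l a p r * uMat C cil l.symm b p' r' =
      ∑ c ∈ channels a b, ∑ k, ∑ m, ((cup C b r')⁻¹ * cup C b p'.rev *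
        (C.φ a b c (p, r'.rev) k * C.ψ b a c m (p'.rev, r))) • uMat C cil l c k m := by
  have e := congrFun (congrFun (uMat_fusion (C := C) (cil := cil) l a b) (p, r'.rev)) (r, p'.rev)
  rw [leg₁_mul_leg₂_apply] at e
  rw [uMat_symm_apply hs hq, mul_smul_comm, e, Matrix.sum_apply, Finset.smul_sum]
  refine Finset.sum_congr rfl fun c _ => ?_
  rw [Matrix.mul_apply, Finset.sum_comm, Finset.smul_sum]
  refine Finset.sum_congr rfl fun m _ => ?_
  rw [Matrix.mul_apply, Finset.sum_mul, Finset.smul_sum]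
  refine Finset.sum_congr rfl fun k _ => ?_
  change _ • (algebraMap ℂ (Lam C cil) (C.φ a b c (p, r'.rev) k) * uMat C cil l c k m *
    algebraMap ℂ (Lam C cil) (C.ψ b a c m (p'.rev, r))) = _
  rw [← Algebra.commutes, ← mul_assoc, ← map_mul, ← Algebra.smul_def, smul_smul,
    mul_comm (C.ψ _ _ _ _ _)]

end Reversal

/-! ### Integration of the links, pair by pair -/

section Integration

variable {s : ℂ} {C : ClebschGordan s} {G : SimpleGraph V} {cil : Ciliation G} {n : ℕ} [NeZero n]
  (L : Loop cil n)

/-- The links away from the edge `x_i x_{i+1}`. -/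
def Loop.off (i : Fin n) : Set G.Dart := {l | l ≠ L.back i ∧ l ≠ L.fwd i}

theorem Loop.add_one_add_one_ne {G : SimpleGraph V} {cil : Ciliation G} (L : Loop cil n) (i : Fin n) : i + 1 + 1 ≠ i := fun h => by
  have := L.cil_lt (i + 1)
  rw [h, add_sub_cancel_right] at this
  exact cil.irrefl _ _ this

theorem Loop.back_mem_off {i j : Fin n} (h : j ≠ i) : L.back j ∈ L.off i := by
  refine ⟨fun e => h (L.inj (congrArg (·.snd) e)), fun e => L.add_one_add_one_ne i ?_⟩
  have h1 : j = i + 1 := L.inj (congrArg (·.snd) e)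
  have h2 : j + 1 = i := L.inj (congrArg (·.fst) e)
  rw [← h1, h2]

theorem Loop.fwd_mem_off {i j : Fin n} (h : j ≠ i) : L.fwd j ∈ L.off i := by
  obtain ⟨h1, h2⟩ := L.back_mem_off h
  exact ⟨fun e => h2 (congrArg (·.symm) e), fun e => h1 (congrArg (·.symm) e)⟩

/-- The products of a field away from the edge `x_i x_{i+1}` and a matrix element of the link
`[x_i, x_{i+1}]` in the representation `c`. -/
def rightSpan (C : ClebschGordan s) (i : Fin n) (c : ℕ) : Submodule ℂ (Lam C cil) :=
  Submodule.span ℂ {A | ∃ P ∈ fieldSubalg C cil (L.off i), ∃ k m,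
    A = P * uMat C cil (L.back i) c k m}

theorem mul_mem_rightSpan {i : Fin n} {c : ℕ} {P A : Lam C cil}
    (hP : P ∈ fieldSubalg C cil (L.off i)) (hA : A ∈ rightSpan L C i c) :
    P * A ∈ rightSpan L C i c := by
  induction hA using Submodule.span_induction with
  | mem A h =>
    obtain ⟨Q, hQ, k, m, rfl⟩ := h
    rw [← mul_assoc]
    exact Submodule.subset_span ⟨_, mul_mem hP hQ, k, m, rfl⟩
  | zero => rw [mul_zero]; exact zero_mem _
  | add A B _ _ hA hB => rw [mul_add]; exact add_mem hA hB
  | smul z A _ hA => rw [mul_smul_comm]; exact Submodule.smul_mem _ _ hA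

/-- Exchange relations act on matrix indices and leave the label c alone, so a link variable moved
to the far right stays in the same representation. -/
theorem uMat_mul_fwd_mem (hs : s ≠ 0) {i j : Fin n} (hj : j ≠ i) (c b : ℕ) (k m : Idx c)
    (p t : Idx b) : uMat C cil (L.back i) c k m * uMat C cil (L.fwd j) b p t ∈
      rightSpan L C i c := by
  have hm : ∀ p v k u, uMat C cil (L.fwd j) b p v * uMat C cil (L.back i) c k u ∈
      rightSpan L C i c := fun p v k u =>
    Submodule.subset_span ⟨_, uMat_mem (L.fwd_mem_off hj) _ _ _, k, u, rfl⟩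
  by_cases h1 : j = i - 1
  · subst h1
    rw [← fwd_back_exchange]
    exact sum_mem fun u _ => sum_mem fun v _ => Submodule.smul_mem _ _ (hm _ _ _ _)
  by_cases h2 : i = j - 1
  · subst h2
    rw [back_fwd_exchange L hs]
    exact sum_mem fun u _ => sum_mem fun v _ => Submodule.smul_mem _ _ (hm _ _ _ _)
  rw [(back_fwd_commute L hj.symm h2 h1 c b k m p t).eq]
  exact hm _ _ _ _

theorem mul_fwd_mem_rightSpan (hs : s ≠ 0) {i j : Fin n} (hj : j ≠ i) (c b : ℕ) (p t : Idx b)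
    {A : Lam C cil} (hA : A ∈ rightSpan L C i c) :
    A * uMat C cil (L.fwd j) b p t ∈ rightSpan L C i c := by
  induction hA using Submodule.span_induction with
  | mem A h =>
    obtain ⟨Q, hQ, k, m, rfl⟩ := h
    rw [mul_assoc]
    exact mul_mem_rightSpan L hQ (uMat_mul_fwd_mem L hs hj _ _ _ _ _ _)
  | zero => rw [zero_mul]; exact zero_mem _
  | add A B _ _ hA hB => rw [add_mul]; exact add_mem hA hB
  | smul z A _ hA => rw [smul_mul_assoc]; exact Submodule.smul_mem _ _ hA

theorem mul_prod_mem_rightSpan (hs : s ≠ 0) {i : Fin n} (c : ℕ) {β : Fin n → ℕ}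
    (p t : ∀ i, Idx (β i)) {l : List (Fin n)} (hl : i ∉ l) {A : Lam C cil}
    (hA : A ∈ rightSpan L C i c) :
    A * (l.map fun j => uMat C cil (L.fwd j) (β j) (p j) (t j)).prod ∈ rightSpan L C i c := by
  induction l generalizing A with
  | nil => simpa using hA
  | cons j l ih =>
    rw [List.mem_cons, not_or] at hl
    rw [List.map_cons, List.prod_cons, ← mul_assoc]
    exact ih hl.2 (mul_fwd_mem_rightSpan L hs (Ne.symm hl.1) _ _ _ _ hA)

variable [DecidableEq V] {hs : s ≠ 0} {h : Lam C cil →ₗ[ℂ] ℂ}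

theorem IsHaar.eq_zero_of_mem_rightSpan [Finite V] (H : IsHaar C cil hs h)
    (hq : ∀ k : ℕ, 0 < k → (s ^ 2) ^ k ≠ 1) {i : Fin n} {c : ℕ} (hc : c ≠ 0) {A : Lam C cil}
    (hA : A ∈ rightSpan L C i c) : h A = 0 := by
  have hX : ∀ l ∈ L.off i, l ∉ ({L.back i} : Set G.Dart) ∧ l.symm ∉ ({L.back i} : Set G.Dart) :=
    fun l hl => ⟨hl.1, fun e => hl.2 (by
      rw [← L.back_symm, ← Set.mem_singleton_iff.mp e, SimpleGraph.Dart.symm_symm])⟩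
  induction hA using Submodule.span_induction with
  | mem A hA =>
    obtain ⟨P, hP, k, m, rfl⟩ := hA
    rw [H.factor _ _ hX P hP _ (uMat_mem (Set.mem_singleton _) _ _ _), H.uMat_eq_zero hq _ hc,
      mul_zero]
  | zero => exact map_zero h
  | add A B _ _ hA hB => rw [map_add, hA, hB, add_zero]
  | smul z A _ hA => rw [map_smul, hA, smul_zero]

/-- The pair on the edge i expands into the u^c. For c ≠ 0 the variable u^c can be pushed through Q
to the right end, where it factors off and integrates to zero; c = 0 leaves the scalar `pairing`. -/
theorem IsHaar.apply_mul_mul [Finite V] (H : IsHaar C cil hs h)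
    (hq : ∀ k : ℕ, 0 < k → (s ^ 2) ^ k ≠ 1) {i : Fin n} {P : Lam C cil}
    (hP : P ∈ fieldSubalg C cil (L.off i)) {β : Fin n → ℕ} (π ρ : ∀ i, Idx (β i))
    {l : List (Fin n)} (hl : i ∉ l) (a b : ℕ) (p r : Idx a) (p' r' : Idx b) :
    h (P * (uMat C cil (L.back i) a p r * uMat C cil (L.fwd i) b p' r') *
      (l.map fun j => uMat C cil (L.fwd j) (β j) (π j) (ρ j)).prod) =
    pairing C a b p r p' r' *
      h (P * (l.map fun j => uMat C cil (L.fwd j) (β j) (π j) (ρ j)).prod) := by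
  set Q := (l.map fun j => uMat C cil (L.fwd j) (β j) (π j) (ρ j)).prod with hQ
  have key : ∀ c, c ≠ 0 → ∀ k m, h (P * uMat C cil (L.back i) c k m * Q) = 0 := fun c hc k m =>
    H.eq_zero_of_mem_rightSpan L hq hc (mul_prod_mem_rightSpan L hs c π ρ hl
      (Submodule.subset_span ⟨P, hP, k, m, rfl⟩))
  rw [← L.back_symm, uMat_mul_symm_apply hs hq]
  simp only [Finset.mul_sum, Finset.sum_mul, mul_smul_comm, smul_mul_assoc, map_sum, map_smul,
    smul_eq_mul]
  by_cases hab : a = b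
  · subst hab
    rw [Finset.sum_eq_single 0]
    · rw [Finset.sum_eq_single 0 (fun k _ hk => absurd (idx_zero_eq _ _) hk) (by simp),
        Finset.sum_eq_single 0 (fun k _ hk => absurd (idx_zero_eq _ _) hk) (by simp), uMat_zero, Matrix.one_apply_eq, mul_one, pairing]
    · exact fun c _ hc => Finset.sum_eq_zero fun k _ => Finset.sum_eq_zero fun m _ => by
        rw [key c hc, mul_zero]
    · exact fun h => absurd (mem_channels (adm_self_zero a)) h
  · rw [pairing_ne hab, zero_mul]
    refine Finset.sum_eq_zero fun c hc => Finset.sum_eq_zero fun k _ =>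
      Finset.sum_eq_zero fun m _ => ?_
    rw [key c (fun h0 => not_adm_zero hab (h0 ▸ adm_of_mem hc)), mul_zero]

/-- The backward links are followed by the forward links in reversed order, so the pairs are nested;
the induction integrates the innermost one first. -/
theorem IsHaar.apply_prod [Finite V] (H : IsHaar C cil hs h)
    (hq : ∀ k : ℕ, 0 < k → (s ^ 2) ^ k ≠ 1) {β β' : Fin n → ℕ} (p r : ∀ i, Idx (β i))
    (p' r' : ∀ i, Idx (β' i)) {l : List (Fin n)} (hl : l.Nodup) :
    h ((l.map fun i => uMat C cil (L.back i) (β i) (p i) (r i)).prod *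
      (l.map fun i => uMat C cil (L.fwd i) (β' i) (p' i) (r' i)).reverse.prod) =
    (l.map fun i => pairing C (β i) (β' i) (p i) (r i) (p' i) (r' i)).prod := by
  induction l using List.reverseRecOn with
  | nil => simp [H.map_one]
  | append_singleton l i ih =>
    have hi : i ∉ l := fun hi => by
      rw [List.nodup_append] at hl
      exact hl.2.2 i hi i (List.mem_singleton_self i) rfl
    have hn : l.Nodup := (List.nodup_append.mp hl).1
    have hP : (l.map fun i => uMat C cil (L.back i) (β i) (p i) (r i)).prod ∈
        fieldSubalg C cil (L.off i) := by
      refine list_prod_mem fun x hx => ?_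
      obtain ⟨j, hj, rfl⟩ := List.mem_map.mp hx
      exact uMat_mem (L.back_mem_off (by rintro rfl; exact hi hj)) _ _ _
    have e := H.apply_mul_mul L hq hP p' r' (l := l.reverse) (by simpa using hi) (β i) (β' i)
      (p i) (r i) (p' i) (r' i)
    rw [List.map_reverse, ih hn] at e
    simp only [List.map_append, List.map_singleton, List.prod_append, List.prod_singleton,
      List.reverse_append, List.reverse_singleton]
    rw [mul_comm (List.prod _) (pairing _ _ _ _ _ _ _), ← e]
    simp only [mul_assoc]

end Integration

/-! ### Contribution of one vertex to the scalar product -/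

section VertexSums

variable {s : ℂ}

/-- R conserves the total weight, so the factor μ⁻¹ on the second leg in `sum_Rmat_mul_inv` can be
traded for one on the first leg. -/
theorem sum_muW_mul_Rmat_mul_inv (C : ClebschGordan s) (hs : s ≠ 0)
    (hq : ∀ k : ℕ, 0 < k → (s ^ 2) ^ k ≠ 1) (c a : ℕ) (t t' : Idx c) (y y' : Idx a) :
    ∑ x, ∑ r, (Rmat s c a)⁻¹ (r, y) (t, x) * Rmat s c a (t', x) (r, y') * (muW s c r)⁻¹ =
      if y = y' ∧ t' = t then (muW s c t')⁻¹ else 0 := by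
  have e : ∀ x r, (Rmat s c a)⁻¹ (r, y) (t, x) * Rmat s c a (t', x) (r, y') * (muW s c r)⁻¹ =
      (muW s a y' * (muW s c t')⁻¹) * ((muW s a x)⁻¹ *
        (Rmat s c a (t', x) (r, y') * (Rmat s c a)⁻¹ (r, y) (t, x))) := by
    intro x r
    by_cases h0 : Rmat s c a (t', x) (r, y') = 0
    · simp [h0]
    have hw := Rmat_weight C hs hq h0
    have h2 : muW s c t' * muW s a x = muW s c r * muW s a y' := by
      simp only [muW, ← zpow_add₀ (pow_ne_zero 2 hs)]
      exact congrArg _ hw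
    have n1 := muW_ne hs c t'
    have n2 := muW_ne hs a x
    have n3 := muW_ne hs c r
    have n4 := muW_ne hs a y'
    have h3 : (muW s c r)⁻¹ = muW s a y' * (muW s c t')⁻¹ * (muW s a x)⁻¹ := by
      field_simp
      linear_combination h2
    rw [h3]
    ring
  have e2 : ∑ x, ∑ r, (Rmat s c a)⁻¹ (r, y) (t, x) * Rmat s c a (t', x) (r, y') *
      (muW s c r)⁻¹ = (muW s a y' * (muW s c t')⁻¹) * ∑ x, ∑ r, (muW s a x)⁻¹ *
        (Rmat s c a (t', x) (r, y') * (Rmat s c a)⁻¹ (r, y) (t, x)) := by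
    simp only [e, Finset.mul_sum]
  have n4 := muW_ne hs a y'
  rw [e2, sum_Rmat_mul_inv C hs hq]
  split_ifs
  · field_simp
  · rw [mul_zero]

theorem sum_mul_sum_mul {ι κ : Type*} [Fintype ι] [Fintype κ] (f g : ι → κ → ℂ) (w : ι → ℂ) :
    ∑ u, (∑ z, f u z) * ((∑ z, g u z) * w u) = ∑ z, ∑ z', ∑ u, f u z * (g u z' * w u) := by
  simp only [Finset.sum_mul, Finset.mul_sum]
  rw [Finset.sum_comm]
  refine (Finset.sum_congr rfl fun z _ => Finset.sum_comm).trans ?_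
  rw [Finset.sum_comm]

theorem sum_ψ_mul_φ {C : ClebschGordan s} {b a c : ℕ} (hA : Adm b a c) (t : Idx c) :
    ∑ p, ∑ x, C.ψ b a c t (p, x) * C.φ b a c (p, x) t = 1 := by
  have e := congrFun (congrFun (C.ψ_φ_self b a c hA) t) t
  rwa [Matrix.mul_apply, Fintype.sum_prod_type, Matrix.one_apply_eq] at e

/-- The ribbon factors cancel and R⁻¹, R contract to the identity. Of the two factors μ_t and the
weight μ_t⁻¹ one μ_t survives, and ∑_t μ_t (ψφ)_{tt} is the quantum dimension. -/
theorem sum_outTw_mul_inTw (C : ClebschGordan s) (hs : s ≠ 0)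
    (hq : ∀ k : ℕ, 0 < k → (s ^ 2) ^ k ≠ 1) {b a c : ℕ} (hA : Adm b a c) :
    ∑ x, ∑ p, ∑ r, outTw C b a c x r p *
      (inTw C b a c x r p * ((muW s c r)⁻¹ * (∑ j, muW s c j)⁻¹)) = 1 := by
  have key : ∀ p, ∑ x, ∑ r, outTw C b a c x r p * (inTw C b a c x r p * (muW s c r)⁻¹) =
      ∑ t, ∑ y, muW s c t * (C.ψ b a c t (p, y) * C.φ b a c (p, y) t) := by
    intro p
    have e := sum_mul_sum_mul (fun (u : Idx a × Idx c) (z : Idx c × Idx a) =>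
      muW s c z.1 * (Rmat s c a)⁻¹ (u.2, z.2) (z.1, u.1) * C.ψ b a c z.1 (p, z.2))
      (fun u z => muW s c z.1 * Rmat s c a (z.1, u.1) (u.2, z.2) * C.φ b a c (p, z.2) z.1)
      (fun u => (muW s c u.2)⁻¹)
    simp only [Fintype.sum_prod_type] at e
    have e1 : ∀ x r, outTw C b a c x r p * (inTw C b a c x r p * (muW s c r)⁻¹) =
        (∑ t, ∑ y, muW s c t * (Rmat s c a)⁻¹ (r, y) (t, x) * C.ψ b a c t (p, y)) *
        ((∑ t, ∑ y, muW s c t * Rmat s c a (t, x) (r, y) * C.φ b a c (p, y) t) *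
          (muW s c r)⁻¹) := by
      intro x r
      have := ribbon_ne hs c
      rw [outTw_eq, inTw_eq]
      field_simp
    simp only [e1, e]
    refine Finset.sum_congr rfl fun t _ => Finset.sum_congr rfl fun y _ => ?_
    have e2 : ∀ t' y', ∑ x, ∑ r, muW s c t * (Rmat s c a)⁻¹ (r, y) (t, x) * C.ψ b a c t (p, y) *
        (muW s c t' * Rmat s c a (t', x) (r, y') * C.φ b a c (p, y') t' * (muW s c r)⁻¹) =
        (muW s c t * C.ψ b a c t (p, y) * (muW s c t' * C.φ b a c (p, y') t')) *
          if y = y' ∧ t' = t then (muW s c t')⁻¹ else 0 := by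
      intro t' y'
      rw [← sum_muW_mul_Rmat_mul_inv C hs hq]
      simp only [Finset.mul_sum]
      exact Finset.sum_congr rfl fun x _ => Finset.sum_congr rfl fun r _ => by ring
    simp only [e2]
    rw [Finset.sum_eq_single t, Finset.sum_eq_single y, if_pos ⟨rfl, rfl⟩]
    · have := muW_ne hs c t
      field_simp
    · intro y' _ hy
      rw [if_neg fun h => hy h.1.symm, mul_zero]
    · simp
    · intro t' _ ht
      exact Finset.sum_eq_zero fun y' _ => by rw [if_neg fun h => ht h.2, mul_zero]
    · simp
  simp only [← mul_assoc, ← Finset.sum_mul]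
  rw [Finset.sum_comm]
  simp only [mul_assoc, key]
  rw [Finset.sum_comm]
  simp only [← Finset.mul_sum, sum_ψ_mul_φ hA, mul_one]
  exact mul_inv_cancel₀ (sum_muW_ne C hs hq c)

/-- At a regular vertex ψφ = 1 leaves ∑ μ⁻¹ over the quantum dimension, which is again 1 because the
weights are symmetric under reversal. -/
theorem sum_outAt_mul_inAt (C : ClebschGordan s) (hs : s ≠ 0)
    (hq : ∀ k : ℕ, 0 < k → (s ^ 2) ^ k ≠ 1) {n : ℕ} [NeZero n] (α β : Fin n → ℕ) (i : Fin n)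
    (hA : Adm (β i) (α i) (β (i - 1))) :
    ∑ x, ∑ p, ∑ r, outAt C α β i x r p * (inAt C α β i x r p *
      ((muW s (β (i - 1)) r)⁻¹ * (∑ j, muW s (β (i - 1)) j)⁻¹)) = 1 := by
  by_cases h : i = 0
  · simp only [outAt, inAt, if_pos h]
    exact sum_outTw_mul_inTw C hs hq hA
  · simp only [outAt, inAt, if_neg h]
    simp only [← mul_assoc, ← Finset.sum_mul]
    have e : ∑ x, ∑ p, ∑ r, C.ψ (β i) (α i) (β (i - 1)) r (p, x) *
        C.φ (β i) (α i) (β (i - 1)) (p, x) r * (muW s (β (i - 1)) r)⁻¹ =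
        ∑ r, (∑ p, ∑ x, C.ψ (β i) (α i) (β (i - 1)) r (p, x) *
          C.φ (β i) (α i) (β (i - 1)) (p, x) r) * (muW s (β (i - 1)) r)⁻¹ := by
      simp only [Finset.sum_mul]
      rw [Finset.sum_comm]
      refine (Finset.sum_congr rfl fun p _ => Finset.sum_comm).trans ?_
      rw [Finset.sum_comm]
    rw [e]
    simp only [sum_ψ_mul_φ hA, one_mul, sum_muW_inv]
    exact mul_inv_cancel₀ (sum_muW_ne C hs hq _)

end VertexSums

/-! ### The scalar product -/

section ScalarProduct

variable {s : ℂ} {C : ClebschGordan s} {G : SimpleGraph V} {cil : Ciliation G} {n : ℕ}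
  [DecidableEq V] {hs : s ≠ 0} {h : Lam C cil →ₗ[ℂ] ℂ}

theorem IsHaar.apply_ofFn [NeZero n] [Finite V] (H : IsHaar C cil hs h)
    (hq : ∀ k : ℕ, 0 < k → (s ^ 2) ^ k ≠ 1) (L : Loop cil n) {β β' : Fin n → ℕ}
    (p r : ∀ i, Idx (β i)) (p' r' : ∀ i, Idx (β' i)) :
    h ((List.ofFn fun i => uMat C cil (L.back i) (β i) (p i) (r i)).prod *
      (List.ofFn fun i => uMat C cil (L.fwd i) (β' i) (p' i) (r' i)).reverse.prod) =
    ∏ i, pairing C (β i) (β' i) (p i) (r i) (p' i) (r' i) := by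
  have := H.apply_prod L hq p r p' r' (List.nodup_finRange n)
  simpa only [← List.ofFn_eq_map, List.prod_ofFn] using this

theorem sum_sum_pairing (hs : s ≠ 0) (hq : ∀ k : ℕ, 0 < k → (s ^ 2) ^ k ≠ 1) {β : Fin n → ℕ}
    (p r : ∀ i, Idx (β i)) (f : (∀ i, Idx (β i)) → (∀ i, Idx (β i)) → ℂ) :
    ∑ p' : ∀ i, Idx (β i), ∑ r' : ∀ i, Idx (β i),
      f p' r' * ∏ i, pairing C (β i) (β i) (p i) (r i) (p' i) (r' i) =
    f r p * ∏ i, ((muW s (β i) (r i))⁻¹ * (∑ j, muW s (β i) j)⁻¹) := by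
  simp only [pairing_self hs hq]
  rw [Finset.sum_eq_single r, Finset.sum_eq_single p]
  · simp
  · intro r' _ hr
    obtain ⟨i, hi⟩ := Function.ne_iff.mp hr
    rw [Finset.prod_eq_zero (Finset.mem_univ i) (if_neg fun e => hi e.2), mul_zero]
  · simp
  · intro p' _ hp
    obtain ⟨i, hi⟩ := Function.ne_iff.mp hp
    exact Finset.sum_eq_zero fun r' _ => by
      rw [Finset.prod_eq_zero (Finset.mem_univ i) (if_neg fun e => hi e.1), mul_zero]
  · simp

theorem IsHaar.sum_outState_mul_inState [NeZero n] [Finite V] (H : IsHaar C cil hs h)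
    (hq : ∀ k : ℕ, 0 < k → (s ^ 2) ^ k ≠ 1) (L : Loop cil n) (α β : Fin n → ℕ)
    (hA : ∀ i, Adm (β i) (α i) (β (i - 1))) (β' : Fin n → ℕ) :
    h (∑ a : ∀ i, Idx (α i), outState C L α β a * inState C L α β' a) =
      ∏ i, if β i = β' i then 1 else 0 := by
  have e : h (∑ a : ∀ i, Idx (α i), outState C L α β a * inState C L α β' a) =
      ∑ a : ∀ i, Idx (α i), ∑ p : ∀ i, Idx (β i), ∑ r : ∀ i, Idx (β i),
        (∏ i, outAt C α β i (a i) (r (i - 1)) (p i)) *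
          ∑ p' : ∀ i, Idx (β' i), ∑ r' : ∀ i, Idx (β' i),
            (∏ i, inAt C α β' i (a i) (p' (i - 1)) (r' i)) *
              ∏ i, pairing C (β i) (β' i) (p i) (r i) (p' i) (r' i) := by
    simp only [outState, inState, outCoeff_eq, inCoeff_eq, outVert_apply, inVert_apply,
      Finset.sum_mul, Finset.mul_sum, smul_mul_assoc, mul_smul_comm, map_sum, map_smul,
      smul_eq_mul, H.apply_ofFn hq]
    refine Finset.sum_congr rfl fun a _ => (sum_comm_pairs _).trans ?_
    refine Finset.sum_congr rfl fun p _ => Finset.sum_congr rfl fun r _ =>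
      Finset.sum_congr rfl fun p' _ => Finset.sum_congr rfl fun r' _ => mul_left_comm _ _ _
  rw [e]
  by_cases hβ : β = β'
  · subst hβ
    simp only [sum_sum_pairing hs hq, if_true, Finset.prod_const_one]
    -- The orthogonality weight of the link i - 1 depends on r_{i-1} and is assigned to the vertex
    -- i, where this index ends.
    have e1 : ∀ r : ∀ i, Idx (β i), ∏ i, ((muW s (β i) (r i))⁻¹ * (∑ j, muW s (β i) j)⁻¹) =
        ∏ i, ((muW s (β (i - 1)) (r (i - 1)))⁻¹ * (∑ j, muW s (β (i - 1)) j)⁻¹) := fun r =>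
      (Fintype.prod_equiv (Equiv.subRight (1 : Fin n)) _ _ fun i => rfl).symm
    simp only [e1, ← Finset.prod_mul_distrib]
    have e2 : ∀ a p, _ := fun (a : ∀ i, Idx (α i)) (p : ∀ i, Idx (β i)) =>
      (sum_pi_shift (J := fun i => Idx (β i)) (fun y => ∏ i, outAt C α β i (a i) (y i) (p i) *
        (inAt C α β i (a i) (y i) (p i) *
          ((muW s (β (i - 1)) (y i))⁻¹ * (∑ j, muW s (β (i - 1)) j)⁻¹)))).symm
    simp only [e2]
    -- With r renumbered by vertices, a_i, p_i and r_{i-1} occur at the vertex i only, so the total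
    -- sum is the product of the vertex sums.
    have e3 : ∏ i, ∑ x, ∑ p, ∑ r, outAt C α β i x r p * (inAt C α β i x r p *
        ((muW s (β (i - 1)) r)⁻¹ * (∑ j, muW s (β (i - 1)) j)⁻¹)) = 1 :=
      Finset.prod_eq_one fun i _ => sum_outAt_mul_inAt C hs hq α β i (hA i)
    simp only [← List.prod_ofFn, prod_ofFn_sum] at e3 ⊢
    exact e3
  · obtain ⟨i, hi⟩ := Function.ne_iff.mp hβ
    rw [Finset.prod_eq_zero (Finset.mem_univ i) (if_neg hi)]
    refine Finset.sum_eq_zero fun a _ => Finset.sum_eq_zero fun p _ =>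
      Finset.sum_eq_zero fun r _ => mul_eq_zero_of_right _ ?_
    refine Finset.sum_eq_zero fun p' _ => Finset.sum_eq_zero fun r' _ => ?_
    exact mul_eq_zero_of_right _ (Finset.prod_eq_zero (Finset.mem_univ i) (pairing_ne hi _ _ _ _))

end ScalarProduct

end LatticeGauge

end

theorem mainTheorem8 (s : ℂ) (hs : s ≠ 0) (hq : ∀ k : ℕ, 0 < k → (s ^ 2) ^ k ≠ 1)
    (C : LatticeGauge.ClebschGordan s) {V : Type*} [Finite V] [DecidableEq V]
    {G : SimpleGraph V} (cil : LatticeGauge.Ciliation G) {n : ℕ} [NeZero n]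
    (L : LatticeGauge.Loop cil n) (α β : Fin n → ℕ) :
    (∀ a : ∀ i, LatticeGauge.Idx (α i),
      LatticeGauge.outState C L.rotate (fun i => α (i - 1)) (fun i => β (i - 1))
        (fun i => a (i - 1)) = LatticeGauge.outState C L α β a) ∧
    (∀ a : ∀ i, LatticeGauge.Idx (α i),
      LatticeGauge.inState C L.rotate (fun i => α (i - 1)) (fun i => β (i - 1))
        (fun i => a (i - 1)) = LatticeGauge.inState C L α β a) ∧
    (∀ a : ∀ i, LatticeGauge.Idx (α i),
      LatticeGauge.coaction C cil hs (LatticeGauge.outState C L α β a) =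
        ∑ b : ∀ i, LatticeGauge.Idx (α i), LatticeGauge.outState C L α β b ⊗ₜ[ℂ]
          (List.ofFn fun i => LatticeGauge.gAt C true (L.x i) (α i) (b i) (a i)).prod) ∧
    (∀ a : ∀ i, LatticeGauge.Idx (α i),
      LatticeGauge.coaction C cil hs (LatticeGauge.inState C L α β a) =
        ∑ b : ∀ i, LatticeGauge.Idx (α i), LatticeGauge.inState C L α β b ⊗ₜ[ℂ]
          (List.ofFn fun i => LatticeGauge.gAt C false (L.x i) (α i) (a i) (b i)).prod) ∧
    (∀ h : LatticeGauge.Lam C cil →ₗ[ℂ] ℂ, LatticeGauge.IsHaar C cil hs h →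
      (∀ i, LatticeGauge.Adm (β i) (α i) (β (i - 1))) → ∀ β' : Fin n → ℕ,
        h (∑ a : ∀ i, LatticeGauge.Idx (α i),
          LatticeGauge.outState C L α β a * LatticeGauge.inState C L α β' a) =
        ∏ i, if β i = β' i then 1 else 0) :=
  ⟨LatticeGauge.outState_rotate C hs hq L α β, LatticeGauge.inState_rotate C hs hq L α β,
    LatticeGauge.coaction_outState C hs hq L α β, LatticeGauge.coaction_inState C hs hq L α β,
    fun _ H hA β' => H.sum_outState_mul_inState hq L α β hA β'⟩
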